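/- **Conventions.** A *univariate GMM* is a distribution $F=\sum_{i=1}^{n} w_i\,\mathcal N(\mu_i,\sigma_i^2)$ with $w_i>0$, $\sum_i w_i=1$, $\sigma_i^2>0$. It is in *near isotropic position* if its mean lies in $[-1,1]$ and its variance in $[1/2,2]$ (isotropic position, mean $0$ and variance $1$, is a special case). The parameter distance is $D_p(\mathcal N(\mu_1,\sigma_1^2),\mathcal N(\mu_2,\sigma_2^2))=|\mu_1-\mu_2|+|\sigma_1^2-\sigma_2^2|$. A mixture $\hat F$ of $k'\le n$ Gaussians is an *$\epsilon$-correct subdivision* of $F$ if there is an onto map $\pi:[n]\to[k']$ with $|\sum_{i:\pi(i)=j}w_i-\hat w_j|\le\epsilon$ for all $j\in[k']$ and $D_p(F_i,\hat F_{\pi(i)})\le\epsilon$ for all $i\in[n]$. Fix $k\ge1$. The algorithms below depend on positive constants $C,C_B,C_1,C_2,C_3,c_\alpha,c_\gamma$ and natural numbers $c_B,e_\alpha$. Put $Q(\epsilon,\delta)=(\epsilon\delta)^{c_B}/C_B$, $R=Q/(C_1k^4)$, $S=R/(C_2k^4)$; the *window* at precision $\epsilon$ is the interval $[R(\epsilon,\delta),\epsilon]$.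 **Basic Univariate Algorithm$(\epsilon,\delta)$.** Take $m=\lceil 1/Q(\epsilon,\delta)\rceil$ samples and compute the first $4k-2$ sample moments. Let $\alpha=c_\alpha\epsilon^{e_\alpha}$ and $\gamma=1/\lceil c_\gamma\alpha^{-(4k-1)}\rceil$. Go through all mixtures of at most $k$ Gaussians whose parameters are multiples of $\gamma$ (the weights at least $\epsilon/2$ and summing to $1$; pairwise parameter distances at least $\epsilon/2$; means of absolute value at most $2/\epsilon$; variances in $(1/2,2/\epsilon]$), and return the first one whose first $4k-2$ moments all are within $\alpha$ of the sample moments. If there is none, the run has no estimate. **General Univariate Algorithm$(\epsilon,\delta)$.** Let $\delta'=\delta/(2k^2)$, $\epsilon_1=\epsilon/(Ck^{k^2})$, and $\epsilon_{i+1}=S(\epsilon_i,\delta')$. Add independent $\mathcal N(0,1/2)$ noise to every sample. For $i=1,\dots,k^2$ run the Basic Univariate Algorithm$(\epsilon_i,\delta')$ on fresh noisy samples, to get estimates $\hat F^i$. Search for a set $T\subseteq[k^2]$ with $|T|>k^2/2$ such that the runs in $T$ all have an estimate and these estimates, in decreasing order of the index, form a $C_3k\epsilon_1$-correct chain (each estimate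 is a $C_3k\epsilon_1$-correct subdivision of the preceding one). If such a $T$ is found, return $\hat F^{\min T}$ with $1/2$ subtracted from all its variances; otherwise output FAIL. *Running time* is the number of steps in a model where drawing one sample, drawing one value of noise, one arithmetic operation or comparison of reals, and one loop step cost one step each, and rounding $x$ up to a natural number costs $\lceil x\rceil+1$ steps (with $\lceil x\rceil=0$ for $x\le 0$). **Theorem.** For every $k\ge1$ there are constants $C,C_B,C_1,C_2,C_3,c_\alpha,c_\gamma>0$ and $c_B,e_\alpha\in\mathbb N$, depending only on $k$, such that: 1. for $0<\epsilon,\delta\le1$ the $k^2$ windows $[R(\epsilon_i,\delta'),\epsilon_i]$ are nonempty and pairwise disjoint; 2. there are $A,d$, depending only on $k$ and these constants, such that for all $\epsilon,\delta>0$ the running time of the General Univariate Algorithm is at most $A(1+1/\epsilon+1/\delta)^d$, for all values of the samples and of the noise; 3. for all $\epsilon,\delta>0$ and every GMM $F$ of at most $k$ univariate Gaussians that is in near isotropic position and has all weights at least $\epsilon$ (no separation of the components is assumed), the General Univariate Algorithm, given independent samples from $F$, returns with probability at least $1-\delta$ a GMM $\hat F$ of $k'\le k$ Gaussians that is an $\epsilon$-correct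 subdivision of $F$. -/

import Mathlib

open MeasureTheory ProbabilityTheory

noncomputable section

/-! ### Univariate Gaussian mixtures -/

/-- A weighted univariate Gaussian `weight * N(mean, var)`; `var` is the variance. -/
structure Component where
  weight : ℝ
  mean : ℝ
  var : ℝ

/-- The list of parameters of a mixture of `size` univariate Gaussians. -/
structure Mixture where
  size : ℕ
  comp : Fin size → Component

namespace Mixture

/-- The parameters are those of a Gaussian mixture model (GMM): the weights are positive and
sum to one, and the variances are positive. -/
def IsGMM (F : Mixture) : Prop :=
  (∀ i, 0 < (F.comp i).weight) ∧ ∑ i, (F.comp i).weight = 1 ∧ ∀ i, 0 < (F.comp i).var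

/-- The distribution on the real line with density `∑ i, w i * N(μ i, σ i ^ 2, x)`. -/
def law (F : Mixture) : Measure ℝ :=
  ∑ i, ENNReal.ofReal (F.comp i).weight •
    gaussianReal (F.comp i).mean (F.comp i).var.toNNReal

/-- Near isotropic position: mean in `[-1, 1]` and variance in `[1/2, 2]`.
(Isotropic position is mean `0` and variance `1`.) -/
def NearIsotropic (F : Mixture) : Prop :=
  |∫ x, x ∂F.law| ≤ 1 ∧ 1 / 2 ≤ variance id F.law ∧ variance id F.law ≤ 2

end Mixture

/-- Parameter distance `|μ₁ - μ₂| + |σ₁² - σ₂²|` of two univariate Gaussians. -/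
def paramDist (a b : Component) : ℝ := |a.mean - b.mean| + |a.var - b.var|

/-- `G` is an `ε`-correct subdivision of `F`. -/
def IsCorrectSubdivision (ε : ℝ) (F G : Mixture) : Prop :=
  G.size ≤ F.size ∧ ∃ π : Fin F.size → Fin G.size, Function.Surjective π ∧
    (∀ j, |∑ i with π i = j, (F.comp i).weight - (G.comp j).weight| ≤ ε) ∧
    ∀ i, paramDist (F.comp i) (G.comp (π i)) ≤ ε

/-! ### Programs with unit-cost real arithmetic, a sample oracle and a noise oracle -/

/-- The four arithmetic operations. -/
inductive ArithOp where
  | add | sub | mul | div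

/-- The value of an arithmetic operation. -/
def ArithOp.eval : ArithOp → ℝ → ℝ → ℝ
  | .add, x, y => x + y
  | .sub, x, y => x - y
  | .mul, x, y => x * y
  | .div, x, y => x / y

/-- Programs, built from the following elementary instructions: draw a sample from the oracle,
draw Gaussian noise, do one arithmetic operation, compare two reals, round a real up to a natural
number, and one step of bookkeeping (such as advancing and testing a loop counter). -/
inductive Prog (α : Type) : Type where
  | ret (a : α) : Prog α
  | sample (cont : ℝ → Prog α) : Prog α
  | noise (cont : ℝ → Prog α) : Prog α
  | arith (op : ArithOp) (x y : ℝ) (cont : ℝ → Prog α) : Prog α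
  | le (x y : ℝ) (cont : Bool → Prog α) : Prog α
  | ceil (x : ℝ) (cont : ℕ → Prog α) : Prog α
  | tick (cont : Prog α) : Prog α

namespace Prog

/-- Sequential composition. -/
def bind {α β : Type} : Prog α → (α → Prog β) → Prog β
  | ret a, f => f a
  | sample c, f => sample fun x => (c x).bind f
  | noise c, f => noise fun x => (c x).bind f
  | arith op x y c, f => arith op x y fun r => (c r).bind f
  | le x y c, f => le x y fun b => (c b).bind f
  | ceil x c, f => ceil x fun n => (c n).bind f
  | tick c, f => tick (c.bind f)

instance : Monad Prog where
  pure := ret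
  bind := bind

/-- The output of a program when the successive samples are `x 0, x 1, …` and the successive
noise values are `z 0, z 1, …`. -/
def run {α : Type} : Prog α → (ℕ → ℝ) → (ℕ → ℝ) → α
  | ret a, _, _ => a
  | sample c, x, z => (c (x 0)).run (fun n => x (n + 1)) z
  | noise c, x, z => (c (z 0)).run x (fun n => z (n + 1))
  | arith op a b c, x, z => (c (op.eval a b)).run x z
  | le a b c, x, z => (c (decide (a ≤ b))).run x z
  | ceil a c, x, z => (c ⌈a⌉₊).run x z
  | tick c, x, z => c.run x z

/-- The running time on given samples and noise values. Every instruction costs one step, except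
for rounding up, which is charged for counting from `0` to the result. -/
def steps {α : Type} : Prog α → (ℕ → ℝ) → (ℕ → ℝ) → ℕ
  | ret _, _, _ => 0
  | sample c, x, z => (c (x 0)).steps (fun n => x (n + 1)) z + 1
  | noise c, x, z => (c (z 0)).steps x (fun n => z (n + 1)) + 1
  | arith op a b c, x, z => (c (op.eval a b)).steps x z + 1
  | le a b c, x, z => (c (decide (a ≤ b))).steps x z + 1
  | ceil a c, x, z => (c ⌈a⌉₊).steps x z + (⌈a⌉₊ + 1)
  | tick c, x, z => c.steps x z + 1

/-! Instructions as programs. -/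

def addP (x y : ℝ) : Prog ℝ := arith .add x y ret
def subP (x y : ℝ) : Prog ℝ := arith .sub x y ret
def mulP (x y : ℝ) : Prog ℝ := arith .mul x y ret
def divP (x y : ℝ) : Prog ℝ := arith .div x y ret
def leP (x y : ℝ) : Prog Bool := le x y ret
def ceilP (x : ℝ) : Prog ℕ := ceil x ret
def tickP : Prog Unit := tick (ret ())

/-- A sample of the oracle with added noise. -/
def noisySample : Prog ℝ :=
  sample fun x => noise fun z => arith .add x z ret

/-! Arithmetic and loops. -/

/-- `|x|`. -/
def absP (x : ℝ) : Prog ℝ := do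
  if ← leP 0 x then pure x else subP 0 x

/-- `x ^ n` by repeated multiplication. -/
def powP (x : ℝ) : ℕ → Prog ℝ
  | 0 => pure 1
  | n + 1 => do
    let y ← powP x n
    mulP y x

/-- Compute `f 0, …, f (n - 1)`, one after the other. -/
def forFin {β : Type} : (n : ℕ) → (Fin n → Prog β) → Prog (Fin n → β)
  | 0, _ => pure Fin.elim0
  | n + 1, f => do
    tickP
    let b ← f 0
    let t ← forFin n fun i => f i.succ
    pure (Fin.cons b t)

/-- The sum of the results of `f 0, …, f (n - 1)`. -/
def sumFin : (n : ℕ) → (Fin n → Prog ℝ) → Prog ℝ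
  | 0, _ => pure 0
  | n + 1, f => do
    tickP
    let a ← f 0
    let s ← sumFin n fun i => f i.succ
    addP a s

/-- Do all the tests `f 0, …, f (n - 1)` succeed? -/
def allFin : (n : ℕ) → (Fin n → Prog Bool) → Prog Bool
  | 0, _ => pure true
  | n + 1, f => do
    tickP
    if ← f 0 then allFin n fun i => f i.succ else pure false

/-- Does one of the tests `f 0, …, f (n - 1)` succeed? -/
def anyFin : (n : ℕ) → (Fin n → Prog Bool) → Prog Bool
  | 0, _ => pure false
  | n + 1, f => do
    tickP
    if ← f 0 then pure true else anyFin n fun i => f i.succ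

/-- Run `f` on the entries of a list until it returns a result. -/
def firstSome {β γ : Type} (f : β → Prog (Option γ)) : List β → Prog (Option γ)
  | [] => pure none
  | b :: l => do
    tickP
    match ← f b with
    | some c => pure (some c)
    | none => firstSome f l

/-- Run `f` on all `n`-tuples of entries of `l` (by `n` nested loops) until it returns a result. -/
def searchTuples {β γ : Type} (l : List β) :
    (n : ℕ) → ((Fin n → β) → Prog (Option γ)) → Prog (Option γ)
  | 0, f => f Fin.elim0
  | n + 1, f => firstSome (fun b => searchTuples l n fun t => f (Fin.cons b t)) l

/-- Draw `m` noisy samples. -/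
def draw : ℕ → Prog (List ℝ)
  | 0 => pure []
  | m + 1 => do
    let x ← noisySample
    let xs ← draw m
    pure (x :: xs)

/-- The sum of the `j`-th powers of the entries of a list. -/
def powerSum (j : ℕ) : List ℝ → Prog ℝ
  | [] => pure 0
  | x :: xs => do
    let y ← powP x j
    let s ← powerSum j xs
    addP y s

/-- The pair of the `n`-th and the `(n + 1)`-st moment of `N(μ, v)`, by the recursion
`M (n + 2) = μ * M (n + 1) + (n + 1) * v * M n`. -/
def gaussMoments (μ v : ℝ) : ℕ → Prog (ℝ × ℝ)
  | 0 => pure (1, μ)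
  | n + 1 => do
    let p ← gaussMoments μ v n
    let a ← mulP μ p.2
    let b ← mulP v p.1
    let c ← mulP ((n + 1 : ℕ) : ℝ) b
    let d ← addP a c
    pure (p.2, d)

/-- The `j`-th moment of a Gaussian mixture. -/
def mixtureMoment (F : Mixture) (j : ℕ) : Prog ℝ :=
  sumFin F.size fun i => do
    let p ← gaussMoments (F.comp i).mean (F.comp i).var j
    mulP (F.comp i).weight p.1

/-- The parameter distance. -/
def paramDistP (a b : Component) : Prog ℝ := do
  let d ← absP (← subP a.mean b.mean)
  let e ← absP (← subP a.var b.var)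
  addP d e

/-- Test whether `G` is an `η`-correct subdivision of `F`, by trying all the maps `π`. -/
def isSubdivision (η : ℝ) (F G : Mixture) : Prog Bool := do
  let r ← searchTuples (List.finRange G.size) F.size fun π => do
    let onto ← allFin G.size fun j => anyFin F.size fun i => do
      tickP
      pure (decide (π i = j))
    let weights ← allFin G.size fun j => do
      let s ← sumFin F.size fun i => do
        tickP
        pure (if π i = j then (F.comp i).weight else 0)
      let d ← absP (← subP s (G.comp j).weight)
      leP d η
    let dists ← allFin F.size fun i => do
      let d ← paramDistP (F.comp i) (G.comp (π i))
      leP d η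
    pure (if onto && weights && dists then some () else none)
  pure r.isSome

end Prog

/-! ### The constants and the windows -/

/-- The constants left open in the description of the algorithm. -/
structure Constants where
  /-- the first precision is `ε / (C * k ^ k ^ 2)` -/
  C : ℝ
  /-- with precision `ε` and error probability `δ`, the Basic Univariate Algorithm takes
  `CB * (ε * δ) ^ (-cB)` samples, rounded up -/
  CB : ℝ
  cB : ℕ
  /-- `R = Q / (C₁ * k ^ 4)` -/
  C₁ : ℝ
  /-- `S = R / (C₂ * k ^ 4)` -/
  C₂ : ℝ
  /-- consecutive estimates in a chain are `Cchain * k * ε₁`-correct subdivisions -/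
  Cchain : ℝ
  /-- moments are compared with accuracy `α = cα * ε ^ eα` -/
  cα : ℝ
  eα : ℕ
  /-- the mesh width is `γ = 1 / N`, where `N` is `cγ * α ^ (-(4 * k - 1))` rounded up -/
  cγ : ℝ
  C_pos : 0 < C
  CB_pos : 0 < CB
  C₁_pos : 0 < C₁
  C₂_pos : 0 < C₂
  Cchain_pos : 0 < Cchain
  cα_pos : 0 < cα
  cγ_pos : 0 < cγ

namespace Constants

/-- The inverse of the number of samples of the Basic Univariate Algorithm. -/
def Q (K : Constants) (ε δ : ℝ) : ℝ := (ε * δ) ^ K.cB / K.CB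

def R (K : Constants) (k : ℕ) (ε δ : ℝ) : ℝ := K.Q ε δ / (K.C₁ * (k : ℝ) ^ 4)

def S (K : Constants) (k : ℕ) (ε δ : ℝ) : ℝ := K.R k ε δ / (K.C₂ * (k : ℝ) ^ 4)

/-- The window at precision `ε`. -/
def window (K : Constants) (k : ℕ) (ε δ : ℝ) : Set ℝ := Set.Icc (K.R k ε δ) ε

/-- The error probability granted to each run of the Basic Univariate Algorithm. -/
def errorProb (k : ℕ) (δ : ℝ) : ℝ := δ / (2 * (k : ℝ) ^ 2)

/-- The precisions `ε₁, ε₂, …` (numbered from `0`): `ε₁ = ε / (C * k ^ k ^ 2)` and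
`ε_{i+1} = S(ε_i)`. -/
def precision (K : Constants) (k : ℕ) (ε δ : ℝ) : ℕ → ℝ
  | 0 => ε / (K.C * (k : ℝ) ^ k ^ 2)
  | i + 1 => K.S k (precision K k ε δ i) (errorProb k δ)

end Constants

/-! ### The Basic Univariate Algorithm -/

namespace Prog

/-- The mesh: indices `(a, b, c)` of the components with weight `a * γ`, mean `(b - M) * γ` and
variance `c * γ`. -/
def mesh (N M : ℕ) : List (ℕ × ℕ × ℕ) :=
  List.product (List.range (N + 1)) (List.product (List.range (2 * M + 1)) (List.range (M + 1)))

/-- The candidate with given mesh indices. -/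
def candidate (γ : ℝ) (M n : ℕ) (t : Fin n → ℕ × ℕ × ℕ) : Prog Mixture := do
  let comps ← forFin n fun i => do
    let w ← mulP ((t i).1 : ℝ) γ
    let b ← subP ((t i).2.1 : ℝ) (M : ℝ)
    let μ ← mulP b γ
    let v ← mulP ((t i).2.2 : ℝ) γ
    pure (Component.mk w μ v)
  pure ⟨n, comps⟩

/-- The conditions on a candidate: the weights are at least `ε / 2` and sum to one, any two
components have parameter distance at least `ε / 2`, and `|μ| ≤ 2 / ε`, `1 / 2 < σ² ≤ 2 / ε`.
(The variances of the mixture that is to be learned are at least `1 / 2`.) -/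
def admissible (ε : ℝ) (F : Mixture) : Prog Bool := do
  let half ← divP ε 2
  let bound ← divP 2 ε
  let each ← allFin F.size fun i => do
    let b₁ ← leP half (F.comp i).weight
    let a ← absP (F.comp i).mean
    let b₂ ← leP a bound
    let b₃ ← leP (F.comp i).var bound
    let b₄ ← leP (F.comp i).var (1 / 2)
    pure (b₁ && b₂ && b₃ && !b₄)
  let s ← sumFin F.size fun i => pure (F.comp i).weight
  let s₁ ← leP s 1
  let s₂ ← leP 1 s
  let sep ← allFin F.size fun i => allFin F.size fun j =>
    if i = j then pure true else do
      let d ← paramDistP (F.comp i) (F.comp j)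
      leP half d
  pure (each && s₁ && s₂ && sep)

/-- The Basic Univariate Algorithm with precision `ε` and error probability `δ`, for the mixture
underlying the noisy samples, which is looked for among the mixtures of at most `k` Gaussians:
compute the first `4 * k - 2` sample moments, and return the first candidate in the mesh whose
first `4 * k - 2` moments all are within `α` of the sample moments. -/
def basicUnivariate (K : Constants) (k : ℕ) (ε δ : ℝ) : Prog (Option Mixture) := do
  let p ← powP (← mulP ε δ) K.cB
  let m ← ceilP (← divP K.CB p)
  let xs ← draw m
  let sampleMoments ← forFin (4 * k - 2) fun j => do
    let s ← powerSum (j + 1) xs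
    divP s (m : ℝ)
  let α ← mulP K.cα (← powP ε K.eα)
  let N ← ceilP (← divP K.cγ (← powP α (4 * k - 1)))
  let γ ← divP 1 (N : ℝ)
  let bound ← divP 2 ε
  let M ← ceilP (← mulP bound (N : ℝ))
  firstSome (fun n => searchTuples (mesh N M) (n + 1) fun t => do
      let F ← candidate γ M (n + 1) t
      if ← admissible ε F then
        let ok ← allFin (4 * k - 2) fun j => do
          let q ← mixtureMoment F (j + 1)
          let d ← absP (← subP q (sampleMoments j))
          leP d α
        pure (if ok then some F else none)
      else pure none)
    (List.range k)

/-! ### The General Univariate Algorithm -/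

/-- `S(ε, δ)`. -/
def nextPrecision (K : Constants) (k : ℕ) (ε δ : ℝ) : Prog ℝ := do
  let p ← powP (← mulP ε δ) K.cB
  let q ← divP p K.CB
  let r ← divP q (K.C₁ * (k : ℝ) ^ 4)
  divP r (K.C₂ * (k : ℝ) ^ 4)

/-- Run the Basic Univariate Algorithm (on fresh samples) with `n` successive precisions, of which
`ε` is the first. -/
def runBasic (K : Constants) (k : ℕ) (δ : ℝ) : (n : ℕ) → ℝ → Prog (Fin n → Option Mixture)
  | 0, _ => pure Fin.elim0
  | n + 1, ε => do
    let F ← basicUnivariate K k ε δ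
    let ε' ← nextPrecision K k ε δ
    let Fs ← runBasic K k δ n ε'
    pure (Fin.cons F Fs)

/-- Go through a list of indices, skip those outside `T`, and check that the estimates at the
others form an `η`-correct chain: each is an `η`-correct subdivision of the one before it. If so,
return the last of these estimates. The argument `prev` is the preceding estimate, if any. -/
def chainLast {n : ℕ} (η : ℝ) (est : Fin n → Option Mixture) (T : Fin n → Bool) :
    List (Fin n) → Option Mixture → Prog (Option Mixture)
  | [], prev => pure prev
  | i :: l, prev => do
    tickP
    if T i then
      match est i, prev with
      | none, _ => pure none
      | some G, none => chainLast η est T l (some G)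
      | some G, some F =>
        if ← isSubdivision η F G then chainLast η est T l (some G) else pure none
    else chainLast η est T l prev

/-- Subtract `1 / 2` from all the variances. -/
def deconvolve (F : Mixture) : Prog Mixture := do
  let comps ← forFin F.size fun i => do
    let v ← subP (F.comp i).var (1 / 2)
    pure (Component.mk (F.comp i).weight (F.comp i).mean v)
  pure ⟨F.size, comps⟩

/-- The General Univariate Algorithm; `none` stands for FAIL. It runs the Basic Univariate
Algorithm with `k ^ 2` precisions, looks for a set `T` of more than half of the runs whose
estimates, in decreasing order of the indices (from the finest precision to the coarsest), form a
correct chain, and returns the last one of them with the added noise taken out. -/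
def generalUnivariate (K : Constants) (k : ℕ) (ε δ : ℝ) : Prog (Option Mixture) := do
  let ε₁ ← divP ε (K.C * (k : ℝ) ^ k ^ 2)
  let δ' ← divP δ (2 * (k : ℝ) ^ 2)
  let η ← mulP (K.Cchain * k) ε₁
  let est ← runBasic K k δ' (k ^ 2) ε₁
  let result ← searchTuples [true, false] (k ^ 2) fun T => do
    let card ← sumFin (k ^ 2) fun i => pure (if T i then 1 else 0)
    if ← leP card ((k : ℝ) ^ 2 / 2) then pure none
    else chainLast η est T (List.finRange (k ^ 2)).reverse none
  match result with
  | none => pure none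
  | some F => do
    let G ← deconvolve F
    pure (some G)

end Prog

end

/-! Adding the noise raises every variance of `F` by 1/2 and leaves weights and means alone, so it
suffices to learn the noisy mixture. Three things carry the proof: a quantitative identifiability
theorem for separated mixtures, a pigeonhole argument that removes the separation assumption, and
Chebyshev's inequality for the sample moments.

Identifiability (`exists_matching`). The difference of two mixtures of at most k Gaussians is a
signed combination of N ≤ 2k Gaussians, and one has to show that small moments up to order 2N - 2 ≤
4k - 2 force small coefficients. A nonzero combination f of N Gaussians with distinct variances has
at most 2N - 2 zeros (`encard_zeros_sum_exp_le`): after multiplication by the inverse of the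
narrowest Gaussian's quadratic exponential, f becomes one pure exponential plus the Laplace
transform of a combination of N - 1 Gaussians, and a Laplace transform has no more zeros than its
original has sign changes (`encard_zeros_laplace_le`, by Rolle's theorem). Hence some polynomial p
of degree at most 2N - 2 has the signs of f, up to a global sign. The integral of p f is then small
because the moments are small, and it is the integral of a nonnegative function.

To bound it from below, all variances are shifted by one common number so that the least of them
becomes tiny. As polynomials in the variance the moments satisfy the heat equation, so small moments
stay small under such a shift, in either direction (`exists_abs_sum_gaussMoment_shift_le`). The
narrowest Gaussian is now a high spike that the others cannot cancel, unless its coefficient is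
small (`exists_coeff_le_of_least_var`). Removing one Gaussian after the other, and perturbing equal
variances, gives `exists_coeff_le`. In `exists_matching` a component of one mixture may be close to
one of the other; among polynomially related scales one is chosen at which every such pair is either
very close, and is merged, or well separated.

No separation. There are fewer than k²/2 unordered pairs of components and k² disjoint windows, so a
majority of the runs is good: no distance between components lies in the window
(`two_mul_card_windows_lt`). In a good run the components cluster into groups that are separated at
that precision, identifiability applies to the clustered mixture, and the estimate groups exactly
the components closer than the lower end of the window (`Constants.IsBasicResult.exists_of_gap`). A
finer good run therefore refines the partition of a coarser one, and the good runs form a correct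
chain. Conversely, every majority contains a good run; from there on each tested link of the chain
loses at most a factor 3k, and the first precision is chosen so small that the total loss is
harmless (`chainValue_of_accurate`).

Programs. Apart from the draws everything is deterministic, so the program is replaced by a
specification of its output for fixed samples (`Prog.exists_run_generalUnivariate`). The number of
samples makes all the sample moments accurate with probability at least 1 - δ
(`measure_not_accurate_le`). The running time is bounded instruction by instruction, and all loop
lengths are polynomial in the inverse precisions; the k² precisions are iterates of a map whose
inverse value is polynomially bounded. -/

/-! ### Gaussian moments as polynomials in the mean and the variance. -/

/-- The moments of the Gaussian with mean `μ` and variance `v` (any real number), by recursion. -/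
def gaussMoment (μ v : ℝ) : ℕ → ℝ
  | 0 => 1
  | 1 => μ
  | n + 2 => μ * gaussMoment μ v (n + 1) + (n + 1) * v * gaussMoment μ v n

/-- The moments are the derivatives at 0 of the moment generating function G, which satisfies G' =
(μ + v t) G. Differentiating this equation repeatedly gives a recursion that becomes the one of
`gaussMoment` at t = 0. -/
theorem integral_pow_gaussianReal (μ : ℝ) (v : NNReal) (n : ℕ) :
    ∫ x, x ^ n ∂gaussianReal μ v = gaussMoment μ v n := by
  set G : ℝ → ℝ := fun t => Real.exp (μ * t + v * t ^ 2 / 2) with hG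
  have hsm : ContDiff ℝ ⊤ G := by rw [hG]; fun_prop
  have hd : ∀ n, Differentiable ℝ (iteratedDeriv n G) := fun n =>
    (hsm.of_le (m := (n + 1 : ℕ)) (by exact_mod_cast le_top)).differentiable_iteratedDeriv n
      (by exact_mod_cast Nat.lt_succ_self n)
  have h1 : ∀ t, iteratedDeriv 1 G t = (μ + v * t) * G t := by
    intro t
    rw [iteratedDeriv_one]
    have : HasDerivAt G (Real.exp (μ * t + v * t ^ 2 / 2) * (μ * 1 + v * (2 * t ^ (2 - 1) * 1) / 2)) t := by
      apply HasDerivAt.exp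
      exact ((hasDerivAt_id t).const_mul μ).add ((((hasDerivAt_id t).pow 2).const_mul _).div_const _)
    rw [this.deriv, hG]
    simp; ring
  have hrec : ∀ n t, iteratedDeriv (n + 2) G t =
      (μ + v * t) * iteratedDeriv (n + 1) G t + (n + 1) * v * iteratedDeriv n G t := by
    intro n
    induction n with
    | zero =>
      intro t
      rw [iteratedDeriv_succ, show iteratedDeriv (0 + 1) G = fun t => (μ + v * t) * G t from funext h1]
      have hG' : HasDerivAt G (iteratedDeriv 1 G t) t := by
        rw [iteratedDeriv_one]; exact ((hd 0 t)).hasDerivAt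
      have := (((hasDerivAt_id t).const_mul (v : ℝ)).const_add μ).mul hG'
      refine this.deriv.trans ?_
      rw [h1]; simp; ring
    | succ n ih =>
      intro t
      rw [iteratedDeriv_succ, show iteratedDeriv (n + 1 + 1) G = _ from funext ih]
      have e1 : HasDerivAt (iteratedDeriv (n + 1) G) (iteratedDeriv (n + 2) G t) t := by
        rw [iteratedDeriv_succ (n := n + 1)]; exact (hd _ t).hasDerivAt
      have e0 : HasDerivAt (iteratedDeriv n G) (iteratedDeriv (n + 1) G t) t := by
        rw [iteratedDeriv_succ (n := n)]; exact (hd _ t).hasDerivAt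
      have := ((((hasDerivAt_id t).const_mul (v : ℝ)).const_add μ).mul e1).add
        (e0.const_mul ((n + 1) * (v : ℝ)))
      refine this.deriv.trans ?_
      simp only [id]; rw [ih t]; push_cast; ring
  have key : ∀ n, iteratedDeriv n G 0 = gaussMoment μ v n ∧
      iteratedDeriv (n + 1) G 0 = gaussMoment μ v (n + 1) := by
    intro n
    induction n with
    | zero => exact ⟨by simp [hG, gaussMoment], by rw [h1]; simp [hG, gaussMoment]⟩
    | succ n ih => exact ⟨ih.2, by rw [hrec]; simp [gaussMoment, ih.1, ih.2]⟩
  have := iteratedDeriv_mgf_zero (X := id) (μ := gaussianReal μ v)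
    (by rw [integrableExpSet_id_gaussianReal]; simp) n
  rw [mgf_id_gaussianReal, (key n).1] at this
  rw [this]; simp

theorem integrable_pow_gaussianReal (μ : ℝ) (v : NNReal) (n : ℕ) :
    Integrable (fun x => x ^ n) (gaussianReal μ v) := by
  by_cases hn : n = 0
  · subst hn; simp
  have := (memLp_id_gaussianReal (μ := μ) (v := v) n).integrable_norm_pow hn
  exact this.mono' (by fun_prop) (by simp)

theorem exists_abs_gaussMoment_le (n : ℕ) : ∃ C : ℝ, 1 ≤ C ∧ ∀ B μ v : ℝ, 1 ≤ B → |μ| ≤ B → |v| ≤ B →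
    |gaussMoment μ v n| ≤ C * B ^ n := by
  have : ∀ n, (∃ C : ℝ, 1 ≤ C ∧ ∀ B μ v : ℝ, 1 ≤ B → |μ| ≤ B → |v| ≤ B →
      |gaussMoment μ v n| ≤ C * B ^ n) ∧ (∃ C : ℝ, 1 ≤ C ∧ ∀ B μ v : ℝ, 1 ≤ B → |μ| ≤ B → |v| ≤ B →
      |gaussMoment μ v (n + 1)| ≤ C * B ^ (n + 1)) := by
    intro n
    induction n with
    | zero => exact ⟨⟨1, le_rfl, fun B μ v _ _ _ => by simp [gaussMoment]⟩,
        ⟨1, le_rfl, fun B μ v _ h _ => by simpa [gaussMoment] using h⟩⟩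
    | succ n ih =>
      refine ⟨ih.2, ?_⟩
      obtain ⟨⟨C, hC, h⟩, C', hC', h'⟩ := ih
      refine ⟨C' + (n + 1) * C, by nlinarith [(Nat.cast_nonneg n : (0 : ℝ) ≤ n)], fun B μ v hB hμ hv => ?_⟩
      have a := h B μ v hB hμ hv
      have b := h' B μ v hB hμ hv
      have hB0 : (0 : ℝ) ≤ B := by linarith
      calc |gaussMoment μ v (n + 1 + 1)|
          ≤ |μ| * |gaussMoment μ v (n + 1)| + (n + 1) * |v| * |gaussMoment μ v n| := by
            rw [gaussMoment]
            refine (abs_add_le _ _).trans ?_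
            rw [abs_mul, abs_mul, abs_mul, abs_of_nonneg (by positivity : (0 : ℝ) ≤ (n : ℝ) + 1)]
        _ ≤ B * (C' * B ^ (n + 1)) + (n + 1) * B * (C * B ^ n) := by gcongr
        _ = C' * B ^ (n + 1 + 1) + (n + 1) * C * B ^ (n + 1) := by ring
        _ ≤ C' * B ^ (n + 1 + 1) + (n + 1) * C * B ^ (n + 1 + 1) := by
            have := pow_le_pow_right₀ hB n.succ.le_succ
            gcongr
        _ = _ := by ring
  exact (this n).1

theorem exists_abs_gaussMoment_sub_le (n : ℕ) : ∃ C : ℝ, 1 ≤ C ∧ ∀ B μ v μ' v' : ℝ, 1 ≤ B →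
    |μ| ≤ B → |v| ≤ B → |μ'| ≤ B → |v'| ≤ B →
    |gaussMoment μ v n - gaussMoment μ' v' n| ≤ C * B ^ n * (|μ - μ'| + |v - v'|) := by
  have : ∀ n, (∃ C : ℝ, 1 ≤ C ∧ ∀ B μ v μ' v' : ℝ, 1 ≤ B →
    |μ| ≤ B → |v| ≤ B → |μ'| ≤ B → |v'| ≤ B →
    |gaussMoment μ v n - gaussMoment μ' v' n| ≤ C * B ^ n * (|μ - μ'| + |v - v'|)) ∧
    (∃ C : ℝ, 1 ≤ C ∧ ∀ B μ v μ' v' : ℝ, 1 ≤ B →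
    |μ| ≤ B → |v| ≤ B → |μ'| ≤ B → |v'| ≤ B →
    |gaussMoment μ v (n + 1) - gaussMoment μ' v' (n + 1)| ≤
      C * B ^ (n + 1) * (|μ - μ'| + |v - v'|)) := by
    intro n
    induction n with
    | zero =>
      refine ⟨⟨1, le_rfl, fun B μ v μ' v' hB _ _ _ _ => ?_⟩, ⟨1, le_rfl, fun B μ v μ' v' hB _ _ _ _ => ?_⟩⟩
      · simp [gaussMoment]; positivity
      · simp only [gaussMoment, zero_add, pow_one, one_mul]
        nlinarith [abs_nonneg (μ - μ'), abs_nonneg (v - v')]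
    | succ n ih =>
      refine ⟨ih.2, ?_⟩
      obtain ⟨⟨C, hC, h⟩, C', hC', h'⟩ := ih
      obtain ⟨D, hD, k⟩ := exists_abs_gaussMoment_le n
      obtain ⟨D', hD', k'⟩ := exists_abs_gaussMoment_le (n + 1)
      refine ⟨C' + D' + (n + 1) * (C + D), by nlinarith [(Nat.cast_nonneg n : (0 : ℝ) ≤ n)],
        fun B μ v μ' v' hB hμ hv hμ' hv' => ?_⟩
      have a := h B μ v μ' v' hB hμ hv hμ' hv'
      have b := h' B μ v μ' v' hB hμ hv hμ' hv'
      have c := k B μ' v' hB hμ' hv'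
      have d := k' B μ' v' hB hμ' hv'
      have hB0 : (0 : ℝ) ≤ B := by linarith
      set t := |μ - μ'| + |v - v'| with ht
      have t0 : 0 ≤ t := by positivity
      have t1 : |μ - μ'| ≤ t := by rw [ht]; linarith [abs_nonneg (v - v')]
      have t2 : |v - v'| ≤ t := by rw [ht]; linarith [abs_nonneg (μ - μ')]
      have e : gaussMoment μ v (n + 1 + 1) - gaussMoment μ' v' (n + 1 + 1) =
        (μ * (gaussMoment μ v (n + 1) - gaussMoment μ' v' (n + 1)) +
          (μ - μ') * gaussMoment μ' v' (n + 1)) +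
        (n + 1) * (v * (gaussMoment μ v n - gaussMoment μ' v' n) + (v - v') * gaussMoment μ' v' n) := by
        simp only [gaussMoment]; ring
      calc |gaussMoment μ v (n + 1 + 1) - gaussMoment μ' v' (n + 1 + 1)|
          ≤ (|μ| * |gaussMoment μ v (n + 1) - gaussMoment μ' v' (n + 1)| +
              |μ - μ'| * |gaussMoment μ' v' (n + 1)|) +
            (n + 1) * (|v| * |gaussMoment μ v n - gaussMoment μ' v' n| +
              |v - v'| * |gaussMoment μ' v' n|) := by
            rw [e]
            refine (abs_add_le _ _).trans (add_le_add ?_ ?_)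
            · exact (abs_add_le _ _).trans (by rw [abs_mul, abs_mul])
            · rw [abs_mul, abs_of_nonneg (by positivity : (0 : ℝ) ≤ (n : ℝ) + 1)]
              gcongr
              exact (abs_add_le _ _).trans (by rw [abs_mul, abs_mul])
        _ ≤ (B * (C' * B ^ (n + 1) * t) + t * (D' * B ^ (n + 1))) +
            (n + 1) * (B * (C * B ^ n * t) + t * (D * B ^ n)) := by gcongr
        _ = C' * (B ^ (n + 1 + 1) * t) + D' * (B ^ (n + 1) * t) +
            (n + 1) * (C * (B ^ (n + 1) * t) + D * (B ^ n * t)) := by ring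
        _ ≤ C' * (B ^ (n + 1 + 1) * t) + D' * (B ^ (n + 1 + 1) * t) +
            (n + 1) * (C * (B ^ (n + 1 + 1) * t) + D * (B ^ (n + 1 + 1) * t)) := by
            gcongr <;> first | exact hB | omega
        _ = _ := by ring
  exact (this n).1

/-- This is the heat equation: the Gaussian density satisfies ∂/∂v = ½ ∂²/∂x², and x ^ (n + 2) is
differentiated twice. Being an identity of polynomials it follows from the recursion, for every real
v, including negative ones. -/
theorem hasDerivAt_gaussMoment (μ v : ℝ) (n : ℕ) :
    HasDerivAt (fun v => gaussMoment μ v (n + 2))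
      ((n + 2) * (n + 1) / 2 * gaussMoment μ v n) v := by
  have : ∀ n, HasDerivAt (fun v => gaussMoment μ v (n + 2))
      ((n + 2) * (n + 1) / 2 * gaussMoment μ v n) v ∧
      HasDerivAt (fun v => gaussMoment μ v (n + 3))
      (((n + 1 : ℕ) + 2) * ((n + 1 : ℕ) + 1) / 2 * gaussMoment μ v (n + 1)) v := by
    intro n
    induction n with
    | zero =>
      constructor
      · simp only [gaussMoment]
        convert! ((hasDerivAt_id v).const_mul (1 : ℝ)).const_add (μ * μ) using 1
        · funext y; simp
        · simp
      · simp only [gaussMoment]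
        convert! ((((hasDerivAt_id v)).const_add (μ * μ)).const_mul μ).add
          ((hasDerivAt_id v).const_mul (2 * μ)) using 1
        · funext y; simp; ring
        · simp; ring
    | succ n ih =>
      refine ⟨ih.2, ?_⟩
      have := (ih.2.const_mul μ).add (((hasDerivAt_id v).const_mul ((n : ℝ) + 3)).mul ih.1)
      convert! this using 1
      · funext y; simp only [Pi.add_apply, Pi.mul_apply, id, gaussMoment]; push_cast; ring
      · simp only [id, gaussMoment]; push_cast; ring
  exact (this n).1

/-- Shifting all the variances of a signed mixture keeps small moments small. -/
theorem exists_abs_sum_gaussMoment_shift_le (n : ℕ) : ∃ C : ℝ, 1 ≤ C ∧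
    ∀ {ι : Type} [Fintype ι] (c μ v : ι → ℝ) (η t : ℝ),
      (∀ j ≤ n, |∑ i, c i * gaussMoment (μ i) (v i) j| ≤ η) →
      |∑ i, c i * gaussMoment (μ i) (v i + t) n| ≤ C * (1 + |t|) ^ n * η := by
  induction n using Nat.strong_induction_on with
  | _ n ih =>
  match n, ih with
  | 0, _ => exact ⟨1, le_rfl, fun c μ v η t h => by simpa [gaussMoment] using h 0 le_rfl⟩
  | 1, _ =>
    refine ⟨1, le_rfl, fun c μ v η t h => ?_⟩
    have := h 1 le_rfl
    have h0 := (abs_nonneg _).trans this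
    simp only [gaussMoment] at this ⊢
    nlinarith [abs_nonneg t]
  | n + 2, ih =>
    obtain ⟨C, hC, h⟩ := ih n (by omega)
    refine ⟨1 + (n + 2) * (n + 1) / 2 * C, by
      have : (0 : ℝ) ≤ (n + 2) * (n + 1) / 2 * C := by positivity
      linarith, fun {ι} _ c μ v η t hη => ?_⟩
    have η0 : 0 ≤ η := (abs_nonneg _).trans (hη 0 (by omega))
    set D := fun s => ∑ i, c i * gaussMoment (μ i) (v i + s) (n + 2) with hD
    -- By the heat equation the derivative in the shift is a multiple of the signed moment of order
    -- n. The induction hypothesis bounds it along the whole segment from 0 to t, and the mean value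
    -- inequality finishes.
    have hder : ∀ s, HasDerivAt D
        ((n + 2) * (n + 1) / 2 * ∑ i, c i * gaussMoment (μ i) (v i + s) n) s := by
      intro s
      rw [Finset.mul_sum]
      have : ∀ i ∈ Finset.univ, HasDerivAt (fun s => c i * gaussMoment (μ i) (v i + s) (n + 2))
          (c i * ((n + 2) * (n + 1) / 2 * gaussMoment (μ i) (v i + s) n)) s := fun i _ =>
        ((hasDerivAt_gaussMoment (μ i) (v i + s) n).comp_const_add (v i) s).const_mul _
      refine (HasDerivAt.fun_sum this).congr_deriv ?_
      exact Finset.sum_congr rfl fun i _ => by ring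
    have hb : ∀ s ∈ Set.uIcc 0 t,
        ‖(n + 2) * (n + 1) / 2 * ∑ i, c i * gaussMoment (μ i) (v i + s) n‖ ≤
        (n + 2) * (n + 1) / 2 * (C * (1 + |t|) ^ n * η) := by
      intro s hs
      rw [Real.norm_eq_abs, abs_mul, abs_of_nonneg (by positivity : (0 : ℝ) ≤ (n + 2) * (n + 1) / 2)]
      have hst : |s| ≤ |t| := by
        have := Set.abs_sub_left_of_mem_uIcc hs
        simpa using this
      gcongr
      refine (h c μ v η s fun j hj => hη j (by omega)).trans ?_
      gcongr
    have hm := (convex_uIcc (0 : ℝ) t).norm_image_sub_le_of_norm_hasDerivWithin_le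
      (fun s _ => (hder s).hasDerivWithinAt) hb Set.left_mem_uIcc Set.right_mem_uIcc
    rw [Real.norm_eq_abs, Real.norm_eq_abs, sub_zero] at hm
    have h0 : |D 0| ≤ η := by simpa [hD] using hη (n + 2) le_rfl
    have h3 : |D t| ≤ |D 0| + |D t - D 0| := by
      have := abs_add_le (D 0) (D t - D 0); simpa using this
    have hp : 1 ≤ (1 + |t|) ^ (n + 2) := one_le_pow₀ (by linarith [abs_nonneg t])
    calc |D t| ≤ η + (n + 2) * (n + 1) / 2 * (C * (1 + |t|) ^ n * η) * |t| := by linarith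
      _ ≤ η * (1 + |t|) ^ (n + 2) + (n + 2) * (n + 1) / 2 * C * η * ((1 + |t|) ^ n * (1 + |t|) ^ 2) := by
          have : |t| ≤ (1 + |t|) ^ 2 := by nlinarith [abs_nonneg t]
          have e : (n + 2) * (n + 1) / 2 * (C * (1 + |t|) ^ n * η) * |t| =
            (n + 2) * (n + 1) / 2 * C * η * ((1 + |t|) ^ n * |t|) := by ring
          rw [e]
          have := le_mul_of_one_le_right η0 hp
          gcongr
      _ = _ := by ring

/-! ### Zeros of Laplace transforms and sign changes. -/

/-- Rolle's theorem as a bound on the number of zeros. -/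
theorem encard_zeros_le_of_hasDerivAt {f f' : ℝ → ℝ} (h : ∀ x, HasDerivAt f (f' x) x) {m : ℕ}
    (hm : {x | f' x = 0}.encard ≤ m) : {x | f x = 0}.encard ≤ (m + 1 : ℕ) := by
  have hfin : {x | f' x = 0}.Finite := Set.finite_of_encard_le_coe hm
  have key : ∀ s : Finset ℝ, (∀ x ∈ s, f x = 0) → s.card ≤ m + 1 := by
    intro s hs
    have h1 : s.card ≤ hfin.toFinset.card + 1 := by
      refine Finset.card_le_of_interleaved fun x hx y hy hxy _ => ?_
      obtain ⟨z, hz, hz'⟩ := exists_hasDerivAt_eq_zero hxy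
        (fun t _ => (h t).continuousAt.continuousWithinAt) ((hs x hx).trans (hs y hy).symm)
        (fun t _ => h t)
      exact ⟨z, by simpa using hz', hz.1, hz.2⟩
    have h2 : hfin.toFinset.card ≤ m := by
      rw [hfin.encard_eq_coe_toFinset_card] at hm
      exact_mod_cast hm
    omega
  by_contra hlt
  push Not at hlt
  obtain ⟨t, ht, hc⟩ := Set.exists_subset_encard_eq (Order.add_one_le_of_lt hlt)
  have tfin : t.Finite := Set.finite_of_encard_le_coe (k := m + 1 + 1) (by rw [hc]; push_cast; rfl)
  have := key tfin.toFinset fun x hx => ht (by simpa using hx)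
  rw [tfin.encard_eq_coe_toFinset_card] at hc
  have hc' : tfin.toFinset.card = m + 1 + 1 := by exact_mod_cast hc
  omega

/-- Multiplication by exp (-r x) does not change the zeros of f and turns f' - r f into a
derivative, so that Rolle's theorem applies. -/
theorem encard_zeros_le_of_hasDerivAt_sub {f f' : ℝ → ℝ} (h : ∀ x, HasDerivAt f (f' x) x) (r : ℝ)
    {m : ℕ} (hm : {x | f' x - r * f x = 0}.encard ≤ m) : {x | f x = 0}.encard ≤ (m + 1 : ℕ) := by
  have h2 : ∀ x, HasDerivAt (fun x => Real.exp (-r * x) * f x)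
      (Real.exp (-r * x) * (f' x - r * f x)) x := by
    intro x
    have := (((hasDerivAt_id x).const_mul (-r)).exp).mul (h x)
    refine this.congr_deriv ?_
    simp; ring
  have := encard_zeros_le_of_hasDerivAt h2 (m := m) (by simpa using hm)
  simpa using this

/-- All the exponential moments of the function exist. -/
def ExpIntegrable (F : ℝ → ℝ) : Prop := ∀ x, Integrable fun y => F y * Real.exp (x * y)

/-- A domination that is uniform in t near x, for differentiating under the integral sign. Both |y|
and exp ((t - x) y) are at most exp |y|, and exp (2 |y|) is at most the sum of its two one-sided
versions. -/
theorem abs_mul_exp_le (x y t : ℝ) (ht : |t - x| ≤ 1) :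
    |y| * Real.exp (t * y) ≤ Real.exp ((x + 2) * y) + Real.exp ((x - 2) * y) := by
  have h1 : |y| ≤ Real.exp |y| := by linarith [Real.add_one_le_exp |y|]
  have h2 : t * y ≤ x * y + |y| := by
    have : (t - x) * y ≤ 1 * |y| := (le_abs_self _).trans (by rw [abs_mul]; gcongr)
    linarith
  calc |y| * Real.exp (t * y) ≤ Real.exp |y| * Real.exp (x * y + |y|) := by gcongr
    _ = Real.exp (x * y + 2 * |y|) := by rw [← Real.exp_add]; ring_nf
    _ ≤ _ := by
      rcases le_total 0 y with hy | hy
      · rw [abs_of_nonneg hy, show x * y + 2 * y = (x + 2) * y by ring]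
        linarith [Real.exp_pos ((x - 2) * y)]
      · rw [abs_of_nonpos hy, show x * y + 2 * -y = (x - 2) * y by ring]
        linarith [Real.exp_pos ((x + 2) * y)]

theorem ExpIntegrable.hasDerivAt {F : ℝ → ℝ} (hF : ExpIntegrable F) (hc : Continuous F) (x : ℝ) :
    Integrable (fun y => y * F y * Real.exp (x * y)) ∧
    HasDerivAt (fun x => ∫ y, F y * Real.exp (x * y)) (∫ y, y * F y * Real.exp (x * y)) x := by
  refine hasDerivAt_integral_of_dominated_loc_of_deriv_le (F := fun x y => F y * Real.exp (x * y))
    (F' := fun x y => y * F y * Real.exp (x * y))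
    (bound := fun y => |F y * Real.exp ((x + 2) * y)| + |F y * Real.exp ((x - 2) * y)|)
    (Metric.ball_mem_nhds x one_pos) (Filter.Eventually.of_forall fun t => ?_) (hF x) ?_
    (Filter.Eventually.of_forall fun y t ht => ?_) ((hF _).abs.add (hF _).abs)
    (Filter.Eventually.of_forall fun y t _ => ?_)
  · exact (by fun_prop : Continuous fun y => F y * Real.exp (t * y)).aestronglyMeasurable
  · exact (by fun_prop : Continuous fun y => y * F y * Real.exp (x * y)).aestronglyMeasurable
  · have := abs_mul_exp_le x y t (by simpa [Real.dist_eq] using (Metric.mem_ball.1 ht).le)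
    rw [Real.norm_eq_abs, abs_mul, abs_mul, abs_mul, abs_mul, Real.abs_exp, Real.abs_exp,
      Real.abs_exp]
    nlinarith [abs_nonneg (F y)]
  · have := (((hasDerivAt_id t).mul_const y).exp).const_mul (F y)
    refine this.congr_deriv ?_
    simp; ring

theorem ExpIntegrable.sub_mul {F : ℝ → ℝ} (hF : ExpIntegrable F) (hc : Continuous F) (r : ℝ) :
    ExpIntegrable fun y => (y - r) * F y := by
  intro x
  refine ((hF.hasDerivAt hc x).1.sub ((hF x).const_mul r)).congr (Filter.Eventually.of_forall fun y => ?_)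
  simp; ring

theorem integral_sub_mul_exp {F : ℝ → ℝ} (hF : ExpIntegrable F) (hc : Continuous F) (r x : ℝ) :
    ∫ y, (y - r) * F y * Real.exp (x * y) =
      (∫ y, y * F y * Real.exp (x * y)) - r * ∫ y, F y * Real.exp (x * y) := by
  rw [← integral_const_mul, ← integral_sub (hF.hasDerivAt hc x).1 ((hF x).const_mul r)]
  congr 1; ext y; ring

theorem exists_sub_mul_ne_zero {F : ℝ → ℝ} (hc : Continuous F) (hne : ∃ y, F y ≠ 0) (r : ℝ) :
    ∃ y, (y - r) * F y ≠ 0 := by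
  by_contra! h
  obtain ⟨y, hy⟩ := hne
  have h1 : ∀ z, z ≠ r → F z = 0 := fun z hz => (mul_eq_zero.1 (h z)).resolve_left (sub_ne_zero.2 hz)
  have hyr : y = r := by by_contra hyr; exact hy (h1 y hyr)
  subst hyr
  have : F = fun _ => 0 := by
    refine hc.ext_on (dense_compl_singleton y) continuous_const fun z hz => h1 z hz
  exact hy (by rw [this])

/-- The number of zeros of a Laplace transform is at most the number of sign changes. -/
theorem encard_zeros_laplace_le (l : List ℝ) : ∀ {F : ℝ → ℝ}, Continuous F → ExpIntegrable F →
    (∃ y, F y ≠ 0) → (∀ y, 0 ≤ (l.map fun r => y - r).prod * F y) →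
    {x | ∫ y, F y * Real.exp (x * y) = 0}.encard ≤ (l.length : ℕ) := by
  induction l with
  | nil =>
    intro F hc hF hne hs
    have hpos : ∀ x, 0 < ∫ y, F y * Real.exp (x * y) := by
      intro x
      rw [integral_pos_iff_support_of_nonneg
        (fun y => mul_nonneg (by simpa using hs y) (Real.exp_pos _).le) (hF x)]
      refine IsOpen.measure_pos _ ?_ ?_
      · exact (by fun_prop : Continuous fun y => F y * Real.exp (x * y)).isOpen_support
      · obtain ⟨y, hy⟩ := hne
        exact ⟨y, mul_ne_zero hy (Real.exp_pos _).ne'⟩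
    have : {x | ∫ y, F y * Real.exp (x * y) = 0} = ∅ := by
      ext x; simpa using (hpos x).ne'
    rw [this]; simp
  | cons r l ih =>
    intro F hc hF hne hs
    -- If f is the transform of F, then f' - r f is the transform of (y - r) F(y). Thus r leaves the
    -- list of sign changes at the price of one zero.
    refine encard_zeros_le_of_hasDerivAt_sub (fun x => (hF.hasDerivAt hc x).2) r ?_
    have := ih (F := fun y => (y - r) * F y) (by fun_prop) (hF.sub_mul hc r)
      (exists_sub_mul_ne_zero hc hne r) fun y => by
        have := hs y
        simp only [List.map_cons, List.prod_cons] at this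
        linarith
    simpa only [integral_sub_mul_exp hF hc] using this

/-- The exponential is the transform of a point mass at r. The operator f' - r f annihilates it and
multiplies F by y - r, which adds at most one sign change; Rolle's theorem adds one more zero. -/
theorem encard_zeros_laplace_add_exp_le (l : List ℝ) {F : ℝ → ℝ} (hc : Continuous F)
    (hF : ExpIntegrable F) (hne : ∃ y, F y ≠ 0) (hs : ∀ y, 0 ≤ (l.map fun r => y - r).prod * F y)
    (d r : ℝ) :
    {x | d * Real.exp (x * r) + ∫ y, F y * Real.exp (x * y) = 0}.encard ≤ (l.length + 2 : ℕ) := by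
  have h1 : ∀ x, HasDerivAt (fun x => d * Real.exp (x * r) + ∫ y, F y * Real.exp (x * y))
      (d * Real.exp (x * r) * r + ∫ y, y * F y * Real.exp (x * y)) x := by
    intro x
    refine HasDerivAt.add ?_ (hF.hasDerivAt hc x).2
    have := (((hasDerivAt_id x).mul_const r).exp).const_mul d
    refine this.congr_deriv ?_
    simp; ring
  refine encard_zeros_le_of_hasDerivAt_sub h1 r ?_
  have := encard_zeros_laplace_le (r :: l) (F := fun y => (y - r) * F y) (by fun_prop)
    (hF.sub_mul hc r) (exists_sub_mul_ne_zero hc hne r) fun y => by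
      have := mul_nonneg (hs y) (sq_nonneg (y - r))
      simp only [List.map_cons, List.prod_cons]
      nlinarith
  simp only [integral_sub_mul_exp hF hc] at this
  refine le_of_eq_of_le (congrArg Set.encard (Set.ext fun x => ?_)) this
  simp only [Set.mem_ofPred_eq]
  rw [show ∀ p q s : ℝ, p * r + q - r * (p + s) = q - r * s from fun p q s => by ring]

/-- A continuous function with finitely many zeros has the signs of a polynomial with simple roots
among these zeros. -/
theorem exists_sign_pattern {F : ℝ → ℝ} (hc : Continuous F) (Z : Finset ℝ) :
    ∀ D : Set ℝ, D.OrdConnected → (∀ y ∈ D, F y = 0 ↔ y ∈ Z) → (∀ z ∈ Z, z ∈ D) →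
    ∃ S ⊆ Z, ∃ σ : ℝ, (σ = 1 ∨ σ = -1) ∧ ∀ y ∈ D, 0 ≤ (∏ r ∈ S, (y - r)) * (σ * F y) := by
  have const : ∀ D : Set ℝ, D.OrdConnected → (∀ y ∈ D, F y ≠ 0) →
      ∃ σ : ℝ, (σ = 1 ∨ σ = -1) ∧ ∀ y ∈ D, 0 ≤ σ * F y := by
    intro D hD hne
    by_cases hpos : ∃ a ∈ D, 0 < F a
    · obtain ⟨a, ha, hFa⟩ := hpos
      refine ⟨1, Or.inl rfl, fun y hy => ?_⟩
      by_contra hlt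
      rw [one_mul, not_le] at hlt
      obtain ⟨z, hz, hz0⟩ := (hD.isPreconnected.intermediate_value hy ha hc.continuousOn)
        ⟨hlt.le, hFa.le⟩
      exact hne z hz hz0
    · push Not at hpos
      exact ⟨-1, Or.inr rfl, fun y hy => by linarith [hpos y hy]⟩
  induction Z using Finset.induction_on_max with
  | empty =>
    intro D hD h _
    obtain ⟨σ, hσ, h'⟩ := const D hD fun y hy => by simp [h y hy]
    exact ⟨∅, subset_rfl, σ, hσ, by simpa using h'⟩
  | insert z Z' hz ih =>
    intro D hD h hZ
    have hzD := hZ z (Finset.mem_insert_self _ _)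
    -- As z is the largest zero, the induction hypothesis describes the signs to its left, and to
    -- its right the sign is constant. The general domain D is there for this restriction.
    obtain ⟨S, hS, σ, hσ, hs⟩ := ih (D ∩ Set.Iio z) (hD.inter Set.ordConnected_Iio)
      (fun y hy => by
        rw [h y hy.1, Finset.mem_insert, or_iff_right hy.2.ne])
      (fun y hy => ⟨hZ y (Finset.mem_insert_of_mem hy), hz y hy⟩)
    obtain ⟨τ, hτ, ht⟩ := const (D ∩ Set.Ioi z) (hD.inter Set.ordConnected_Ioi) fun y hy h0 => by
      rw [h y hy.1, Finset.mem_insert] at h0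
      rcases h0 with h0 | h0
      · exact hy.2.ne' h0
      · exact absurd (hz y h0) (not_lt.2 (le_of_lt hy.2))
    have hFz : F z = 0 := (h z hzD).2 (Finset.mem_insert_self _ _)
    have hprod : ∀ y, z < y → 0 < ∏ r ∈ S, (y - r) := fun y hy =>
      Finset.prod_pos fun r hr => sub_pos.2 ((hz r (hS hr)).trans hy)
    have hzS : z ∉ S := fun hzS => lt_irrefl _ (hz z (hS hzS))
    -- All the elements of S lie below z, so their product is positive to the right of z. Hence z
    -- becomes a root exactly if the two signs differ.
    by_cases hst : τ = σ
    · refine ⟨S, hS.trans (Finset.subset_insert _ _), σ, hσ, fun y hy => ?_⟩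
      rcases lt_trichotomy y z with hyz | hyz | hyz
      · exact hs y ⟨hy, hyz⟩
      · rw [hyz, hFz]; simp
      · exact mul_nonneg (hprod y hyz).le (hst ▸ ht y ⟨hy, hyz⟩)
    · have hst' : τ = -σ := by
        rcases hσ with rfl | rfl <;> rcases hτ with rfl | rfl <;> simp_all
      refine ⟨insert z S, Finset.insert_subset_insert _ hS, τ, hτ, fun y hy => ?_⟩
      rw [Finset.prod_insert hzS]
      rcases lt_trichotomy y z with hyz | hyz | hyz
      · have := mul_nonneg (hs y ⟨hy, hyz⟩) (sub_pos.2 hyz).le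
        rw [hst']
        linarith
      · rw [hyz, hFz]; simp
      · exact mul_nonneg (mul_pos (sub_pos.2 hyz) (hprod y hyz)).le (ht y ⟨hy, hyz⟩)

theorem exists_finset_sign_pattern {F : ℝ → ℝ} (hc : Continuous F) {m : ℕ}
    (hm : {x | F x = 0}.encard ≤ m) :
    ∃ S : Finset ℝ, S.card ≤ m ∧ ∃ σ : ℝ, (σ = 1 ∨ σ = -1) ∧
      ∀ y, 0 ≤ (∏ r ∈ S, (y - r)) * (σ * F y) := by
  have hfin : {x | F x = 0}.Finite := Set.finite_of_encard_le_coe hm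
  obtain ⟨S, hS, σ, hσ, h⟩ := exists_sign_pattern hc hfin.toFinset Set.univ Set.ordConnected_univ
    (by simp) (by simp)
  rw [hfin.encard_eq_coe_toFinset_card] at hm
  exact ⟨S, (Finset.card_le_card hS).trans (by exact_mod_cast hm), σ, hσ, fun y => h y trivial⟩

/-! ### Zeros of linear combinations of Gaussians. -/

theorem integral_exp_quadratic {a : ℝ} (ha : 0 < a) (b : ℝ) :
    Integrable (fun y => Real.exp (-a * y ^ 2 + b * y)) ∧
    ∫ y, Real.exp (-a * y ^ 2 + b * y) = √(Real.pi / a) * Real.exp (b ^ 2 / (4 * a)) := by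
  have e : (fun y => Real.exp (-a * y ^ 2 + b * y)) =
      fun y => Real.exp (b ^ 2 / (4 * a)) * Real.exp (-a * (y - b / (2 * a)) ^ 2) := by
    ext y
    rw [← Real.exp_add]
    congr 1
    field_simp
    ring
  rw [e]
  refine ⟨((integrable_exp_neg_mul_sq ha).comp_sub_right _).const_mul _, ?_⟩
  rw [integral_const_mul, integral_sub_right_eq_self (fun y => Real.exp (-a * y ^ 2)),
    integral_gaussian, mul_comm]

/-- A nonzero linear combination of `n` Gaussians with distinct variances has at most `2 * n - 2`
zeros. -/
theorem encard_zeros_sum_exp_le {ι : Type*} (n : ℕ) : ∀ (s : Finset ι) (_ : s.card = n)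
    (a b c : ι → ℝ), (∀ i ∈ s, 0 < a i) → Set.InjOn a s → (∃ i ∈ s, c i ≠ 0) →
    {x | ∑ i ∈ s, c i * Real.exp (-a i * x ^ 2 + b i * x) = 0}.encard ≤ (2 * n - 2 : ℕ) := by
  classical
  induction n with
  | zero =>
    intro s hs a b c _ _ ⟨i, hi, _⟩
    rw [Finset.card_eq_zero.1 hs] at hi
    simp at hi
  | succ n ih =>
    intro s hs a b c ha hinj hne
    -- The narrowest Gaussian is singled out. After multiplication by exp (a i₀ * x ^ 2) it is a
    -- pure exponential, and in all other terms the coefficient of x ^ 2 is positive, which makes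
    -- them Laplace transforms of Gaussians.
    obtain ⟨i₀, hi₀, hmax⟩ := Finset.exists_max_image s a
      (Finset.card_pos.1 (by omega))
    set s' := s.erase i₀ with hs'
    have hcard : s'.card = n := by rw [hs', Finset.card_erase_of_mem hi₀, hs]; rfl
    have hlt : ∀ i ∈ s', 0 < a i₀ - a i := by
      intro i hi
      have hi' := Finset.mem_of_mem_erase hi
      refine sub_pos.2 (lt_of_le_of_ne (hmax i hi') fun h => ?_)
      exact Finset.ne_of_mem_erase hi (hinj hi' hi₀ h)
    by_cases hrest : ∃ i ∈ s', c i ≠ 0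
    swap
    · push Not at hrest
      have hc0 : c i₀ ≠ 0 := by
        obtain ⟨i, hi, hci⟩ := hne
        by_cases h : i = i₀
        · rwa [← h]
        · exact absurd (hrest i (Finset.mem_erase.2 ⟨h, hi⟩)) hci
      have : {x | ∑ i ∈ s, c i * Real.exp (-a i * x ^ 2 + b i * x) = 0} = ∅ := by
        ext x
        rw [Set.mem_ofPred_eq, ← Finset.add_sum_erase s _ hi₀,
          Finset.sum_eq_zero fun i hi => by rw [hrest i hi, zero_mul]]
        simp [hc0]
      rw [this]; simp
    -- Completing the square: with these parameters, the transform of exp (-A y² + B y) is a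
    -- constant times exp ((a i₀ - a i) x² + b i x), and `D` removes that constant.
    set A : ι → ℝ := fun i => 1 / (4 * (a i₀ - a i)) with hA
    set B : ι → ℝ := fun i => b i / (2 * (a i₀ - a i)) with hB
    set D : ι → ℝ := fun i => c i / √(Real.pi / A i) * Real.exp (-(b i ^ 2 / (4 * (a i₀ - a i)))) with hD
    have hApos : ∀ i ∈ s', 0 < A i := fun i hi => by
      have := hlt i hi; rw [hA]; positivity
    set F : ℝ → ℝ := fun y => ∑ i ∈ s', D i * Real.exp (-A i * y ^ 2 + B i * y) with hF
    have hFc : Continuous F := by rw [hF]; fun_prop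
    have hterm : ∀ x, ∀ i ∈ s', Integrable (fun y => D i * Real.exp (-A i * y ^ 2 + B i * y) * Real.exp (x * y)) ∧
        ∫ y, D i * Real.exp (-A i * y ^ 2 + B i * y) * Real.exp (x * y) =
          Real.exp (a i₀ * x ^ 2) * (c i * Real.exp (-a i * x ^ 2 + b i * x)) := by
      intro x i hi
      have e : (fun y => D i * Real.exp (-A i * y ^ 2 + B i * y) * Real.exp (x * y)) =
          fun y => D i * Real.exp (-A i * y ^ 2 + (B i + x) * y) := by
        ext y
        rw [mul_assoc, ← Real.exp_add]
        ring_nf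
      obtain ⟨h1, h2⟩ := integral_exp_quadratic (hApos i hi) (B i + x)
      rw [e]
      refine ⟨h1.const_mul _, ?_⟩
      have hsq : √(Real.pi / A i) ≠ 0 := by
        have := div_pos Real.pi_pos (hApos i hi)
        positivity
      have hne := (hlt i hi).ne'
      rw [integral_const_mul, h2, hD]
      have : ∀ p q : ℝ, c i / √(Real.pi / A i) * p * (√(Real.pi / A i) * q) = c i * (p * q) := by
        intro p q; field_simp
      rw [this, ← Real.exp_add, mul_left_comm, ← Real.exp_add]
      congr 2
      rw [hA, hB]
      field_simp
      ring
    have hFE : ExpIntegrable F := by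
      intro x
      simp only [hF, Finset.sum_mul]
      exact integrable_finsetSum _ fun i hi => (hterm x i hi).1
    have hFI : ∀ x, ∫ y, F y * Real.exp (x * y) =
        Real.exp (a i₀ * x ^ 2) * ∑ i ∈ s', c i * Real.exp (-a i * x ^ 2 + b i * x) := by
      intro x
      simp only [hF, Finset.sum_mul]
      rw [integral_finsetSum _ fun i hi => (hterm x i hi).1, Finset.mul_sum]
      exact Finset.sum_congr rfl fun i hi => (hterm x i hi).2
    have hDne : ∃ i ∈ s', D i ≠ 0 := by
      obtain ⟨i, hi, hci⟩ := hrest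
      refine ⟨i, hi, ?_⟩
      have := div_pos Real.pi_pos (hApos i hi)
      rw [hD]; positivity
    -- The new quadratic coefficients are again positive and distinct, so F has at most 2 * n - 2
    -- zeros and no more sign changes. The extra exponential raises the count by two; n ≥ 1, proved
    -- below, makes the truncated subtraction exact.
    have hZ := ih s' hcard A B D hApos (fun i hi j hj hij => by
      have h1 := hlt i hi
      have h2 := hlt j hj
      simp only [hA] at hij
      rw [div_eq_div_iff (by positivity) (by positivity)] at hij
      exact hinj (Finset.mem_of_mem_erase hi) (Finset.mem_of_mem_erase hj) (by linarith)) hDne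
    obtain ⟨S, hS, σ, hσ, hsgn⟩ := exists_finset_sign_pattern hFc hZ
    have hF0 : ∃ y, F y ≠ 0 := by
      by_contra! h
      exact Set.infinite_univ ((Set.finite_of_encard_le_coe hZ).subset fun x _ => h x)
    have hσ0 : σ ≠ 0 := by rcases hσ with rfl | rfl <;> norm_num
    have := encard_zeros_laplace_add_exp_le S.toList (F := fun y => σ * F y) (by fun_prop)
      (fun x => by simpa only [mul_assoc] using (hFE x).const_mul σ)
      (by obtain ⟨y, hy⟩ := hF0; exact ⟨y, mul_ne_zero hσ0 hy⟩)
      (fun y => by rw [Finset.prod_map_toList]; exact hsgn y) (σ * c i₀) (b i₀)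
    have hn : 1 ≤ n := by
      obtain ⟨i, hi, _⟩ := hrest
      rw [← hcard]; exact Finset.card_pos.2 ⟨i, hi⟩
    refine le_trans (le_trans (le_of_eq ?_) this) ?_
    · congr 1
      ext x
      simp only [mul_assoc σ, integral_const_mul, hFI, Set.mem_ofPred_eq]
      rw [← Finset.add_sum_erase s _ hi₀]
      have e : σ * (c i₀ * Real.exp (x * b i₀)) + σ * (Real.exp (a i₀ * x ^ 2) *
          ∑ i ∈ s', c i * Real.exp (-a i * x ^ 2 + b i * x)) =
          σ * Real.exp (a i₀ * x ^ 2) * (c i₀ * Real.exp (-a i₀ * x ^ 2 + b i₀ * x) +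
          ∑ i ∈ s', c i * Real.exp (-a i * x ^ 2 + b i * x)) := by
        have : Real.exp (x * b i₀) = Real.exp (a i₀ * x ^ 2) * Real.exp (-a i₀ * x ^ 2 + b i₀ * x) := by
          rw [← Real.exp_add]; ring_nf
        rw [this]; ring
      rw [e, mul_eq_zero, or_iff_right (mul_ne_zero hσ0 (Real.exp_pos _).ne')]
    · rw [Finset.length_toList]
      exact_mod_cast (by omega : S.card + 2 ≤ 2 * (n + 1) - 2)

/-! ### Size and slope of Gaussian densities. -/

/-- Throughout, constants are absorbed by additional powers of a small parameter; its upper bound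
1/2 is what makes this possible. -/
theorem exists_mul_pow_le (C c : ℝ) (hc : 0 < c) :
    ∃ b : ℕ, ∀ t : ℝ, 0 < t → t ≤ 1 / 2 → C * t ^ b ≤ c := by
  obtain ⟨b, hb⟩ := exists_pow_lt_of_lt_one (x := c / (|C| + 1)) (by positivity)
    (by norm_num : (1 / 2 : ℝ) < 1)
  refine ⟨b, fun t ht ht2 => ?_⟩
  have h1 : t ^ b ≤ (1 / 2) ^ b := by gcongr
  rw [lt_div_iff₀ (by positivity)] at hb
  have h2 : 0 ≤ t ^ b := by positivity
  nlinarith [le_abs_self C, abs_nonneg C]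

/-- The Gaussian density, with a real variance. -/
noncomputable def gaussDensity (μ u x : ℝ) : ℝ := (√(2 * Real.pi * u))⁻¹ * Real.exp (-(x - μ) ^ 2 / (2 * u))

theorem gaussDensity_eq {μ u x : ℝ} (hu : 0 < u) :
    gaussDensity μ u x = gaussianPDFReal μ u.toNNReal x := by
  rw [gaussDensity, gaussianPDFReal, Real.coe_toNNReal _ hu.le]

theorem gaussDensity_nonneg (μ u x : ℝ) : 0 ≤ gaussDensity μ u x := by
  unfold gaussDensity; positivity

theorem continuous_gaussDensity (μ u : ℝ) : Continuous (gaussDensity μ u) := by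
  unfold gaussDensity; fun_prop

theorem integral_pow_mul_gaussDensity {μ u : ℝ} (hu : 0 < u) (n : ℕ) :
    Integrable (fun x => x ^ n * gaussDensity μ u x) ∧
    ∫ x, x ^ n * gaussDensity μ u x = gaussMoment μ u n := by
  have hu0 : u.toNNReal ≠ 0 := by simpa using hu
  constructor
  · have := integrable_pow_gaussianReal μ u.toNNReal n
    rw [gaussianReal_of_var_ne_zero _ hu0, integrable_withDensity_iff (measurable_gaussianPDF _ _)
      (Filter.Eventually.of_forall fun x => gaussianPDF_lt_top)] at this
    simpa only [toReal_gaussianPDF, ← gaussDensity_eq hu] using this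
  · have := integral_pow_gaussianReal μ u.toNNReal n
    rw [integral_gaussianReal_eq_integral_smul hu0, Real.coe_toNNReal _ hu.le] at this
    rw [← this]
    congr 1; ext x
    rw [gaussDensity_eq hu, smul_eq_mul, mul_comm]

/-- The left side is the square root of exp (-d² / u), and exp s ≥ s. The factor √u is kept because
it cancels the normalisation of the density. -/
theorem exp_neg_sq_le {u d : ℝ} (hu : 0 < u) (hd : 0 < d) :
    Real.exp (-d ^ 2 / (2 * u)) ≤ √u / d := by
  have h1 : Real.exp (-d ^ 2 / (2 * u)) = √(Real.exp (-(d ^ 2 / u))) := by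
    rw [Real.sqrt_eq_rpow, ← Real.exp_mul]
    congr 1; field_simp
  have h2 : √u / d = √(u / d ^ 2) := by rw [Real.sqrt_div' _ (by positivity), Real.sqrt_sq hd.le]
  rw [h1, h2]
  apply Real.sqrt_le_sqrt
  rw [Real.exp_neg, show u / d ^ 2 = (d ^ 2 / u)⁻¹ from (inv_div _ _).symm]
  gcongr
  linarith [Real.add_one_le_exp (d ^ 2 / u)]

/-- If u is not small, the normalisation bounds the density. If u is small but x is far from the
mean, the decay of the exponential outweighs the normalisation, however small u is. -/
theorem gaussDensity_le_of_sep {μ u x t : ℝ} (hu : 0 < u) (ht : 0 < t) (ht2 : t ≤ 1 / 2)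
    (h : t / 2 ≤ u ∨ t / 2 ≤ |x - μ|) : gaussDensity μ u x ≤ 2 / t := by
  rcases h with h | h
  · have h1 : Real.exp (-(x - μ) ^ 2 / (2 * u)) ≤ 1 := by
      rw [Real.exp_le_one_iff, neg_div]
      have : 0 ≤ (x - μ) ^ 2 / (2 * u) := by positivity
      linarith
    have h2 : t ≤ √(2 * Real.pi * u) := by
      apply Real.le_sqrt_of_sq_le
      nlinarith [Real.pi_gt_three]
    unfold gaussDensity
    calc (√(2 * Real.pi * u))⁻¹ * Real.exp (-(x - μ) ^ 2 / (2 * u)) ≤ t⁻¹ * 1 := by gcongr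
      _ ≤ 2 / t := by rw [mul_one, ← one_div]; gcongr; norm_num
  · have hd : 0 < |x - μ| := by linarith
    have h1 := exp_neg_sq_le hu hd
    rw [sq_abs] at h1
    have h2 : √u ≤ √(2 * Real.pi * u) := by
      apply Real.sqrt_le_sqrt
      nlinarith [Real.pi_gt_three]
    have h3 : 0 < √u := Real.sqrt_pos.2 hu
    unfold gaussDensity
    calc (√(2 * Real.pi * u))⁻¹ * Real.exp (-(x - μ) ^ 2 / (2 * u))
        ≤ (√u)⁻¹ * (√u / (t / 2)) := by
          gcongr
          exact h1.trans (by gcongr)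
      _ = 2 / t := by field_simp

theorem hasDerivAt_gaussDensity (μ u x : ℝ) :
    HasDerivAt (gaussDensity μ u) (-((x - μ) / u) * gaussDensity μ u x) x := by
  unfold gaussDensity
  have := ((((hasDerivAt_id x).sub_const μ).pow 2).neg.div_const (2 * u)).exp.const_mul
    (√(2 * Real.pi * u))⁻¹
  refine this.congr_deriv ?_
  simp only [id, Pi.pow_apply, Pi.neg_apply]
  by_cases hu : u = 0
  · simp [hu]
  · field_simp; norm_num

theorem abs_deriv_gaussDensity_le {μ u x : ℝ} (hu : 0 < u) :
    |-((x - μ) / u) * gaussDensity μ u x| ≤ 1 / u := by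
  by_cases hx : x = μ
  · simp [hx, hu.le]
  have hd : 0 < |x - μ| := abs_pos.2 (sub_ne_zero.2 hx)
  have h1 := exp_neg_sq_le hu hd
  rw [sq_abs] at h1
  have h3 : 0 < √u := Real.sqrt_pos.2 hu
  have h2 : √u ≤ √(2 * Real.pi * u) := by
    apply Real.sqrt_le_sqrt
    nlinarith [Real.pi_gt_three]
  rw [abs_mul, abs_neg, abs_div, abs_of_pos hu, abs_of_nonneg (gaussDensity_nonneg _ _ _)]
  unfold gaussDensity
  calc |x - μ| / u * ((√(2 * Real.pi * u))⁻¹ * Real.exp (-(x - μ) ^ 2 / (2 * u)))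
      ≤ |x - μ| / u * ((√u)⁻¹ * (√u / |x - μ|)) := by gcongr
    _ = 1 / u := by field_simp

theorem abs_gaussDensity_sub_le {μ u : ℝ} (hu : 0 < u) (x y : ℝ) :
    |gaussDensity μ u x - gaussDensity μ u y| ≤ 1 / u * |x - y| := by
  have := convex_univ.norm_image_sub_le_of_norm_hasDerivWithin_le (f := gaussDensity μ u)
    (fun z _ => (hasDerivAt_gaussDensity μ u z).hasDerivWithinAt)
    (fun z _ => abs_deriv_gaussDensity_le hu) (Set.mem_univ y) (Set.mem_univ x)
  exact this

/-! ### Testing a signed mixture against a polynomial with the same signs. -/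

/-- A product of normalised linear factors integrates small moments to something small. -/
theorem abs_integral_prod_mul_le {f : ℝ → ℝ} {n : ℕ} {η : ℝ}
    (hint : ∀ j : ℕ, Integrable fun y => y ^ j * f y) (hη : ∀ j ≤ n, |∫ y, y ^ j * f y| ≤ η)
    (S : Finset ℝ) :
    (∀ j : ℕ, Integrable fun y => y ^ j * ((∏ r ∈ S, (y - r) / max 1 |r|) * f y)) ∧
    ∀ j : ℕ, j + S.card ≤ n →
      |∫ y, y ^ j * ((∏ r ∈ S, (y - r) / max 1 |r|) * f y)| ≤ 2 ^ S.card * η := by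
  induction S using Finset.induction_on with
  | empty => simpa using ⟨hint, hη⟩
  | insert r S hr ih =>
    obtain ⟨h1, h2⟩ := ih
    set M := max 1 |r| with hM
    have hM1 : 1 ≤ M := le_max_left _ _
    have hMr : |r| ≤ M := le_max_right _ _
    -- Dividing by max 1 |r| makes both coefficients of the linear factor at most 1 in absolute
    -- value. One factor thus at most doubles the bound on the moments and uses up one order.
    have e : ∀ j : ℕ, (fun y => y ^ j * ((∏ r ∈ insert r S, (y - r) / max 1 |r|) * f y)) =
        fun y => 1 / M * (y ^ (j + 1) * ((∏ r ∈ S, (y - r) / max 1 |r|) * f y)) -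
          r / M * (y ^ j * ((∏ r ∈ S, (y - r) / max 1 |r|) * f y)) := by
      intro j; ext y
      rw [Finset.prod_insert hr, pow_succ]
      ring
    refine ⟨fun j => ?_, fun j hj => ?_⟩
    · rw [e]; exact ((h1 _).const_mul _).sub ((h1 _).const_mul _)
    · rw [Finset.card_insert_of_notMem hr] at hj ⊢
      rw [e, integral_sub ((h1 _).const_mul _) ((h1 _).const_mul _), integral_const_mul,
        integral_const_mul]
      refine (abs_sub _ _).trans ?_
      rw [abs_mul, abs_mul]
      have a1 := h2 (j + 1) (by omega)
      have a2 := h2 j (by omega)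
      have b1 : |1 / M| ≤ 1 := by
        rw [abs_of_nonneg (by positivity), div_le_one (by positivity)]; exact hM1
      have b2 : |r / M| ≤ 1 := by
        rw [abs_div, abs_of_nonneg (by positivity : 0 ≤ M), div_le_one (by positivity)]; exact hMr
      have c1 := mul_le_mul b1 a1 (abs_nonneg _) zero_le_one
      have c2 := mul_le_mul b2 a2 (abs_nonneg _) zero_le_one
      rw [pow_succ]
      linarith

/-- For a root with |r| ≤ 2 Y the denominator is at most 2 Y. A root further out is at distance at
least |r| / 2 from y, and the division by |r| leaves a constant, so distant roots do no harm. -/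
theorem le_abs_sub_div_max {y r ρ Y : ℝ} (hY : 1 ≤ Y) (hy : |y| ≤ Y) (hρY : ρ ≤ Y)
    (h : ρ ≤ |y - r|) : ρ / (2 * Y) ≤ |(y - r) / max 1 (|r|)| := by
  have hM1 : 1 ≤ max 1 |r| := le_max_left _ _
  rw [abs_div, abs_of_nonneg (by positivity : 0 ≤ max 1 |r|), div_le_div_iff₀ (by positivity) (by positivity)]
  by_cases hr : |r| ≤ 2 * Y
  · have : max 1 |r| ≤ 2 * Y := max_le (by linarith) hr
    exact mul_le_mul h this (by positivity) (abs_nonneg _)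
  · push Not at hr
    rw [max_eq_right (by linarith)]
    have h1 : |r| / 2 ≤ |y - r| := by
      have := abs_sub_abs_le_abs_sub r y
      rw [abs_sub_comm] at this
      linarith
    calc ρ * |r| ≤ Y * |r| := by gcongr
      _ = |r| / 2 * (2 * Y) := by ring
      _ ≤ _ := by gcongr

/-- A lower bound for the integral of a function against a product of normalised linear factors
with the same signs. -/
theorem le_integral_prod_mul {f : ℝ → ℝ} {S : Finset ℝ} {m : ℕ} (hS : S.card ≤ m) {x w Y : ℝ}
    (hw : 0 < w) (hw1 : w ≤ 1) (hY : 1 ≤ Y) (hx : |x| + w ≤ Y)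
    (hf : ∀ y, |y - x| ≤ w → 1 / 2 ≤ |f y|)
    (hint : Integrable fun y => (∏ r ∈ S, (y - r) / max 1 |r|) * f y)
    (hs : ∀ y, 0 ≤ (∏ r ∈ S, (y - r) / max 1 |r|) * f y) :
    w * (1 / 2 * (w / (2 * m + 1) / (2 * Y)) ^ m) ≤
      ∫ y, (∏ r ∈ S, (y - r) / max 1 |r|) * f y := by
  set ρ := w / (2 * m + 1) with hρ
  have hm0 : (0 : ℝ) ≤ m := Nat.cast_nonneg m
  have hρ0 : 0 < ρ := by positivity
  have hρw : ρ ≤ w := div_le_self hw.le (by linarith)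
  have hρY : ρ ≤ Y := by linarith [abs_nonneg x]
  -- The interval has length 2 w, and the neighbourhoods of the at most m roots have total length at
  -- most 2 m ρ ≤ w. What remains has measure at least w, and all the linear factors are bounded
  -- below on it.
  set G := Set.Icc (x - w) (x + w) \ ⋃ r ∈ S, Set.Ioo (r - ρ) (r + ρ) with hG
  have hGm : MeasurableSet G := measurableSet_Icc.diff
    (Finset.measurableSet_biUnion _ fun _ _ => measurableSet_Ioo)
  have hGfin : volume G ≠ ⊤ := (measure_mono Set.sdiff_subset |>.trans_lt (by simp)).ne
  have hGvol : w ≤ volume.real G := by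
    have h1 : volume.real (Set.Icc (x - w) (x + w)) ≤
        volume.real G + volume.real (⋃ r ∈ S, Set.Ioo (r - ρ) (r + ρ)) := by
      refine (measureReal_mono (fun y hy => ?_) ?_).trans (measureReal_union_le _ _)
      · by_cases h : y ∈ ⋃ r ∈ S, Set.Ioo (r - ρ) (r + ρ)
        · exact Or.inr h
        · exact Or.inl ⟨hy, h⟩
      · refine (measure_union_lt_top hGfin.lt_top ?_).ne
        exact (measure_biUnion_finset_le _ _).trans_lt (ENNReal.sum_lt_top.2 fun r _ => by simp)
    have h2 : volume.real (⋃ r ∈ S, Set.Ioo (r - ρ) (r + ρ)) ≤ m * (2 * ρ) := by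
      refine (measureReal_biUnion_finset_le _ _).trans ?_
      have : ∀ r ∈ S, volume.real (Set.Ioo (r - ρ) (r + ρ)) = 2 * ρ := by
        intro r _
        rw [Real.volume_real_Ioo_of_le (by linarith)]; ring
      rw [Finset.sum_congr rfl this, Finset.sum_const, nsmul_eq_mul]
      gcongr
    rw [Real.volume_real_Icc_of_le (by linarith)] at h1
    have h3 : m * (2 * ρ) ≤ w := by
      rw [hρ, ← mul_div_assoc, ← mul_div_assoc, div_le_iff₀ (by positivity)]
      nlinarith
    linarith
  have hbd : ∀ y ∈ G, 1 / 2 * (ρ / (2 * Y)) ^ m ≤ (∏ r ∈ S, (y - r) / max 1 |r|) * f y := by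
    intro y hy
    have hyx : |y - x| ≤ w := by
      rw [abs_le]; constructor <;> linarith [hy.1.1, hy.1.2]
    have hyY : |y| ≤ Y := by
      have := abs_add_le x (y - x)
      rw [add_sub_cancel] at this
      linarith
    rw [← abs_of_nonneg (hs y), abs_mul, mul_comm, Finset.abs_prod]
    refine mul_le_mul ?_ (hf y hyx) (by norm_num) (Finset.prod_nonneg fun _ _ => abs_nonneg _)
    have hq1 : ρ / (2 * Y) ≤ 1 := by rw [div_le_one (by positivity)]; linarith
    calc (ρ / (2 * Y)) ^ m ≤ (ρ / (2 * Y)) ^ S.card :=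
          pow_le_pow_of_le_one (by positivity) hq1 hS
      _ = ∏ r ∈ S, (ρ / (2 * Y)) := by rw [Finset.prod_const]
      _ ≤ _ := by
        refine Finset.prod_le_prod (fun _ _ => by positivity) fun r hr => ?_
        refine le_abs_sub_div_max hY hyY hρY ?_
        by_contra hlt
        rw [not_le, abs_lt] at hlt
        exact hy.2 (Set.mem_biUnion hr ⟨by linarith [hlt.1], by linarith [hlt.2]⟩)
  calc w * (1 / 2 * (ρ / (2 * Y)) ^ m) ≤ volume.real G * (1 / 2 * (ρ / (2 * Y)) ^ m) := by gcongr
    _ = ∫ y in G, (1 / 2 * (ρ / (2 * Y)) ^ m) := by rw [setIntegral_const, smul_eq_mul]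
    _ ≤ ∫ y in G, (∏ r ∈ S, (y - r) / max 1 |r|) * f y :=
        setIntegral_mono_on (integrableOn_const hGfin) hint.integrableOn hGm hbd
    _ ≤ _ := setIntegral_le_integral hint (Filter.Eventually.of_forall hs)

theorem exists_sign_pattern_gaussDensity {ι : Type*} [Fintype ι] {c μ u : ι → ℝ} (hu : ∀ i, 0 < u i)
    (hinj : Function.Injective u) (hc : ∃ i, c i ≠ 0) :
    ∃ S : Finset ℝ, S.card ≤ 2 * Fintype.card ι - 2 ∧ ∃ σ : ℝ, (σ = 1 ∨ σ = -1) ∧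
      ∀ y, 0 ≤ (∏ r ∈ S, (y - r)) * (σ * ∑ i, c i * gaussDensity (μ i) (u i) y) := by
  refine exists_finset_sign_pattern ?_ ?_
  · exact continuous_finsetSum _ fun i _ => continuous_const.mul (continuous_gaussDensity _ _)
  · have := encard_zeros_sum_exp_le (Fintype.card ι) (Finset.univ : Finset ι) rfl
      (fun i => 1 / (2 * u i)) (fun i => μ i / u i)
      (fun i => c i * ((√(2 * Real.pi * u i))⁻¹ * Real.exp (-μ i ^ 2 / (2 * u i))))
      (fun i _ => by have := hu i; positivity)
      (fun i _ j _ hij => hinj (by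
        have h1 := hu i
        have h2 := hu j
        simp only at hij
        rw [div_eq_div_iff (by positivity) (by positivity)] at hij
        linarith))
      (by
        obtain ⟨i, hi⟩ := hc
        refine ⟨i, Finset.mem_univ _, mul_ne_zero hi ?_⟩
        have := hu i
        positivity)
    convert this using 6 with x i
    rw [gaussDensity, mul_assoc (c i), mul_assoc _ (Real.exp _), ← Real.exp_add]
    congr 3
    have := (hu i).ne'
    field_simp
    ring

/-- If a signed mixture of Gaussians with separated parameters has small moments, then the Gaussian
of the least variance has a small coefficient. -/
theorem exists_coeff_le_of_least_var (m N : ℕ) (hNm : 2 * N - 2 ≤ m) : ∃ a : ℕ, ∀ t : ℝ, 0 < t →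
    t ≤ 1 / 2 → ∀ {ι : Type} [Fintype ι] (c μ v : ι → ℝ), Fintype.card ι = N →
    (∀ i, |c i| ≤ 1) → (∀ i, |μ i| ≤ 1 / t) → (∀ i, |v i| ≤ 1 / t) →
    (∀ i j, i ≠ j → t ≤ |μ i - μ j| + |v i - v j|) → Function.Injective v →
    ∀ i₀, (∀ i, v i₀ ≤ v i) →
    (∀ j ≤ m, |∑ i, c i * gaussMoment (μ i) (v i) j| ≤ t ^ a) → |c i₀| ≤ t := by
  classical
  choose C hC1 hC using exists_abs_sum_gaussMoment_shift_le
  set Cm := ∑ j ∈ Finset.range (m + 1), C j with hCm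
  have hCj : ∀ j ≤ m, C j ≤ Cm := fun j hj =>
    Finset.single_le_sum (f := C) (fun i _ => by linarith [hC1 i]) (Finset.mem_range.2 (by omega))
  have hCm0 : 0 ≤ Cm := Finset.sum_nonneg fun i _ => by linarith [hC1 i]
  set κ₁ : ℝ := 1 / (9 * (2 * N + 1) ^ 2 * (2 * (N + 1))) with hκ₁
  have hκ₁0 : 0 < κ₁ := by positivity
  set κ₂ : ℝ := κ₁ * (1 / 2 * (κ₁ / (2 * m + 1) / 4) ^ m) with hκ₂
  have hκ₂0 : 0 < κ₂ := by positivity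
  obtain ⟨b, hb⟩ := exists_mul_pow_le (2 ^ m * Cm * 3 ^ m) (κ₂ / 2) (by positivity)
  -- The lower bound for the integral will be of order t ^ (4 + 5 * m): the interval has width of
  -- order t ^ 4 and each of the m factors is of order t ^ 5. The shift of the variances costs (3 /
  -- t) ^ m, and t ^ b absorbs the constants.
  refine ⟨4 + 6 * m + b, fun t ht ht2 ι _ c μ v hcard hc hμ hv hsep hinj i₀ hmin hη => ?_⟩
  by_contra! hlt
  have ht1 : 2 ≤ 1 / t := by rw [le_div_iff₀ ht]; linarith
  have hN1 : 1 ≤ N := by rw [← hcard]; exact Fintype.card_pos_iff.2 ⟨i₀⟩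
  have hN1' : (1 : ℝ) ≤ N := by exact_mod_cast hN1
  -- This is to become the least variance. The corresponding density has at its mean a value of at
  -- least (2 * N + 1) / t ^ 2, since 2 π ≤ 9. Its coefficient exceeds t, so this term is at least
  -- (2 * N + 1) / t, whereas the others together are at most 2 * N / t.
  set s : ℝ := (t ^ 2 / (3 * (2 * N + 1))) ^ 2 with hs
  have hs0 : 0 < s := by positivity
  have hs1 : s ≤ 1 := by
    rw [hs, sq_le_one_iff₀ (by positivity), div_le_one (by positivity)]
    nlinarith
  set u : ι → ℝ := fun i => v i + (s - v i₀) with hu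
  have hus : ∀ i, s ≤ u i := fun i => by simp only [hu]; linarith [hmin i]
  have hu0 : ∀ i, 0 < u i := fun i => hs0.trans_le (hus i)
  have hui₀ : u i₀ = s := by simp [hu]
  have huinj : Function.Injective u := fun i j h => hinj (by simpa [hu] using h)
  set f : ℝ → ℝ := fun y => ∑ i, c i * gaussDensity (μ i) (u i) y with hf
  obtain ⟨S, hS, σ, hσ, hsgn⟩ := exists_sign_pattern_gaussDensity (c := c) (μ := μ) hu0 huinj
    ⟨i₀, fun h => by rw [h] at hlt; simp at hlt; linarith⟩
  rw [hcard] at hS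
  have hSm := hS.trans hNm
  -- the moments of `f`
  have hshift : 1 + |s - v i₀| ≤ 3 / t := by
    have h1 := abs_sub s (v i₀)
    rw [abs_of_pos hs0] at h1
    have h2 := hv i₀
    have : 3 / t = 3 * (1 / t) := by ring
    linarith
  set η : ℝ := Cm * (3 / t) ^ m * t ^ (4 + 6 * m + b) with hηdef
  have h3t : 1 ≤ 3 / t := by rw [le_div_iff₀ ht]; linarith
  have hmom : ∀ j ≤ m, |∑ i, c i * gaussMoment (μ i) (u i) j| ≤ η := by
    intro j hj
    refine (hC j c μ v _ (s - v i₀) fun l hl => hη l (hl.trans hj)).trans ?_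
    rw [hηdef]
    have h1 : (1 + |s - v i₀|) ^ j ≤ (3 / t) ^ m :=
      (pow_le_pow_left₀ (by positivity) hshift j).trans (pow_le_pow_right₀ h3t hj)
    have := hCj j hj
    gcongr
  have hint : ∀ j : ℕ, Integrable fun y => y ^ j * (σ * f y) := by
    intro j
    have : (fun y => y ^ j * (σ * f y)) =
        fun y => ∑ i, σ * c i * (y ^ j * gaussDensity (μ i) (u i) y) := by
      ext y
      simp only [hf, Finset.mul_sum]
      exact Finset.sum_congr rfl fun i _ => by ring
    rw [this]
    exact integrable_finsetSum _ fun i _ => (integral_pow_mul_gaussDensity (hu0 i) j).1.const_mul _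
  have hσ1 : |σ| = 1 := by rcases hσ with rfl | rfl <;> simp
  have hval : ∀ j ≤ m, |∫ y, y ^ j * (σ * f y)| ≤ η := by
    intro j hj
    have : (fun y => y ^ j * (σ * f y)) =
        fun y => ∑ i, σ * c i * (y ^ j * gaussDensity (μ i) (u i) y) := by
      ext y
      simp only [hf, Finset.mul_sum]
      exact Finset.sum_congr rfl fun i _ => by ring
    rw [this, integral_finsetSum _ fun i _ =>
      (integral_pow_mul_gaussDensity (hu0 i) j).1.const_mul _]
    simp only [integral_const_mul, (integral_pow_mul_gaussDensity (hu0 _) j).2, mul_assoc σ]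
    rw [← Finset.mul_sum, abs_mul, hσ1, one_mul]
    exact hmom j hj
  obtain ⟨hI, hle⟩ := abs_integral_prod_mul_le hint hval S
  have hupper := hle 0 (by omega)
  simp only [pow_zero, one_mul] at hupper
  -- a lower bound for `f` near `μ i₀`
  have hpeak : 1 ≤ |f (μ i₀)| := by
    have h1 : f (μ i₀) = c i₀ * gaussDensity (μ i₀) (u i₀) (μ i₀) +
        ∑ i ∈ Finset.univ.erase i₀, c i * gaussDensity (μ i) (u i) (μ i₀) :=
      (Finset.add_sum_erase _ _ (Finset.mem_univ i₀)).symm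
    have h2 : |∑ i ∈ Finset.univ.erase i₀, c i * gaussDensity (μ i) (u i) (μ i₀)| ≤ N * (2 / t) := by
      refine (Finset.abs_sum_le_sum_abs _ _).trans ?_
      have : ∀ i ∈ Finset.univ.erase i₀, |c i * gaussDensity (μ i) (u i) (μ i₀)| ≤ 2 / t := by
        intro i hi
        rw [abs_mul, abs_of_nonneg (gaussDensity_nonneg _ _ _)]
        have hd : gaussDensity (μ i) (u i) (μ i₀) ≤ 2 / t := by
          refine gaussDensity_le_of_sep (hu0 i) ht ht2 ?_
          have := hsep i₀ i (Finset.ne_of_mem_erase hi).symm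
          by_cases h : t / 2 ≤ |μ i₀ - μ i|
          · exact Or.inr h
          · left
            have h3 : |v i₀ - v i| = v i - v i₀ := by
              rw [abs_sub_comm, abs_of_nonneg (by linarith [hmin i])]
            rw [h3] at this
            simp only [hu]
            linarith
        calc |c i| * gaussDensity (μ i) (u i) (μ i₀) ≤ 1 * (2 / t) :=
              mul_le_mul (hc i) hd (gaussDensity_nonneg _ _ _) zero_le_one
          _ = 2 / t := one_mul _
      refine (Finset.sum_le_sum this).trans ?_
      rw [Finset.sum_const, nsmul_eq_mul]
      have : ((Finset.univ.erase i₀).card : ℝ) ≤ N := by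
        rw [← hcard]; exact_mod_cast Finset.card_le_univ _
      gcongr
    have h3 : (2 * N + 1) / t ≤ |c i₀ * gaussDensity (μ i₀) (u i₀) (μ i₀)| := by
      have e : gaussDensity (μ i₀) (u i₀) (μ i₀) = (√(2 * Real.pi * s))⁻¹ := by
        simp [gaussDensity, hui₀]
      have h4 : √(2 * Real.pi * s) ≤ t ^ 2 / (2 * N + 1) := by
        apply Real.sqrt_le_iff.2 ⟨by positivity, ?_⟩
        have : (t ^ 2 / (2 * N + 1)) ^ 2 = 9 * s := by rw [hs]; field_simp; ring
        rw [this]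
        nlinarith [Real.pi_lt_d2]
      have h5 : 0 < √(2 * Real.pi * s) := by positivity
      rw [e, abs_mul, abs_inv, abs_of_pos h5, ← div_eq_mul_inv, div_le_div_iff₀ ht h5]
      calc (2 * N + 1) * √(2 * Real.pi * s) ≤ (2 * N + 1) * (t ^ 2 / (2 * N + 1)) := by gcongr
        _ = t * t := by field_simp
        _ ≤ |c i₀| * t := by gcongr
    have h6 : (2 * N + 1) / t = N * (2 / t) + 1 / t := by ring
    rw [h1]
    have h7 := abs_sub_abs_le_abs_sub (c i₀ * gaussDensity (μ i₀) (u i₀) (μ i₀))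
      (-∑ i ∈ Finset.univ.erase i₀, c i * gaussDensity (μ i) (u i) (μ i₀))
    rw [abs_neg, sub_neg_eq_add] at h7
    linarith
  -- All the variances are at least s, so f has Lipschitz constant at most N / s and varies by at
  -- most 1/2 over this distance.
  set w : ℝ := s / (2 * (N + 1)) with hw
  have hw0 : 0 < w := by positivity
  have hwκ : w = κ₁ * t ^ 4 := by rw [hw, hs, hκ₁]; field_simp; ring
  have hw1 : w ≤ 1 := by
    rw [hw, div_le_one (by positivity)]; linarith
  have hflat : ∀ y, |y - μ i₀| ≤ w → 1 / 2 ≤ |σ * f y| := by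
    intro y hy
    have h1 : |f y - f (μ i₀)| ≤ N * (1 / s * w) := by
      simp only [hf]
      rw [← Finset.sum_sub_distrib]
      refine (Finset.abs_sum_le_sum_abs _ _).trans ?_
      have : ∀ i ∈ Finset.univ, |c i * gaussDensity (μ i) (u i) y -
          c i * gaussDensity (μ i) (u i) (μ i₀)| ≤ 1 / s * w := by
        intro i _
        rw [← mul_sub, abs_mul]
        calc |c i| * |gaussDensity (μ i) (u i) y - gaussDensity (μ i) (u i) (μ i₀)|
            ≤ 1 * (1 / u i * |y - μ i₀|) :=
              mul_le_mul (hc i) (abs_gaussDensity_sub_le (hu0 i) _ _) (abs_nonneg _) zero_le_one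
          _ ≤ 1 / s * w := by rw [one_mul]; have := hus i; gcongr
      refine (Finset.sum_le_sum this).trans ?_
      rw [Finset.sum_const, Finset.card_univ, hcard, nsmul_eq_mul]
    have h2 : N * (1 / s * w) ≤ 1 / 2 := by
      have : N * (1 / s * w) = N / (2 * (N + 1)) := by rw [hw]; field_simp
      rw [this, div_le_div_iff₀ (by positivity) (by norm_num)]
      linarith
    rw [abs_mul, hσ1, one_mul]
    have h3 := abs_sub_abs_le_abs_sub (f (μ i₀)) (f y)
    rw [abs_sub_comm] at h3
    linarith
  have hsgn' : ∀ y, 0 ≤ (∏ r ∈ S, (y - r) / max 1 |r|) * (σ * f y) := by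
    intro y
    rw [Finset.prod_div_distrib, div_mul_eq_mul_div]
    exact div_nonneg (hsgn y) (Finset.prod_nonneg fun r _ => by positivity)
  have hlower := le_integral_prod_mul (Y := 2 / t) hSm hw0 hw1
    (by rw [le_div_iff₀ ht]; linarith)
    (by have := hμ i₀; have : 2 / t = 1 / t + 1 / t := by ring
        linarith) hflat (by simpa using hI 0) hsgn'
  have h8 := hlower.trans ((le_abs_self _).trans hupper)
  have h9 : w * (1 / 2 * (w / (2 * m + 1) / (2 * (2 / t))) ^ m) = κ₂ * t ^ (4 + 5 * m) := by
    have : w / (2 * m + 1) / (2 * (2 / t)) = κ₁ / (2 * m + 1) / 4 * t ^ 5 := by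
      rw [hwκ]; field_simp; ring
    rw [this, hwκ, hκ₂, mul_pow]
    ring
  have h10 : η = Cm * 3 ^ m * t ^ b * t ^ (4 + 5 * m) := by
    rw [hηdef, div_pow, show 4 + 6 * m + b = m + b + (4 + 5 * m) by ring, pow_add, pow_add]
    field_simp
  have h11 : (2 : ℝ) ^ S.card ≤ 2 ^ m := pow_le_pow_right₀ (by norm_num) hSm
  have h12 : (2 : ℝ) ^ S.card * η ≤ κ₂ / 2 * t ^ (4 + 5 * m) := by
    calc (2 : ℝ) ^ S.card * η ≤ 2 ^ m * η := by
          have : 0 ≤ η := by rw [h10]; positivity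
          gcongr
      _ = (2 ^ m * Cm * 3 ^ m * t ^ b) * t ^ (4 + 5 * m) := by rw [h10]; ring
      _ ≤ _ := by have := hb t ht ht2; gcongr
  rw [h9] at h8
  have : 0 < t ^ (4 + 5 * m) := by positivity
  nlinarith

/-! ### Quantitative linear independence of separated Gaussians. -/

theorem continuous_gaussMoment (μ : ℝ) (n : ℕ) : Continuous fun v => gaussMoment μ v n := by
  have : ∀ n, Continuous (fun v => gaussMoment μ v n) ∧
      Continuous fun v => gaussMoment μ v (n + 1) := by
    intro n
    induction n with
    | zero => exact ⟨by simpa [gaussMoment] using continuous_const,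
        by simpa [gaussMoment] using continuous_const⟩
    | succ n ih =>
      refine ⟨ih.2, ?_⟩
      obtain ⟨h1, h2⟩ := ih
      simp only [gaussMoment]
      fun_prop
  exact (this n).1

/-- Uniform bounds for the moments up to a given order. -/
theorem exists_gaussMoment_bounds (m : ℕ) : ∃ D : ℝ, 1 ≤ D ∧ ∀ j ≤ m, ∀ B : ℝ, 1 ≤ B →
    (∀ μ v : ℝ, |μ| ≤ B → |v| ≤ B → |gaussMoment μ v j| ≤ D * B ^ m) ∧
    ∀ μ v μ' v' : ℝ, |μ| ≤ B → |v| ≤ B → |μ'| ≤ B → |v'| ≤ B →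
      |gaussMoment μ v j - gaussMoment μ' v' j| ≤ D * B ^ m * (|μ - μ'| + |v - v'|) := by
  choose C hC1 hC using exists_abs_gaussMoment_le
  choose C' hC1' hC' using exists_abs_gaussMoment_sub_le
  have h1 : ∀ j ≤ m, C j ≤ ∑ j ∈ Finset.range (m + 1), (C j + C' j) := fun j hj => by
    refine le_trans ?_ (Finset.single_le_sum (f := fun j => C j + C' j)
      (fun i _ => by linarith [hC1 i, hC1' i]) (Finset.mem_range.2 (by omega : j < m + 1)))
    linarith [hC1' j]
  have h2 : ∀ j ≤ m, C' j ≤ ∑ j ∈ Finset.range (m + 1), (C j + C' j) := fun j hj => by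
    refine le_trans ?_ (Finset.single_le_sum (f := fun j => C j + C' j)
      (fun i _ => by linarith [hC1 i, hC1' i]) (Finset.mem_range.2 (by omega : j < m + 1)))
    linarith [hC1 j]
  refine ⟨_, (hC1 0).trans (h1 0 (Nat.zero_le _)), fun j hj B hB => ⟨fun μ v hμ hv => ?_,
    fun μ v μ' v' hμ hv hμ' hv' => ?_⟩⟩
  · refine (hC j B μ v hB hμ hv).trans ?_
    have a := h1 j hj
    have b := pow_le_pow_right₀ hB hj
    have c := hC1 j
    gcongr
    linarith
  · refine (hC' j B μ v μ' v' hB hμ hv hμ' hv').trans ?_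
    have a := h2 j hj
    have b := pow_le_pow_right₀ hB hj
    have c := hC1' j
    gcongr
    linarith

/-- Gaussians with separated parameters and distinct variances are linearly independent on
polynomials of small degree, with polynomial bounds. -/
theorem exists_coeff_le_of_injective (m N : ℕ) (hNm : 2 * N - 2 ≤ m) : ∃ e : ℕ, ∀ θ : ℝ, 0 < θ →
    θ ≤ 1 / 2 → ∀ {ι : Type} [Fintype ι] (c μ v : ι → ℝ), Fintype.card ι = N →
    (∀ i, |c i| ≤ 1) → (∀ i, |μ i| ≤ 1 / θ) → (∀ i, |v i| ≤ 1 / θ) →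
    (∀ i j, i ≠ j → θ ≤ |μ i - μ j| + |v i - v j|) → Function.Injective v →
    (∀ j ≤ m, |∑ i, c i * gaussMoment (μ i) (v i) j| ≤ θ ^ e) → ∀ i, |c i| ≤ θ := by
  classical
  induction N with
  | zero =>
    refine ⟨0, fun θ _ _ ι _ c μ v hcard _ _ _ _ _ _ i => ?_⟩
    exact ((Fintype.card_eq_zero_iff.1 hcard).false i).elim
  | succ N ih =>
    obtain ⟨e₀, he₀⟩ := ih (by omega)
    obtain ⟨a, ha⟩ := exists_coeff_le_of_least_var m (N + 1) hNm
    obtain ⟨D, hD1, hD⟩ := exists_gaussMoment_bounds m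
    obtain ⟨b', hb'⟩ := exists_mul_pow_le D 1 one_pos
    -- The bound on the least-variance coefficient is used with t = θ ^ b. That coefficient is then
    -- so small that its term, whose moment is at most D * θ ^ (-m), can be deleted: the moments of
    -- the remaining Gaussians still satisfy the induction hypothesis.
    set b := b' + e₀ + m + 1 with hb
    refine ⟨a * b + e₀ + 1, fun θ hθ hθ2 ι _ c μ v hcard hc hμ hv hsep hinj hη => ?_⟩
    have : Nonempty ι := Fintype.card_pos_iff.1 (by omega)
    obtain ⟨i₀, hi₀⟩ := Finite.exists_min v
    have hθ1 : θ ≤ 1 := by linarith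
    have htθ : θ ^ b ≤ θ := pow_le_of_le_one hθ.le hθ1 (by omega)
    have ht : 0 < θ ^ b := by positivity
    have hinv : 1 / θ ≤ 1 / θ ^ b := one_div_le_one_div_of_le ht htθ
    have h0 : |c i₀| ≤ θ ^ b := by
      refine ha (θ ^ b) ht (htθ.trans hθ2) c μ v hcard hc (fun i => (hμ i).trans hinv)
        (fun i => (hv i).trans hinv) (fun i j hij => htθ.trans (hsep i j hij)) hinj i₀ hi₀
        fun j hj => (hη j hj).trans ?_
      rw [← pow_mul]
      exact pow_le_pow_of_le_one hθ.le hθ1 (by rw [mul_comm]; omega)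
    have hrest : ∀ i : {i // i ≠ i₀}, |c i| ≤ θ := by
      refine he₀ θ hθ hθ2 (fun i : {i // i ≠ i₀} => c i) (fun i => μ i) (fun i => v i) ?_
        (fun i => hc i) (fun i => hμ i) (fun i => hv i)
        (fun i j hij => hsep i j fun h => hij (Subtype.ext h))
        (fun i j h => Subtype.ext (hinj h)) fun j hj => ?_
      · rw [Fintype.card_subtype_compl, Fintype.card_subtype_eq, hcard]; rfl
      · have h1 := Fintype.sum_eq_add_sum_subtype_ne (fun i => c i * gaussMoment (μ i) (v i) j) i₀
        have h2 := hη j hj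
        have h3 : |c i₀ * gaussMoment (μ i₀) (v i₀) j| ≤ θ ^ (e₀ + 1) := by
          rw [abs_mul]
          calc |c i₀| * |gaussMoment (μ i₀) (v i₀) j| ≤ θ ^ b * (D * (1 / θ) ^ m) := by
                have := (hD j hj (1 / θ) (by rw [le_div_iff₀ hθ]; linarith)).1 _ _ (hμ i₀) (hv i₀)
                gcongr
            _ = (D * θ ^ b') * θ ^ (e₀ + 1) := by
                rw [hb, show b' + e₀ + m + 1 = b' + (e₀ + 1) + m by ring, pow_add, pow_add, one_div,
                  inv_pow]
                field_simp
            _ ≤ 1 * θ ^ (e₀ + 1) := by have := hb' θ hθ hθ2; gcongr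
            _ = _ := one_mul _
        have h4 : θ ^ (a * b + e₀ + 1) ≤ θ ^ (e₀ + 1) :=
          pow_le_pow_of_le_one hθ.le hθ1 (by omega)
        have h5 : θ ^ (e₀ + 1) ≤ θ ^ e₀ * (1 / 2) := by rw [pow_succ]; gcongr
        rw [abs_le] at *
        constructor <;> linarith [h2.1, h2.2, h3.1, h3.2]
    intro i
    by_cases h : i = i₀
    · rw [h]; exact h0.trans htθ
    · exact hrest ⟨i, h⟩

/-- Equal variances are pulled apart by adding ζ * n i with distinct n i. For small ζ > 0 the other
hypotheses survive with θ / 2 in place of θ, by continuity; the exponent 2 * e + 1 makes the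
hypothesis on the moments strict, as θ² ≤ θ / 2. -/
theorem exists_coeff_le (m N : ℕ) (hNm : 2 * N - 2 ≤ m) : ∃ e : ℕ, ∀ θ : ℝ, 0 < θ →
    θ ≤ 1 / 2 → ∀ {ι : Type} [Fintype ι] (c μ v : ι → ℝ), Fintype.card ι = N →
    (∀ i, |c i| ≤ 1) → (∀ i, |μ i| ≤ 1 / θ) → (∀ i, |v i| ≤ 1 / θ) →
    (∀ i j, i ≠ j → θ ≤ |μ i - μ j| + |v i - v j|) →
    (∀ j ≤ m, |∑ i, c i * gaussMoment (μ i) (v i) j| ≤ θ ^ e) → ∀ i, |c i| ≤ θ := by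
  obtain ⟨e, he⟩ := exists_coeff_le_of_injective m N hNm
  refine ⟨2 * e + 1, fun θ hθ hθ2 ι _ c μ v hcard hc hμ hv hsep hη => ?_⟩
  set n : ι → ℝ := fun i => ((Fintype.equivFin ι i : ℕ) : ℝ) with hn
  have hninj : Function.Injective n := fun i j h => by
    have : (Fintype.equivFin ι i : ℕ) = Fintype.equivFin ι j := Nat.cast_injective (R := ℝ) h
    exact (Fintype.equivFin ι).injective (Fin.ext this)
  have hv' : ∀ i, Continuous fun ζ : ℝ => v i + ζ * n i := fun i => by fun_prop
  have hlt : 1 / θ < 1 / (θ / 2) := one_div_lt_one_div_of_lt (by positivity) (by linarith)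
  have E1 : ∀ i, ∀ᶠ ζ in nhdsWithin (0 : ℝ) (Set.Ioi 0), |v i + ζ * n i| ≤ 1 / (θ / 2) := fun i => by
    have : ∀ᶠ ζ in nhds (0 : ℝ), |v i + ζ * n i| < 1 / (θ / 2) :=
      (hv' i).abs.continuousAt.eventually_lt_const (by simpa using (hv i).trans_lt hlt)
    exact nhdsWithin_le_nhds (this.mono fun _ h => h.le)
  have E2 : ∀ i j, ∀ᶠ ζ in nhdsWithin (0 : ℝ) (Set.Ioi 0), i ≠ j →
      θ / 2 ≤ |μ i - μ j| + |(v i + ζ * n i) - (v j + ζ * n j)| := fun i j => by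
    by_cases hij : i = j
    · simp [hij]
    · have hc : Continuous fun ζ : ℝ => |μ i - μ j| + |(v i + ζ * n i) - (v j + ζ * n j)| := by fun_prop
      have : ∀ᶠ ζ in nhds (0 : ℝ), θ / 2 < |μ i - μ j| + |(v i + ζ * n i) - (v j + ζ * n j)| :=
        hc.continuousAt.eventually_const_lt (by
          have := hsep i j hij
          simp only [zero_mul, add_zero]
          linarith)
      exact nhdsWithin_le_nhds (this.mono fun _ h _ => h.le)
  have E3 : ∀ i j, ∀ᶠ ζ in nhdsWithin (0 : ℝ) (Set.Ioi 0), v i + ζ * n i = v j + ζ * n j → i = j :=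
      fun i j => by
    by_cases hij : i = j
    · simp [hij]
    by_cases hvij : v i = v j
    · filter_upwards [self_mem_nhdsWithin] with ζ hζ h
      rw [hvij] at h
      exact hninj (mul_left_cancel₀ (ne_of_gt hζ) (add_left_cancel h))
    · have : ∀ᶠ ζ in nhds (0 : ℝ), (v i + ζ * n i) - (v j + ζ * n j) ≠ 0 :=
        ((hv' i).sub (hv' j)).continuousAt.eventually_ne (by simpa [sub_eq_zero] using hvij)
      exact nhdsWithin_le_nhds (this.mono fun _ h h' => absurd (sub_eq_zero.2 h') h)
  have E4 : ∀ j ∈ Finset.range (m + 1), ∀ᶠ ζ in nhdsWithin (0 : ℝ) (Set.Ioi 0),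
      |∑ i, c i * gaussMoment (μ i) (v i + ζ * n i) j| ≤ (θ / 2) ^ e := fun j hj => by
    have hc : Continuous fun ζ : ℝ => |∑ i, c i * gaussMoment (μ i) (v i + ζ * n i) j| :=
      (continuous_finsetSum _ fun i _ =>
        continuous_const.mul ((continuous_gaussMoment (μ i) j).comp (hv' i))).abs
    have h1 : θ ^ (2 * e + 1) < (θ / 2) ^ e := by
      calc θ ^ (2 * e + 1) = (θ * θ) ^ e * θ := by rw [pow_succ, pow_mul, sq]
        _ ≤ (θ / 2) ^ e * θ := by gcongr; nlinarith
        _ < (θ / 2) ^ e := mul_lt_of_lt_one_right (by positivity) (by linarith)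
    have : ∀ᶠ ζ in nhds (0 : ℝ), |∑ i, c i * gaussMoment (μ i) (v i + ζ * n i) j| < (θ / 2) ^ e :=
      hc.continuousAt.eventually_lt_const (by
        simpa using (hη j (by have := Finset.mem_range.1 hj; omega)).trans_lt h1)
    exact nhdsWithin_le_nhds (this.mono fun _ h => h.le)
  obtain ⟨ζ, h1, h2, h3, h4⟩ := ((Filter.eventually_all.2 E1).and
    ((Filter.eventually_all.2 fun i => Filter.eventually_all.2 (E2 i)).and
    ((Filter.eventually_all.2 fun i => Filter.eventually_all.2 (E3 i)).and
    ((Finset.range (m + 1)).eventually_all.2 E4)))).exists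
  intro i
  refine (he (θ / 2) (by positivity) (by linarith) c μ (fun i => v i + ζ * n i) hcard hc
    (fun i => (hμ i).trans hlt.le) h1 h2 (fun i j => h3 i j)
    (fun j hj => h4 j (Finset.mem_range.2 (by omega))) i).trans (by linarith)

/-! ### Pigeonhole for windows and scales. -/

/-- Pairwise disjoint windows that contain one of finitely many numbers are few. -/
theorem card_filter_windows_le {α : Type*} [Fintype α] (d : α → ℝ) (W : ℕ → Set ℝ) (n : ℕ)
    (hW : ∀ i < n, ∀ j < n, i ≠ j → Disjoint (W i) (W j))
    [DecidablePred fun l => ∃ a, d a ∈ W l] :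
    ((Finset.range n).filter fun l => ∃ a, d a ∈ W l).card ≤ Fintype.card α := by
  by_cases hα : Nonempty α
  · have : ∀ l, ∃ a, (∃ a, d a ∈ W l) → d a ∈ W l := fun l => by
      by_cases h : ∃ a, d a ∈ W l
      · exact ⟨h.choose, fun _ => h.choose_spec⟩
      · exact ⟨hα.some, fun h' => absurd h' h⟩
    choose f hf using this
    refine Finset.card_le_card_of_injOn f (fun _ _ => Finset.mem_coe.2 (Finset.mem_univ _)) ?_
    intro i hi j hj hij
    rw [Finset.mem_coe, Finset.mem_filter, Finset.mem_range] at hi hj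
    by_contra hne
    have h1 := hf i hi.2
    rw [hij] at h1
    exact Set.disjoint_left.1 (hW i hi.1 j hj.1 hne) h1 (hf j hj.2)
  · rw [Finset.filter_false_of_mem]
    · simp
    · rintro l _ ⟨a, _⟩
      exact hα ⟨a⟩

/-- The K + 1 intervals between consecutive scales are disjoint, so K numbers cannot meet all of
them. -/
theorem exists_gap {α : Type*} [Fintype α] (d : α → ℝ) {τ : ℕ → ℝ} (hτ : Antitone τ) {K : ℕ}
    (hK : Fintype.card α ≤ K) : ∃ l ≤ K, ∀ a, d a < τ (l + 1) ∨ τ l ≤ d a := by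
  classical
  by_contra! h
  have h1 := card_filter_windows_le d (fun l => Set.Ico (τ (l + 1)) (τ l)) (K + 1) ?_
  · rw [Finset.filter_true_of_mem, Finset.card_range] at h1
    · omega
    · intro l hl
      obtain ⟨a, ha⟩ := h l (by have := Finset.mem_range.1 hl; omega)
      exact ⟨a, ha⟩
  · have key : ∀ i j, i < j → Disjoint (Set.Ico (τ (i + 1)) (τ i)) (Set.Ico (τ (j + 1)) (τ j)) := by
      intro i j hij
      rw [Set.disjoint_left]
      intro x hx hx'
      exact absurd (hx'.2.trans_le (hτ (by omega : i + 1 ≤ j))) (not_lt.2 hx.1)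
    intro i _ j _ hij
    rcases lt_or_gt_of_ne hij with h | h
    · exact key i j h
    · exact (key j i h).symm

/-! ### Moments identify the parameters of a separated mixture. -/

theorem paramDist_comm (a b : Component) : paramDist a b = paramDist b a := by
  unfold paramDist; rw [abs_sub_comm, abs_sub_comm a.var]

theorem paramDist_triangle (a b c : Component) : paramDist a c ≤ paramDist a b + paramDist b c := by
  unfold paramDist
  have h1 := abs_sub_le a.mean b.mean c.mean
  have h2 := abs_sub_le a.var b.var c.var
  linarith

theorem paramDist_self (a : Component) : paramDist a a = 0 := by
  simp [paramDist]

/-- The moments of a Gaussian mixture. -/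
def Mixture.moment (F : Mixture) (j : ℕ) : ℝ :=
  ∑ i, (F.comp i).weight * gaussMoment (F.comp i).mean (F.comp i).var j

/-- The weights are at least `θ` and sum to one, the components are `θ`-separated, and the means
and variances have absolute value at most `1 / θ`. -/
structure Mixture.IsSeparated (F : Mixture) (θ : ℝ) : Prop where
  weight : ∀ i, θ ≤ (F.comp i).weight
  sum : ∑ i, (F.comp i).weight = 1
  mean : ∀ i, |(F.comp i).mean| ≤ 1 / θ
  var : ∀ i, |(F.comp i).var| ≤ 1 / θ
  sep : ∀ i j, i ≠ j → θ ≤ paramDist (F.comp i) (F.comp j)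

theorem Mixture.moment_zero (F : Mixture) : F.moment 0 = ∑ i, (F.comp i).weight := by
  simp [Mixture.moment, gaussMoment]

/-- The moments of a separated mixture of at most `k` Gaussians up to order `4 * k - 2` determine
its parameters, with polynomial accuracy. -/
theorem exists_matching (k : ℕ) : ∃ e : ℕ, ∀ θ : ℝ, 0 < θ → θ ≤ 1 / 2 → ∀ F G : Mixture,
    F.size ≤ k → G.size ≤ k → F.IsSeparated θ → G.IsSeparated θ →
    (∀ j ≤ 4 * k - 2, |F.moment j - G.moment j| ≤ θ ^ e) →
    ∃ π : Fin F.size → Fin G.size, Function.Bijective π ∧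
      ∀ i, |(F.comp i).weight - (G.comp (π i)).weight| ≤ θ ∧
        paramDist (F.comp i) (G.comp (π i)) ≤ θ := by
  classical
  set m := 4 * k - 2 with hm
  have hex : ∀ N : Fin (2 * k + 1), ∃ e : ℕ, ∀ θ : ℝ, 0 < θ →
    θ ≤ 1 / 2 → ∀ {ι : Type} [Fintype ι] (c μ v : ι → ℝ), Fintype.card ι = N →
    (∀ i, |c i| ≤ 1) → (∀ i, |μ i| ≤ 1 / θ) → (∀ i, |v i| ≤ 1 / θ) →
    (∀ i j, i ≠ j → θ ≤ |μ i - μ j| + |v i - v j|) →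
    (∀ j ≤ m, |∑ i, c i * gaussMoment (μ i) (v i) j| ≤ θ ^ e) → ∀ i, |c i| ≤ θ :=
    fun N => exists_coeff_le m N (by have := N.2; omega)
  choose e₁ he₁ using hex
  set E := ∑ N, e₁ N with hE
  have hEN : ∀ N, e₁ N ≤ E := fun N => Finset.single_le_sum (fun _ _ => Nat.zero_le _) (Finset.mem_univ N)
  obtain ⟨D, hD1, hD⟩ := exists_gaussMoment_bounds m
  obtain ⟨b', hb'⟩ := exists_mul_pow_le D 1 one_pos
  -- Each scale is the p-th power of the preceding one. This makes it safe to merge components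
  -- closer than the smaller scale ρ: the moments change by at most T ^ (E + 2), where T is the
  -- larger scale.
  set p := b' + E + m + 2 with hp
  -- The smallest scale that can be selected is (θ / 4) ^ p ^ k ^ 2. The factor 3 comes from θ ^ 3 ≤
  -- θ / 4, and E + 1 is the accuracy needed relative to the selected scale.
  set e := 3 * p ^ k ^ 2 * (E + 1) with he
  refine ⟨e, fun θ hθ hθ2 F G hF hG hFs hGs hη => ?_⟩
  set τ : ℕ → ℝ := fun l => (θ / 4) ^ p ^ l with hτ
  have hθ4 : 0 < θ / 4 := by positivity
  have hθ41 : θ / 4 ≤ 1 := by linarith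
  have hp0 : 0 < p := by omega
  have hτanti : Antitone τ := fun i j hij =>
    pow_le_pow_of_le_one hθ4.le hθ41 (Nat.pow_le_pow_right hp0 hij)
  have hcardpairs : Fintype.card (Fin F.size × Fin G.size) ≤ k ^ 2 := by
    rw [Fintype.card_prod, Fintype.card_fin, Fintype.card_fin, sq]
    exact Nat.mul_le_mul hF hG
  obtain ⟨l, hl, hgap⟩ := exists_gap
    (fun q : Fin F.size × Fin G.size => paramDist (F.comp q.1) (G.comp q.2)) hτanti hcardpairs
  set T := τ l with hT
  set ρ := τ (l + 1) with hρ
  have hT0 : 0 < T := by rw [hT]; positivity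
  have hTθ : T ≤ θ / 4 := by
    have := hτanti (Nat.zero_le l)
    simpa [hτ] using this
  have hρT : ρ = T ^ p := by rw [hρ, hT, hτ]; simp only; rw [← pow_mul, pow_succ]
  have hρ0 : 0 < ρ := by rw [hρT]; positivity
  have hT1 : T ≤ 1 / 2 := by linarith
  have hρ2 : 2 * ρ ≤ T := by
    have : T ^ p ≤ T ^ 2 := pow_le_pow_of_le_one hT0.le (by linarith) (by omega)
    rw [hρT]; nlinarith
  have hTinv : 1 / θ ≤ 1 / T := one_div_le_one_div_of_le hT0 (by linarith)
  have hηT : θ ^ e ≤ T ^ (E + 1) := by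
    have h1 : θ ^ 3 ≤ θ / 4 := by
      have : θ ^ 2 ≤ (1 / 2) ^ 2 := by gcongr
      calc θ ^ 3 = θ * θ ^ 2 := by ring
        _ ≤ θ * (1 / 2) ^ 2 := by gcongr
        _ = θ / 4 := by ring
    have h2 : (θ / 4) ^ p ^ k ^ 2 ≤ T := by rw [hT]; exact hτanti hl
    calc θ ^ e = ((θ ^ 3) ^ p ^ k ^ 2) ^ (E + 1) := by rw [he, pow_mul, pow_mul]
      _ ≤ T ^ (E + 1) := by
        gcongr
        exact (pow_le_pow_left₀ (by positivity) h1 _).trans h2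
  set cl : Fin F.size → Fin G.size → Prop := fun i j =>
    paramDist (F.comp i) (G.comp j) < ρ with hcl
  have hfar : ∀ i j, ¬cl i j → T ≤ paramDist (F.comp i) (G.comp j) := fun i j h =>
    (hgap (i, j)).resolve_left h
  have huniqG : ∀ i j j', cl i j → cl i j' → j = j' := fun i j j' h h' => by
    by_contra hne
    have h1 := hGs.sep j j' hne
    have h2 := paramDist_triangle (G.comp j) (F.comp i) (G.comp j')
    rw [paramDist_comm (G.comp j) (F.comp i)] at h2
    simp only [hcl] at h h'
    linarith
  have huniqF : ∀ i i' j, cl i j → cl i' j → i = i' := fun i i' j h h' => by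
    by_contra hne
    have h1 := hFs.sep i i' hne
    have h2 := paramDist_triangle (F.comp i) (G.comp j) (F.comp i')
    rw [paramDist_comm (G.comp j)] at h2
    simp only [hcl] at h h'
    linarith
  have hGw0 : ∀ j, 0 ≤ (G.comp j).weight := fun j => hθ.le.trans (hGs.weight j)
  have hFw0 : ∀ j, 0 ≤ (F.comp j).weight := fun j => hθ.le.trans (hFs.weight j)
  have hFw1 : ∀ i, (F.comp i).weight ≤ 1 := fun i => by
    rw [← hFs.sum]
    exact Finset.single_le_sum (f := fun i => (F.comp i).weight) (fun i _ => hFw0 i) (Finset.mem_univ i)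
  have hGw1 : ∀ i, (G.comp i).weight ≤ 1 := fun i => by
    rw [← hGs.sum]
    exact Finset.single_le_sum (f := fun i => (G.comp i).weight) (fun i _ => hGw0 i) (Finset.mem_univ i)
  -- A component of `G` close to one of `F` is moved onto it; the others keep a place of their own.
  -- The resulting signed family of at most 2 * k Gaussians is T-separated, so its coefficients are
  -- at most T < θ. An unmatched component would have a coefficient of absolute value at least θ,
  -- and for a matched pair the coefficient is the difference of the weights.
  set c : Fin F.size ⊕ {j // ∀ i, ¬cl i j} → ℝ := Sum.elim
    (fun i => (F.comp i).weight - ∑ j with cl i j, (G.comp j).weight)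
    (fun j => -(G.comp j.1).weight) with hc
  set q : Fin F.size ⊕ {j // ∀ i, ¬cl i j} → Component := Sum.elim F.comp (fun j => G.comp j.1) with hq
  have hcardι : Fintype.card (Fin F.size ⊕ {j // ∀ i, ¬cl i j}) < 2 * k + 1 := by
    rw [Fintype.card_sum, Fintype.card_fin]
    have := Fintype.card_subtype_le fun j => ∀ i, ¬cl i j
    rw [Fintype.card_fin] at this
    omega
  have hsmall : ∀ x, |c x| ≤ T := by
    refine he₁ ⟨_, hcardι⟩ T hT0 hT1 c (fun x => (q x).mean) (fun x => (q x).var) rfl ?_ ?_ ?_ ?_ ?_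
    · rintro (i | j)
      · simp only [hc, Sum.elim_inl]
        have h1 : 0 ≤ ∑ j with cl i j, (G.comp j).weight := Finset.sum_nonneg fun j _ => hGw0 j
        have h2 : ∑ j with cl i j, (G.comp j).weight ≤ 1 := by
          rw [← hGs.sum]
          exact Finset.sum_le_sum_of_subset_of_nonneg (Finset.filter_subset _ _) fun j _ _ => hGw0 j
        rw [abs_le]
        constructor <;> linarith [hFw0 i, hFw1 i]
      · simp only [hc, Sum.elim_inr, abs_neg, abs_of_nonneg (hGw0 _)]
        exact hGw1 _
    · rintro (i | j)
      · exact (hFs.mean i).trans hTinv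
      · exact (hGs.mean j).trans hTinv
    · rintro (i | j)
      · exact (hFs.var i).trans hTinv
      · exact (hGs.var j).trans hTinv
    · rintro (i | j) (i' | j') hne
      · have := hFs.sep i i' (by simpa using hne)
        exact le_trans (by linarith) this
      · exact hfar i j' (j'.2 i)
      · have := hfar i' j (j.2 i')
        rw [paramDist_comm] at this
        exact this
      · have := hGs.sep j j' (fun h => hne (by rw [Subtype.ext h]))
        exact le_trans (by linarith) this
    · intro r hr
      have hsplit : ∀ j, (G.comp j).weight * gaussMoment (G.comp j).mean (G.comp j).var r =
          (if ∀ i, ¬cl i j then (G.comp j).weight * gaussMoment (G.comp j).mean (G.comp j).var r else 0) +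
          ∑ i with cl i j, (G.comp j).weight * gaussMoment (G.comp j).mean (G.comp j).var r := by
        intro j
        by_cases h : ∀ i, ¬cl i j
        · rw [if_pos h, Finset.filter_false_of_mem fun i _ => h i]; simp
        · rw [if_neg h, zero_add]
          push Not at h
          obtain ⟨i, hi⟩ := h
          have : Finset.univ.filter (fun i => cl i j) = {i} := by
            ext i'; simp only [Finset.mem_filter, Finset.mem_univ, true_and, Finset.mem_singleton]
            exact ⟨fun h => huniqF _ _ _ h hi, fun h => h ▸ hi⟩
          rw [this, Finset.sum_singleton]
      have hsum : ∑ x, c x * gaussMoment (q x).mean (q x).var r = (F.moment r - G.moment r) +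
          ∑ j, ∑ i with cl i j, (G.comp j).weight * (gaussMoment (G.comp j).mean (G.comp j).var r -
            gaussMoment (F.comp i).mean (F.comp i).var r) := by
        rw [Fintype.sum_sum_type]
        simp only [hc, hq, Sum.elim_inl, Sum.elim_inr, Mixture.moment]
        rw [Finset.sum_congr rfl fun j _ => hsplit j]
        simp only [sub_mul, mul_sub, Finset.sum_sub_distrib, Finset.sum_add_distrib, neg_mul,
          Finset.sum_neg_distrib, Finset.sum_mul]
        have e1 : ∑ j, (if ∀ i, ¬cl i j then
            (G.comp j).weight * gaussMoment (G.comp j).mean (G.comp j).var r else 0) =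
            ∑ j : {j // ∀ i, ¬cl i j},
              (G.comp j.1).weight * gaussMoment (G.comp j.1).mean (G.comp j.1).var r := by
          rw [← Finset.sum_filter]
          exact Finset.sum_subtype _ (fun j => by simp) _
        have e2 : ∑ i, ∑ j with cl i j, (G.comp j).weight * gaussMoment (F.comp i).mean (F.comp i).var r =
            ∑ j, ∑ i with cl i j, (G.comp j).weight * gaussMoment (F.comp i).mean (F.comp i).var r := by
          simp only [Finset.sum_filter]
          exact Finset.sum_comm
        rw [e1, e2]
        ring
      have hdiff : |∑ j, ∑ i with cl i j, (G.comp j).weight *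
          (gaussMoment (G.comp j).mean (G.comp j).var r -
            gaussMoment (F.comp i).mean (F.comp i).var r)| ≤ D * (1 / T) ^ m * ρ := by
        refine (Finset.abs_sum_le_sum_abs _ _).trans ?_
        have hB0 : 0 ≤ D * (1 / T) ^ m * ρ := by positivity
        have : ∀ j ∈ Finset.univ, |∑ i with cl i j, (G.comp j).weight *
            (gaussMoment (G.comp j).mean (G.comp j).var r -
            gaussMoment (F.comp i).mean (F.comp i).var r)| ≤
            (G.comp j).weight * (D * (1 / T) ^ m * ρ) := by
          intro j _
          refine (Finset.abs_sum_le_sum_abs _ _).trans ?_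
          have h1 : ∀ i ∈ Finset.univ.filter (fun i => cl i j), |(G.comp j).weight *
            (gaussMoment (G.comp j).mean (G.comp j).var r -
            gaussMoment (F.comp i).mean (F.comp i).var r)| ≤
            (G.comp j).weight * (D * (1 / T) ^ m * ρ) := by
            intro i hi
            have hi' : paramDist (F.comp i) (G.comp j) < ρ := (Finset.mem_filter.1 hi).2
            rw [abs_mul, abs_of_nonneg (hGw0 j)]
            have h2 := (hD r hr (1 / T) (by rw [le_div_iff₀ hT0]; linarith)).2 _ _ _ _
              ((hGs.mean j).trans hTinv) ((hGs.var j).trans hTinv)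
              ((hFs.mean i).trans hTinv) ((hFs.var i).trans hTinv)
            rw [paramDist_comm, paramDist] at hi'
            have := hGw0 j
            refine mul_le_mul_of_nonneg_left (h2.trans ?_) this
            gcongr
          refine (Finset.sum_le_card_nsmul _ _ _ h1).trans ?_
          have h3 : (Finset.univ.filter (fun i => cl i j)).card ≤ 1 :=
            Finset.card_le_one.2 fun i hi i' hi' =>
              huniqF i i' j (Finset.mem_filter.1 hi).2 (Finset.mem_filter.1 hi').2
          rw [nsmul_eq_mul]
          have h4 : ((Finset.univ.filter (fun i => cl i j)).card : ℝ) ≤ 1 := by exact_mod_cast h3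
          exact mul_le_of_le_one_left (mul_nonneg (hGw0 j) hB0) h4
        refine (Finset.sum_le_sum this).trans ?_
        rw [← Finset.sum_mul, hGs.sum, one_mul]
      have hfin : D * (1 / T) ^ m * ρ ≤ T ^ (E + 2) := by
        rw [hρT, hp, show b' + E + m + 2 = b' + (E + 2) + m by ring, pow_add, pow_add, one_div, inv_pow]
        have e3 : D * (T ^ m)⁻¹ * (T ^ b' * T ^ (E + 2) * T ^ m) = D * T ^ b' * T ^ (E + 2) := by
          field_simp
        rw [e3]
        exact mul_le_of_le_one_left (by positivity) (hb' T hT0 hT1)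
      have h5 : T ^ (E + 2) + T ^ (E + 1) ≤ T ^ E := by
        have : T ^ (E + 2) + T ^ (E + 1) = T ^ E * (T ^ 2 + T) := by ring
        rw [this]
        exact mul_le_of_le_one_right (by positivity) (by nlinarith)
      rw [hsum]
      calc _ ≤ |F.moment r - G.moment r| + _ := abs_add_le _ _
        _ ≤ T ^ (E + 1) + T ^ (E + 2) := add_le_add ((hη r hr).trans hηT) (hdiff.trans hfin)
        _ ≤ T ^ E := by linarith
        _ ≤ _ := pow_le_pow_of_le_one hT0.le (by linarith) (hEN _)
  have hTltθ : T < θ := by linarith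
  have hGm : ∀ j, ∃ i, cl i j := by
    intro j
    by_contra! h
    have h1 := hsmall (Sum.inr ⟨j, h⟩)
    simp only [hc, Sum.elim_inr, abs_neg, abs_of_nonneg (hGw0 _)] at h1
    linarith [hGs.weight j]
  have hFm : ∀ i, ∃ j, cl i j := by
    intro i
    by_contra! h
    have h1 := hsmall (Sum.inl i)
    simp only [hc, Sum.elim_inl] at h1
    rw [Finset.filter_false_of_mem fun j _ => h j, Finset.sum_empty, sub_zero,
      abs_of_nonneg (hFw0 i)] at h1
    linarith [hFs.weight i]
  choose π hπ using hFm
  refine ⟨π, ⟨fun i i' h => huniqF i i' (π i) (hπ i) (h ▸ hπ i'), fun j => ?_⟩, fun i => ⟨?_, ?_⟩⟩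
  · obtain ⟨i, hi⟩ := hGm j
    exact ⟨i, huniqG i _ _ (hπ i) hi⟩
  · have h1 := hsmall (Sum.inl i)
    simp only [hc, Sum.elim_inl] at h1
    have : Finset.univ.filter (fun j => cl i j) = {π i} := by
      ext j; simp only [Finset.mem_filter, Finset.mem_univ, true_and, Finset.mem_singleton]
      exact ⟨fun h => huniqG _ _ _ h (hπ i), fun h => h ▸ hπ i⟩
    rw [this, Finset.sum_singleton] at h1
    linarith
  · have h1 : paramDist (F.comp i) (G.comp (π i)) < ρ := hπ i
    linarith

/-! ### What the subroutines compute. -/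

namespace Prog

theorem bind_eq_bind {α β : Type} (p : Prog α) (f : α → Prog β) : (p >>= f) = p.bind f := rfl

theorem bind_assoc {α β γ : Type} (p : Prog α) (f : α → Prog β) (g : β → Prog γ) :
    (p.bind f).bind g = p.bind fun a => (f a).bind g := by
  induction p with
  | ret a => rfl
  | sample c ih => simp only [bind, ih]
  | noise c ih => simp only [bind, ih]
  | arith op x y c ih => simp only [bind, ih]
  | le x y c ih => simp only [bind, ih]
  | ceil x c ih => simp only [bind, ih]
  | tick c ih => simp only [bind, ih]

theorem bind_ret {α : Type} (p : Prog α) : p.bind ret = p := by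
  induction p with
  | ret a => rfl
  | sample c ih => simp only [bind, ih]
  | noise c ih => simp only [bind, ih]
  | arith op x y c ih => simp only [bind, ih]
  | le x y c ih => simp only [bind, ih]
  | ceil x c ih => simp only [bind, ih]
  | tick c ih => simp only [bind, ih]

/-- The program returns `a`, without drawing samples or noise. -/
def Evals {α : Type} (p : Prog α) (a : α) : Prop :=
  ∀ {β : Type} (f : α → Prog β) (x z : ℕ → ℝ), (p.bind f).run x z = (f a).run x z

/-- The program returns a value with the property `Q`, without drawing samples or noise. -/
def Post {α : Type} (p : Prog α) (Q : α → Prop) : Prop := ∃ a, Evals p a ∧ Q a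

theorem post_pure {α : Type} {a : α} {Q : α → Prop} (h : Q a) : Post (pure a) Q :=
  ⟨a, fun _ _ _ => rfl, h⟩

theorem post_pure_eq {α : Type} (a : α) : Post (pure a) (· = a) := post_pure rfl

theorem Post.bind {α β : Type} {p : Prog α} {f : α → Prog β} {Q : α → Prop} {Q' : β → Prop}
    (hp : Post p Q) (hf : ∀ a, Q a → Post (f a) Q') : Post (p >>= f) Q' := by
  obtain ⟨a, ha, hQ⟩ := hp
  obtain ⟨b, hb, hQ'⟩ := hf a hQ
  refine ⟨b, fun g x z => ?_, hQ'⟩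
  rw [bind_eq_bind, bind_assoc, ha, hb]

theorem Post.bind_eq {α β : Type} {p : Prog α} {f : α → Prog β} {a : α} {Q' : β → Prop}
    (hp : Post p (· = a)) (hf : Post (f a) Q') : Post (p >>= f) Q' :=
  hp.bind fun _ h => h ▸ hf

theorem Post.mono {α : Type} {p : Prog α} {Q Q' : α → Prop} (hp : Post p Q) (h : ∀ a, Q a → Q' a) :
    Post p Q' := let ⟨a, ha, hQ⟩ := hp; ⟨a, ha, h a hQ⟩

theorem post_addP (x y : ℝ) : Post (addP x y) (· = x + y) := ⟨_, fun _ _ _ => rfl, rfl⟩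
theorem post_subP (x y : ℝ) : Post (subP x y) (· = x - y) := ⟨_, fun _ _ _ => rfl, rfl⟩
theorem post_mulP (x y : ℝ) : Post (mulP x y) (· = x * y) := ⟨_, fun _ _ _ => rfl, rfl⟩
theorem post_divP (x y : ℝ) : Post (divP x y) (· = x / y) := ⟨_, fun _ _ _ => rfl, rfl⟩
theorem post_ceilP (x : ℝ) : Post (ceilP x) (· = ⌈x⌉₊) := ⟨_, fun _ _ _ => rfl, rfl⟩
theorem post_tickP : Post tickP (· = ()) := ⟨_, fun _ _ _ => rfl, rfl⟩
theorem post_leP (x y : ℝ) : Post (leP x y) (fun b => b = true ↔ x ≤ y) :=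
  ⟨_, fun _ _ _ => rfl, by simp⟩

theorem post_absP (x : ℝ) : Post (absP x) (· = |x|) := by
  refine (post_leP 0 x).bind fun b hb => ?_
  by_cases h : 0 ≤ x
  · rw [hb.2 h, if_pos rfl]
    exact post_pure (abs_of_nonneg h).symm
  · rw [if_neg (fun h' => h (hb.1 h'))]
    exact (post_subP 0 x).mono fun a ha => by rw [ha, abs_of_neg (not_le.1 h), zero_sub]

theorem post_powP (x : ℝ) (n : ℕ) : Post (powP x n) (· = x ^ n) := by
  induction n with
  | zero => exact post_pure (pow_zero x).symm
  | succ n ih => exact ih.bind_eq ((post_mulP _ _).mono fun a ha => by rw [ha, pow_succ])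

theorem post_forFin {β : Type} : ∀ {n : ℕ} {f : Fin n → Prog β} {Q : Fin n → β → Prop},
    (∀ i, Post (f i) (Q i)) → Post (forFin n f) fun t => ∀ i, Q i (t i)
  | 0, _, _, _ => post_pure fun i => i.elim0
  | n + 1, f, Q, h => by
    refine post_tickP.bind_eq ((h 0).bind fun b hb => ?_)
    refine (post_forFin fun i => h i.succ).bind fun t ht => post_pure fun i => ?_
    exact Fin.cases hb ht i

theorem post_sumFin : ∀ {n : ℕ} {f : Fin n → Prog ℝ} {g : Fin n → ℝ},
    (∀ i, Post (f i) (· = g i)) → Post (sumFin n f) (· = ∑ i, g i)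
  | 0, _, _, _ => post_pure (by simp)
  | n + 1, f, g, h => by
    refine post_tickP.bind_eq ((h 0).bind_eq ?_)
    refine (post_sumFin fun i => h i.succ).bind_eq ((post_addP _ _).mono fun a ha => ?_)
    rw [ha, Fin.sum_univ_succ]

theorem post_allFin : ∀ {n : ℕ} {f : Fin n → Prog Bool} {P : Fin n → Prop},
    (∀ i, Post (f i) fun b => b = true ↔ P i) → Post (allFin n f) fun b => b = true ↔ ∀ i, P i
  | 0, _, _, _ => post_pure (by simp)
  | n + 1, f, P, h => by
    refine post_tickP.bind_eq ((h 0).bind fun b hb => ?_)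
    by_cases h0 : P 0
    · rw [hb.2 h0, if_pos rfl]
      exact (post_allFin fun i => h i.succ).mono fun a ha => by
        rw [ha, Fin.forall_fin_succ, and_iff_right h0]
    · rw [if_neg (fun h' => h0 (hb.1 h'))]
      exact post_pure (by simp only [Bool.false_eq_true, false_iff]; exact fun h' => h0 (h' 0))

theorem post_anyFin : ∀ {n : ℕ} {f : Fin n → Prog Bool} {P : Fin n → Prop},
    (∀ i, Post (f i) fun b => b = true ↔ P i) → Post (anyFin n f) fun b => b = true ↔ ∃ i, P i
  | 0, _, _, _ => post_pure (by simp)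
  | n + 1, f, P, h => by
    refine post_tickP.bind_eq ((h 0).bind fun b hb => ?_)
    by_cases h0 : P 0
    · rw [hb.2 h0, if_pos rfl]
      exact post_pure (by simp only [true_iff]; exact ⟨0, h0⟩)
    · rw [if_neg (fun h' => h0 (hb.1 h'))]
      exact (post_anyFin fun i => h i.succ).mono fun a ha => by
        rw [ha, Fin.exists_fin_succ, or_iff_right h0]

/-- It is not recorded which entry succeeds first. Correctness only needs that a result has passed
its test and that a failure rules out every entry. -/
theorem post_firstSome {β γ : Type} {f : β → Prog (Option γ)} {Q : β → Option γ → Prop} :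
    ∀ {l : List β}, (∀ b ∈ l, Post (f b) (Q b)) → Post (firstSome f l) fun r =>
      (∃ c, r = some c ∧ ∃ b ∈ l, Q b (some c)) ∨ (r = none ∧ ∀ b ∈ l, Q b none)
  | [], _ => post_pure (by simp)
  | b :: l, h => by
    refine post_tickP.bind_eq ((h b (by simp)).bind fun r hr => ?_)
    rcases r with _ | c
    · refine (post_firstSome fun b hb => h b (List.mem_cons_of_mem _ hb)).mono fun r hr' => ?_
      rcases hr' with ⟨c, hc, b', hb', hQ⟩ | ⟨hn, hall⟩
      · exact Or.inl ⟨c, hc, b', List.mem_cons_of_mem _ hb', hQ⟩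
      · exact Or.inr ⟨hn, by simpa using ⟨hr, hall⟩⟩
    · exact post_pure (Or.inl ⟨c, rfl, b, by simp, hr⟩)

theorem post_searchTuples {β γ : Type} {l : List β} :
    ∀ {n : ℕ} {f : (Fin n → β) → Prog (Option γ)} {Q : (Fin n → β) → Option γ → Prop},
    (∀ t, (∀ i, t i ∈ l) → Post (f t) (Q t)) → Post (searchTuples l n f) fun r =>
      (∃ c, r = some c ∧ ∃ t, (∀ i, t i ∈ l) ∧ Q t (some c)) ∨
      (r = none ∧ ∀ t, (∀ i, t i ∈ l) → Q t none)
  | 0, f, Q, h => (h Fin.elim0 fun i => i.elim0).mono fun r hr => by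
      have huniq : ∀ t : Fin 0 → β, t = Fin.elim0 := fun t => funext fun i => i.elim0
      rcases r with _ | c
      · exact Or.inr ⟨rfl, fun t _ => by rw [huniq t]; exact hr⟩
      · exact Or.inl ⟨c, rfl, Fin.elim0, fun i => i.elim0, hr⟩
  | n + 1, f, Q, h => by
    refine (post_firstSome fun b hb => post_searchTuples (Q := fun t => Q (Fin.cons b t))
      fun t ht => h (Fin.cons b t) (Fin.cases hb ht)).mono fun r hr => ?_
    rcases hr with ⟨c, hc, b, hb, h'⟩ | ⟨hn, hall⟩
    · rcases h' with ⟨c', hc', t, ht, hQ⟩ | ⟨h', _⟩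
      · exact Or.inl ⟨c, hc, Fin.cons b t, Fin.cases hb ht, by rw [hc']; exact hQ⟩
      · simp at h'
    · refine Or.inr ⟨hn, fun t ht => ?_⟩
      rcases hall (t 0) (ht 0) with ⟨c, hc, _⟩ | ⟨_, h'⟩
      · simp at hc
      · have := h' (fun i => t i.succ) fun i => ht i.succ
        rwa [show Fin.cons (t 0) (fun i => t i.succ) = t from Fin.cons_self_tail t] at this

theorem post_powerSum (j : ℕ) : ∀ l : List ℝ, Post (powerSum j l) (· = (l.map (· ^ j)).sum)
  | [] => post_pure (by simp)
  | x :: xs => (post_powP x j).bind_eq ((post_powerSum j xs).bind_eq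
      ((post_addP _ _).mono fun a ha => by rw [ha, List.map_cons, List.sum_cons]))

theorem post_gaussMoments (μ v : ℝ) (n : ℕ) :
    Post (gaussMoments μ v n) (· = (gaussMoment μ v n, gaussMoment μ v (n + 1))) := by
  induction n with
  | zero => exact post_pure (by simp [gaussMoment])
  | succ n ih =>
    refine ih.bind_eq ((post_mulP _ _).bind_eq ((post_mulP _ _).bind_eq ((post_mulP _ _).bind_eq
      ((post_addP _ _).bind_eq (post_pure ?_)))))
    simp only [gaussMoment, Prod.mk.injEq, true_and]
    push_cast; ring

theorem post_mixtureMoment (F : Mixture) (j : ℕ) : Post (mixtureMoment F j) (· = F.moment j) :=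
  post_sumFin fun _ => (post_gaussMoments _ _ _).bind_eq (post_mulP _ _)

theorem post_paramDistP (a b : Component) : Post (paramDistP a b) (· = paramDist a b) :=
  (post_subP _ _).bind_eq ((post_absP _).bind_eq ((post_subP _ _).bind_eq
    ((post_absP _).bind_eq (post_addP _ _))))

theorem post_isSubdivision (η : ℝ) (F G : Mixture) :
    Post (isSubdivision η F G) fun b => b = true ↔ IsCorrectSubdivision η F G := by
  have h1 : ∀ π : Fin F.size → Fin G.size, Post (allFin G.size fun j => anyFin F.size fun i => do
      tickP
      pure (decide (π i = j))) fun b => b = true ↔ Function.Surjective π := fun π =>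
    post_allFin fun j => post_anyFin fun i => post_tickP.bind_eq (post_pure (by simp))
  have h2 : ∀ π : Fin F.size → Fin G.size, Post (allFin G.size fun j => do
      let s ← sumFin F.size fun i => do
        tickP
        pure (if π i = j then (F.comp i).weight else 0)
      let d ← absP (← subP s (G.comp j).weight)
      leP d η) fun b => b = true ↔
        ∀ j, |∑ i with π i = j, (F.comp i).weight - (G.comp j).weight| ≤ η := fun π =>
    post_allFin fun j => (post_sumFin fun i => post_tickP.bind_eq (post_pure_eq _)).bind_eq
      ((post_subP _ _).bind_eq ((post_absP _).bind_eq ((post_leP _ _).mono fun b hb => by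
        rw [hb, Finset.sum_filter])))
  have h3 : ∀ π : Fin F.size → Fin G.size, Post (allFin F.size fun i => do
      let d ← paramDistP (F.comp i) (G.comp (π i))
      leP d η) fun b => b = true ↔ ∀ i, paramDist (F.comp i) (G.comp (π i)) ≤ η := fun π =>
    post_allFin fun i => (post_paramDistP _ _).bind_eq (post_leP _ _)
  have h4 : Post (isSubdivision η F G) fun b => b = true ↔ ∃ π : Fin F.size → Fin G.size,
      Function.Surjective π ∧
      (∀ j, |∑ i with π i = j, (F.comp i).weight - (G.comp j).weight| ≤ η) ∧
      ∀ i, paramDist (F.comp i) (G.comp (π i)) ≤ η := by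
    refine (post_searchTuples (Q := fun π r => r = some () ↔ Function.Surjective π ∧
      (∀ j, |∑ i with π i = j, (F.comp i).weight - (G.comp j).weight| ≤ η) ∧
      ∀ i, paramDist (F.comp i) (G.comp (π i)) ≤ η) fun π _ => (h1 π).bind fun b₁ hb₁ =>
        (h2 π).bind fun b₂ hb₂ => (h3 π).bind fun b₃ hb₃ => post_pure ?_).bind
          fun r hr => post_pure ?_
    · rw [← hb₁, ← hb₂, ← hb₃]
      rcases b₁ <;> rcases b₂ <;> rcases b₃ <;> simp
    · rcases hr with ⟨c, rfl, t, _, h⟩ | ⟨rfl, h⟩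
      · simp only [Option.isSome_some, true_iff]
        exact ⟨t, h.1 rfl⟩
      · simp only [Option.isSome_none, Bool.false_eq_true, false_iff]
        rintro ⟨π, hπ⟩
        have := (h π fun i => List.mem_finRange _).2 hπ
        simp at this
  refine h4.mono fun b hb => ?_
  rw [hb, IsCorrectSubdivision]
  refine ⟨fun h => ⟨?_, h⟩, fun h => h.2⟩
  obtain ⟨π, hπ, _⟩ := h
  simpa using Fintype.card_le_of_surjective π hπ

/-- Drawing is what moves the two streams. Afterwards both are shifted by m, so the runs see
disjoint blocks of samples and noise. -/
theorem run_draw_bind {β : Type} : ∀ (m : ℕ) (f : List ℝ → Prog β) (x z : ℕ → ℝ),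
    ((draw m).bind f).run x z = (f ((List.range m).map fun i => x i + z i)).run
      (fun n => x (n + m)) fun n => z (n + m)
  | 0, f, x, z => rfl
  | m + 1, f, x, z => by
    have : ((draw (m + 1)).bind f).run x z = ((draw m).bind fun xs => f ((x 0 + z 0) :: xs)).run
        (fun n => x (n + 1)) fun n => z (n + 1) := by
      simp only [draw, bind_eq_bind, noisySample, Prog.bind, run, bind_assoc, ArithOp.eval]
      rfl
    rw [this, run_draw_bind m]
    rw [List.range_succ_eq_map]
    simp only [List.map_cons, List.map_map]
    have e1 : (fun n => x (n + m + 1)) = fun n => x (n + (m + 1)) := rfl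
    rfl

end Prog

/-! ### The output of the Basic Univariate Algorithm. -/

/-- The conditions on the candidates of the Basic Univariate Algorithm. -/
structure Mixture.IsAdmissible (F : Mixture) (ε : ℝ) : Prop where
  each : ∀ i, ε / 2 ≤ (F.comp i).weight ∧ |(F.comp i).mean| ≤ 2 / ε ∧ (F.comp i).var ≤ 2 / ε ∧
    1 / 2 < (F.comp i).var
  sum : ∑ i, (F.comp i).weight = 1
  sep : ∀ i j, i ≠ j → ε / 2 ≤ paramDist (F.comp i) (F.comp j)

/-- The `j`-th moment of the first `m` samples. -/
noncomputable def sampleMoment (y : ℕ → ℝ) (m j : ℕ) : ℝ := (∑ i ∈ Finset.range m, y i ^ j) / m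

/-- The candidate with given mesh indices, as a mixture. -/
def meshMixture (γ : ℝ) (M n : ℕ) (t : Fin n → ℕ × ℕ × ℕ) : Mixture :=
  ⟨n, fun i => ⟨(t i).1 * γ, ((t i).2.1 - M) * γ, (t i).2.2 * γ⟩⟩

namespace Constants

noncomputable def numSamples (K : Constants) (ε δ : ℝ) : ℕ := ⌈K.CB / (ε * δ) ^ K.cB⌉₊

noncomputable def accuracy (K : Constants) (ε : ℝ) : ℝ := K.cα * ε ^ K.eα

noncomputable def meshInv (K : Constants) (k : ℕ) (ε : ℝ) : ℕ :=
  ⌈K.cγ / K.accuracy ε ^ (4 * k - 1)⌉₊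

noncomputable def meshBound (K : Constants) (k : ℕ) (ε : ℝ) : ℕ := ⌈2 / ε * K.meshInv k ε⌉₊

/-- The candidate is admissible and its moments are close to the sample moments. -/
def Accepts (K : Constants) (k : ℕ) (ε : ℝ) (s : ℕ → ℝ) (G : Mixture) : Prop :=
  G.IsAdmissible ε ∧ ∀ j < 4 * k - 2, |G.moment (j + 1) - s (j + 1)| ≤ K.accuracy ε

/-- The result of the Basic Univariate Algorithm with given sample moments: a mixture that is
accepted, or nothing if no candidate in the mesh is accepted. -/
def IsBasicResult (K : Constants) (k : ℕ) (ε : ℝ) (s : ℕ → ℝ) (r : Option Mixture) : Prop :=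
  (∀ G, r = some G → G.size ≤ k ∧ K.Accepts k ε s G) ∧
  (r = none → ∀ n < k, ∀ t : Fin (n + 1) → ℕ × ℕ × ℕ,
    (∀ i, t i ∈ Prog.mesh (K.meshInv k ε) (K.meshBound k ε)) →
    ¬K.Accepts k ε s (meshMixture (1 / K.meshInv k ε) (K.meshBound k ε) (n + 1) t))

end Constants

namespace Prog

theorem post_candidate (γ : ℝ) (M n : ℕ) (t : Fin n → ℕ × ℕ × ℕ) :
    Post (candidate γ M n t) (· = meshMixture γ M n t) := by
  refine (post_forFin (Q := fun i c => c =
    ⟨(t i).1 * γ, ((t i).2.1 - M) * γ, (t i).2.2 * γ⟩) fun i => ?_).bind fun c hc => post_pure ?_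
  · exact (post_mulP _ _).bind_eq ((post_subP _ _).bind_eq ((post_mulP _ _).bind_eq
      ((post_mulP _ _).bind_eq (post_pure_eq _))))
  · rw [meshMixture, funext hc]

theorem post_admissible (ε : ℝ) (F : Mixture) :
    Post (admissible ε F) fun b => b = true ↔ F.IsAdmissible ε := by
  have h : Post (admissible ε F) fun b => b = true ↔ (∀ i, ε / 2 ≤ (F.comp i).weight ∧
      |(F.comp i).mean| ≤ 2 / ε ∧ (F.comp i).var ≤ 2 / ε ∧ 1 / 2 < (F.comp i).var) ∧
      (∑ i, (F.comp i).weight ≤ 1 ∧ 1 ≤ ∑ i, (F.comp i).weight) ∧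
      ∀ i j, i ≠ j → ε / 2 ≤ paramDist (F.comp i) (F.comp j) := by
    refine (post_divP _ _).bind_eq ((post_divP _ _).bind_eq ((post_allFin (P := fun i =>
        ε / 2 ≤ (F.comp i).weight ∧ |(F.comp i).mean| ≤ 2 / ε ∧ (F.comp i).var ≤ 2 / ε ∧
        1 / 2 < (F.comp i).var) fun i => ?_).bind fun b hb =>
      (post_sumFin fun i => post_pure_eq _).bind_eq ((post_leP _ _).bind fun b₁ hb₁ =>
      (post_leP _ _).bind fun b₂ hb₂ => (post_allFin (P := fun i =>
        ∀ j, i ≠ j → ε / 2 ≤ paramDist (F.comp i) (F.comp j))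
        fun i => post_allFin fun j => ?_).bind fun b₃ hb₃ => post_pure ?_)))
    · refine (post_leP _ _).bind fun c₁ hc₁ => (post_absP _).bind_eq ((post_leP _ _).bind
        fun c₂ hc₂ => (post_leP _ _).bind fun c₃ hc₃ => (post_leP _ _).bind fun c₄ hc₄ =>
        post_pure ?_)
      rw [← hc₁, ← hc₂, ← hc₃, ← not_le, ← hc₄]
      rcases c₁ <;> rcases c₂ <;> rcases c₃ <;> rcases c₄ <;> simp
    · by_cases hij : i = j
      · rw [if_pos hij]; exact post_pure (by simp [hij])
      · rw [if_neg hij]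
        exact (post_paramDistP _ _).bind_eq ((post_leP _ _).mono fun b hb => by
          rw [hb]; exact ⟨fun h _ => h, fun h => h hij⟩)
    · rw [← hb, ← hb₁, ← hb₂, ← hb₃]
      rcases b <;> rcases b₁ <;> rcases b₂ <;> rcases b₃ <;> simp
  refine h.mono fun b hb => ?_
  rw [hb]
  exact ⟨fun ⟨h1, h2, h3⟩ => ⟨h1, le_antisymm h2.1 h2.2, h3⟩,
    fun h => ⟨h.each, ⟨h.sum.le, h.sum.ge⟩, h.sep⟩⟩

theorem Post.run_bind_eq {α β γ : Type} {p : Prog α} {g : α → Prog β} {a : α}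
    (h : Post p (· = a)) (f : β → Prog γ) (x z : ℕ → ℝ) :
    ((p >>= g).bind f).run x z = ((g a).bind f).run x z := by
  obtain ⟨b, hb, rfl⟩ := h
  rw [bind_eq_bind, bind_assoc, hb]

/-- Once the samples are fixed, the rest of the program is deterministic and is handled by `Post`.
The continuation f is arbitrary because further runs follow. -/
theorem exists_run_basicUnivariate_bind (K : Constants) (k : ℕ) (ε δ : ℝ) (x z : ℕ → ℝ) :
    ∃ r, K.IsBasicResult k ε (sampleMoment (fun n => x n + z n) (K.numSamples ε δ)) r ∧
      ∀ {β : Type} (f : Option Mixture → Prog β), ((basicUnivariate K k ε δ).bind f).run x z =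
        (f r).run (fun n => x (n + K.numSamples ε δ)) fun n => z (n + K.numSamples ε δ) := by
  set m := K.numSamples ε δ with hm
  set s := sampleMoment (fun n => x n + z n) m with hs
  set xs := (List.range m).map fun i => x i + z i with hxs
  set tail : Prog (Option Mixture) := (do
    let sampleMoments ← forFin (4 * k - 2) fun j => do
      let s ← powerSum (j + 1) xs
      divP s (m : ℝ)
    let α ← mulP K.cα (← powP ε K.eα)
    let N ← ceilP (← divP K.cγ (← powP α (4 * k - 1)))
    let γ ← divP 1 (N : ℝ)
    let bound ← divP 2 ε
    let M ← ceilP (← mulP bound (N : ℝ))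
    firstSome (fun n => searchTuples (mesh N M) (n + 1) fun t => do
        let F ← candidate γ M (n + 1) t
        if ← admissible ε F then
          let ok ← allFin (4 * k - 2) fun j => do
            let q ← mixtureMoment F (j + 1)
            let d ← absP (← subP q (sampleMoments j))
            leP d α
          pure (if ok then some F else none)
        else pure none)
      (List.range k)) with htail
  have hpost : Post tail (K.IsBasicResult k ε s) := by
    refine (post_forFin (Q := fun j a => a = s (j + 1)) fun j => ?_).bind fun sm hsm => ?_
    · refine (post_powerSum _ _).bind_eq ((post_divP _ _).mono fun a ha => ?_)
      rw [ha, hs, sampleMoment, hxs, List.map_map]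
      rfl
    refine (post_powP _ _).bind_eq ((post_mulP _ _).bind_eq ((post_powP _ _).bind_eq
      ((post_divP _ _).bind_eq ((post_ceilP _).bind_eq ((post_divP _ _).bind_eq
      ((post_divP _ _).bind_eq ((post_mulP _ _).bind_eq ((post_ceilP _).bind_eq ?_))))))))
    -- The mesh parameters computed by the program are definitionally the named ones.
    change Post (firstSome (fun n => searchTuples (mesh (K.meshInv k ε) (K.meshBound k ε)) (n + 1) _) _) _
    refine (post_firstSome fun n hn => post_searchTuples (Q := fun t r =>
      (∀ G, r = some G → G.size = n + 1 ∧ K.Accepts k ε s G) ∧ (r = none →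
        ¬K.Accepts k ε s (meshMixture (1 / K.meshInv k ε) (K.meshBound k ε) (n + 1) t)))
      fun t ht => (post_candidate _ _ _ _).bind_eq ?_).mono fun r hr => ?_
    · set F := meshMixture (1 / K.meshInv k ε) (K.meshBound k ε) (n + 1) t with hF
      refine (post_admissible _ _).bind fun b hb => ?_
      by_cases hadm : F.IsAdmissible ε
      · rw [hb.2 hadm, if_pos rfl]
        refine (post_allFin (P := fun j : Fin (4 * k - 2) =>
          |F.moment (j + 1) - s (j + 1)| ≤ K.accuracy ε) fun j => (post_mixtureMoment _ _).bind_eq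
            ((post_subP _ _).bind_eq ((post_absP _).bind_eq ?_))).bind
            fun ok hok => post_pure ?_
        · exact (post_leP _ _).mono fun b hb => by rw [hb, hsm j]; rfl
        · rcases ok with _ | _
          · refine ⟨fun G hG => by simp at hG, fun _ hacc => ?_⟩
            exact absurd (hok.2 fun j => hacc.2 j j.2) (by simp)
          · refine ⟨fun G hG => ?_, fun h => by simp at h⟩
            simp only [if_true, Option.some.injEq] at hG
            subst hG
            exact ⟨rfl, hadm, fun j hj => hok.1 rfl ⟨j, hj⟩⟩
      · rw [if_neg (fun h' => hadm (hb.1 h'))]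
        exact post_pure ⟨fun G hG => by simp at hG, fun _ hacc => hadm hacc.1⟩
    · rcases hr with ⟨c, rfl, n, hn, h⟩ | ⟨rfl, h⟩
      · rcases h with ⟨c', hc', t, _, hQ⟩ | ⟨h, _⟩
        · refine ⟨fun G hG => ?_, fun h => by simp at h⟩
          have := hQ.1 G (hc' ▸ hG)
          exact ⟨this.1 ▸ List.mem_range.1 hn, this.2⟩
        · simp at h
      · refine ⟨fun G hG => by simp at hG, fun _ n hn t ht => ?_⟩
        rcases h n (List.mem_range.2 hn) with ⟨c, hc, _⟩ | ⟨_, h'⟩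
        · simp at hc
        · exact (h' t ht).2 rfl
  obtain ⟨r, hr, hQ⟩ := hpost
  refine ⟨r, hQ, fun f => ?_⟩
  unfold basicUnivariate
  rw [(post_mulP _ _).run_bind_eq, (post_powP _ _).run_bind_eq, (post_divP _ _).run_bind_eq,
    (post_ceilP _).run_bind_eq, bind_eq_bind, bind_assoc]
  change ((draw m).bind _).run x z = _
  rw [run_draw_bind]
  exact hr f _ _

end Prog

/-! ### The output of the General Univariate Algorithm. -/

/-- The variances of the mixture, diminished by `1 / 2`. -/
noncomputable def Mixture.deconvolved (F : Mixture) : Mixture :=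
  ⟨F.size, fun i => ⟨(F.comp i).weight, (F.comp i).mean, (F.comp i).var - 1 / 2⟩⟩

open Classical in
/-- The last estimate of a correct chain, as computed by `Prog.chainLast`. -/
noncomputable def chainValue {n : ℕ} (η : ℝ) (est : Fin n → Option Mixture) (T : Fin n → Bool) :
    List (Fin n) → Option Mixture → Option Mixture
  | [], prev => prev
  | i :: l, prev =>
    if T i then
      match est i, prev with
      | none, _ => none
      | some G, none => chainValue η est T l (some G)
      | some G, some F =>
        if IsCorrectSubdivision η F G then chainValue η est T l (some G) else none
    else chainValue η est T l prev

open Classical in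
theorem chainValue_cons {n : ℕ} (η : ℝ) (est : Fin n → Option Mixture) (T : Fin n → Bool)
    (i : Fin n) (l : List (Fin n)) (prev : Option Mixture) :
    chainValue η est T (i :: l) prev = if T i then
      match est i, prev with
      | none, _ => none
      | some G, none => chainValue η est T l (some G)
      | some G, some F =>
        if IsCorrectSubdivision η F G then chainValue η est T l (some G) else none
    else chainValue η est T l prev := rfl

namespace Prog

theorem post_chainLast {n : ℕ} (η : ℝ) (est : Fin n → Option Mixture) (T : Fin n → Bool) :
    ∀ (l : List (Fin n)) (prev : Option Mixture),
    Post (chainLast η est T l prev) (· = chainValue η est T l prev)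
  | [], _ => post_pure rfl
  | i :: l, prev => by
    refine post_tickP.bind_eq ?_
    rw [chainValue_cons]
    by_cases hT : T i = true
    · rw [if_pos hT, if_pos hT]
      generalize est i = e
      rcases e with _ | G <;> rcases prev with _ | F
      · exact post_pure rfl
      · exact post_pure rfl
      · exact post_chainLast η est T l _
      · refine (post_isSubdivision _ _ _).bind fun b hb => ?_
        by_cases h : IsCorrectSubdivision η F G
        · rw [hb.2 h, if_pos rfl]
          simp only [if_pos h]
          exact post_chainLast η est T l _
        · rw [if_neg (fun h' => h (hb.1 h'))]
          simp only [if_neg h]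
          exact post_pure rfl
    · rw [if_neg hT, if_neg hT]
      exact post_chainLast η est T l _

theorem post_deconvolve (F : Mixture) : Post (deconvolve F) (· = F.deconvolved) := by
  refine (post_forFin (Q := fun i c => c =
    ⟨(F.comp i).weight, (F.comp i).mean, (F.comp i).var - 1 / 2⟩) fun i =>
    (post_subP _ _).bind_eq (post_pure_eq _)).bind fun c hc => post_pure ?_
  rw [Mixture.deconvolved, funext hc]

theorem post_nextPrecision (K : Constants) (k : ℕ) (ε δ : ℝ) :
    Post (nextPrecision K k ε δ) (· = K.S k ε δ) :=
  (post_mulP _ _).bind_eq ((post_powP _ _).bind_eq ((post_divP _ _).bind_eq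
    ((post_divP _ _).bind_eq (post_divP _ _))))

/-- The number of samples drawn by the first `i` runs. -/
noncomputable def offset (K : Constants) (k : ℕ) (ε δ : ℝ) (i : ℕ) : ℕ :=
  ∑ l ∈ Finset.range i, K.numSamples ((fun e => K.S k e δ)^[l] ε) δ

/-- The streams left over at the end may stay unspecified, since nothing is drawn after the last
run. -/
theorem exists_run_runBasic_bind (K : Constants) (k : ℕ) (δ : ℝ) : ∀ (n : ℕ) (ε : ℝ) (x z : ℕ → ℝ),
    ∃ est : Fin n → Option Mixture, (∀ i : Fin n,
      K.IsBasicResult k ((fun e => K.S k e δ)^[i] ε)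
        (sampleMoment (fun t => x (t + offset K k ε δ i) + z (t + offset K k ε δ i))
          (K.numSamples ((fun e => K.S k e δ)^[i] ε) δ)) (est i)) ∧
      ∃ x' z', ∀ {β : Type} (f : (Fin n → Option Mixture) → Prog β),
        ((runBasic K k δ n ε).bind f).run x z = (f est).run x' z'
  | 0, ε, x, z => ⟨Fin.elim0, fun i => i.elim0, x, z, fun f => rfl⟩
  | n + 1, ε, x, z => by
    obtain ⟨r, hr, hrun⟩ := exists_run_basicUnivariate_bind K k ε δ x z
    obtain ⟨est, hest, x', z', hrun'⟩ := exists_run_runBasic_bind K k δ n (K.S k ε δ)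
      (fun t => x (t + K.numSamples ε δ)) fun t => z (t + K.numSamples ε δ)
    refine ⟨Fin.cons r est, fun i => ?_, x', z', fun f => ?_⟩
    · refine Fin.cases ?_ (fun i => ?_) i
      · simpa [offset] using hr
      have h1 : ∀ t, t + offset K k (K.S k ε δ) δ i + K.numSamples ε δ =
          t + offset K k ε δ (i + 1) := fun t => by
        rw [offset, offset, Finset.sum_range_succ']
        simp only [Function.iterate_succ, Function.comp, Function.iterate_zero, id]
        ring
      have := hest i
      simp only [h1] at this
      exact this
    · change (((basicUnivariate K k ε δ).bind _).bind f).run x z = _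
      rw [bind_assoc, hrun, (post_nextPrecision _ _ _ _).run_bind_eq,
        bind_eq_bind, bind_assoc, hrun']
      rfl

theorem precision_eq (K : Constants) (k : ℕ) (ε δ : ℝ) (i : ℕ) : K.precision k ε δ i =
    (fun e => K.S k e (Constants.errorProb k δ))^[i] (ε / (K.C * (k : ℝ) ^ k ^ 2)) := by
  induction i with
  | zero => rfl
  | succ i ih => rw [Function.iterate_succ_apply', ← ih]; rfl

/-- The number of selected indices is more than `k ^ 2 / 2`. -/
def IsMajority (k : ℕ) (T : Fin (k ^ 2) → Bool) : Prop :=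
  (k : ℝ) ^ 2 / 2 < ∑ i, if T i then (1 : ℝ) else 0

/-- From here on no program occurs in the proof of correctness: it remains to study `chainValue` for
estimates that satisfy the specification of the single runs. -/
theorem exists_run_generalUnivariate (K : Constants) (k : ℕ) (ε δ : ℝ) (x z : ℕ → ℝ) :
    ∃ est : Fin (k ^ 2) → Option Mixture,
      (∀ i : Fin (k ^ 2), K.IsBasicResult k (K.precision k ε δ i)
        (sampleMoment (fun t =>
          x (t + offset K k (ε / (K.C * (k : ℝ) ^ k ^ 2)) (Constants.errorProb k δ) i) +
          z (t + offset K k (ε / (K.C * (k : ℝ) ^ k ^ 2)) (Constants.errorProb k δ) i))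
          (K.numSamples (K.precision k ε δ i) (Constants.errorProb k δ))) (est i)) ∧
      ((∃ F T, IsMajority k T ∧ chainValue (K.Cchain * k * (ε / (K.C * (k : ℝ) ^ k ^ 2))) est T
          (List.finRange (k ^ 2)).reverse none = some F ∧
          (generalUnivariate K k ε δ).run x z = some F.deconvolved) ∨
        ∀ T, IsMajority k T → chainValue (K.Cchain * k * (ε / (K.C * (k : ℝ) ^ k ^ 2))) est T
          (List.finRange (k ^ 2)).reverse none = none) := by
  obtain ⟨est, hest, x', z', hrun⟩ := exists_run_runBasic_bind K k (Constants.errorProb k δ) (k ^ 2)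
    (ε / (K.C * (k : ℝ) ^ k ^ 2)) x z
  refine ⟨est, fun i => by rw [precision_eq]; exact hest i, ?_⟩
  set η := K.Cchain * k * (ε / (K.C * (k : ℝ) ^ k ^ 2)) with hη
  set v : (Fin (k ^ 2) → Bool) → Option Mixture := fun T =>
    chainValue η est T (List.finRange (k ^ 2)).reverse none with hv
  have hpost : Post (do
      let result ← searchTuples [true, false] (k ^ 2) fun T => do
        let card ← sumFin (k ^ 2) fun i => pure (if T i then 1 else 0)
        if ← leP card ((k : ℝ) ^ 2 / 2) then pure none
        else chainLast η est T (List.finRange (k ^ 2)).reverse none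
      match result with
      | none => pure none
      | some F => do
        let G ← deconvolve F
        pure (some G)) fun r => (∃ F T, IsMajority k T ∧ v T = some F ∧ r = some F.deconvolved) ∨
          ∀ T, IsMajority k T → v T = none := by
    refine (post_searchTuples (Q := fun T r => (∀ F, r = some F → IsMajority k T ∧ v T = some F) ∧
      (r = none → IsMajority k T → v T = none)) fun T _ =>
      (post_sumFin fun i => post_pure_eq _).bind_eq ((post_leP _ _).bind fun b hb => ?_)).bind
      fun r hr => ?_
    · by_cases h : ∑ i, (if T i then (1 : ℝ) else 0) ≤ (k : ℝ) ^ 2 / 2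
      · rw [hb.2 h, if_pos rfl]
        exact post_pure ⟨fun F hF => by simp at hF, fun _ h' => absurd h (not_le.2 h')⟩
      · rw [if_neg (fun h' => h (hb.1 h'))]
        exact (post_chainLast _ _ _ _ _).mono fun r hr =>
          ⟨fun F hF => ⟨not_le.1 h, hr.symm.trans hF⟩, fun hn _ => hr.symm.trans hn⟩
    · rcases hr with ⟨F, rfl, T, _, h⟩ | ⟨rfl, h⟩
      · exact (post_deconvolve F).bind_eq (post_pure (Or.inl ⟨F, T, (h.1 F rfl).1, (h.1 F rfl).2, rfl⟩))
      · exact post_pure (Or.inr fun T hT => (h T fun i => by simp).2 rfl hT)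
  obtain ⟨r, hr, hQ⟩ := hpost
  have hval : (generalUnivariate K k ε δ).run x z = r := by
    rw [← bind_ret (generalUnivariate K k ε δ)]
    unfold generalUnivariate
    rw [(post_divP _ _).run_bind_eq, (post_divP _ _).run_bind_eq, (post_mulP _ _).run_bind_eq,
      bind_eq_bind, bind_assoc]
    change ((runBasic K k (Constants.errorProb k δ) (k ^ 2) (ε / (K.C * (k : ℝ) ^ k ^ 2))).bind _).run x z = _
    rw [hrun]
    exact hr ret x' z'
  rw [hval]
  rcases hQ with ⟨F, T, hT, hF, rfl⟩ | h
  · exact Or.inl ⟨F, T, hT, hF, rfl⟩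
  · exact Or.inr h

end Prog

theorem chainValue_mem {n : ℕ} (η : ℝ) (est : Fin n → Option Mixture) (T : Fin n → Bool) (H : Mixture) :
    ∀ (l : List (Fin n)) (prev : Option Mixture), chainValue η est T l prev = some H →
      prev = some H ∨ ∃ i, est i = some H
  | [], prev, h => Or.inl h
  | i :: l, prev, h => by
    rw [chainValue_cons] at h
    by_cases hT : T i = true
    · rw [if_pos hT] at h
      generalize he : est i = e at h
      have key : ∀ G, e = some G → chainValue η est T l (some G) = some H → ∃ i, est i = some H := by
        intro G hG h
        rcases chainValue_mem η est T H l _ h with h' | h'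
        · exact ⟨i, by rw [he, hG, h']⟩
        · exact h'
      rcases e with _ | G <;> rcases prev with _ | F
      · simp at h
      · simp at h
      · exact Or.inr (key G rfl h)
      · simp only at h
        split_ifs at h
        exact Or.inr (key G rfl h)
    · rw [if_neg hT] at h
      exact chainValue_mem η est T H l prev h

/-! ### Counting steps. -/

namespace Prog

/-- The leftover streams depend on the first program only and serve the step count and the output at
the same time; this is what lets costs with postconditions be composed. -/
theorem exists_steps_bind {α : Type} (p : Prog α) : ∀ x z : ℕ → ℝ, ∃ x' z' : ℕ → ℝ,
    ∀ {β : Type} (f : α → Prog β),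
      (p.bind f).steps x z = p.steps x z + (f (p.run x z)).steps x' z' ∧
      (p.bind f).run x z = (f (p.run x z)).run x' z' := by
  induction p with
  | ret a => exact fun x z => ⟨x, z, fun f => by simp [Prog.bind, steps, run]⟩
  | sample c ih =>
    intro x z
    obtain ⟨x', z', h⟩ := ih (x 0) (fun n => x (n + 1)) z
    exact ⟨x', z', fun f => ⟨by simp only [Prog.bind, steps, run, h]; omega, (h f).2⟩⟩
  | noise c ih =>
    intro x z
    obtain ⟨x', z', h⟩ := ih (z 0) x (fun n => z (n + 1))
    exact ⟨x', z', fun f => ⟨by simp only [Prog.bind, steps, run, h]; omega, (h f).2⟩⟩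
  | arith op a b c ih =>
    intro x z
    obtain ⟨x', z', h⟩ := ih (op.eval a b) x z
    exact ⟨x', z', fun f => ⟨by simp only [Prog.bind, steps, run, h]; omega, (h f).2⟩⟩
  | le a b c ih =>
    intro x z
    obtain ⟨x', z', h⟩ := ih (decide (a ≤ b)) x z
    exact ⟨x', z', fun f => ⟨by simp only [Prog.bind, steps, run, h]; omega, (h f).2⟩⟩
  | ceil a c ih =>
    intro x z
    obtain ⟨x', z', h⟩ := ih ⌈a⌉₊ x z
    exact ⟨x', z', fun f => ⟨by simp only [Prog.bind, steps, run, h]; omega, (h f).2⟩⟩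
  | tick c ih =>
    intro x z
    obtain ⟨x', z', h⟩ := ih x z
    exact ⟨x', z', fun f => ⟨by simp only [Prog.bind, steps, run, h]; omega, (h f).2⟩⟩

/-- The program makes at most `c` steps and returns a value with the property `Q`, whatever the
samples and the noise are. -/
def Cost {α : Type} (p : Prog α) (c : ℝ) (Q : α → Prop) : Prop :=
  ∀ x z, (p.steps x z : ℝ) ≤ c ∧ Q (p.run x z)

/-- The program makes at most `c` steps. -/
abbrev CostLE {α : Type} (p : Prog α) (c : ℝ) : Prop := Cost p c fun _ => True

theorem costLE_pure {α : Type} (a : α) : CostLE (pure a) 0 :=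
  fun _ _ => ⟨(Nat.cast_zero (R := ℝ)).le, trivial⟩

theorem Cost.bind {α β : Type} {p : Prog α} {f : α → Prog β} {c d : ℝ} {Q : α → Prop}
    {Q' : β → Prop} (hp : Cost p c Q) (hf : ∀ a, Q a → Cost (f a) d Q') :
    Cost (p >>= f) (c + d) Q' := by
  intro x z
  obtain ⟨x', z', h⟩ := exists_steps_bind p x z
  have h1 := hf _ (hp x z).2 x' z'
  rw [bind_eq_bind, (h f).1, (h f).2]
  push_cast
  exact ⟨add_le_add (hp x z).1 h1.1, h1.2⟩

theorem CostLE.seq {α β : Type} {p : Prog α} {f : α → Prog β} {c d : ℝ}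
    (hp : CostLE p c) (hf : ∀ a, CostLE (f a) d) : CostLE (p >>= f) (c + d) :=
  Cost.bind hp fun a _ => hf a

theorem Cost.mono {α : Type} {p : Prog α} {c d : ℝ} {Q : α → Prop} (hp : Cost p c Q) (h : c ≤ d) :
    Cost p d Q := fun x z => ⟨(hp x z).1.trans h, (hp x z).2⟩

/-- Later costs depend on values computed earlier, such as the number of samples or the fineness of
the mesh. Functional correctness is fed into the cost analysis here. -/
theorem CostLE.and_post {α : Type} {p : Prog α} {c : ℝ} {Q : α → Prop} (hp : CostLE p c)
    (h : Post p Q) : Cost p c Q := by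
  obtain ⟨a, ha, hQ⟩ := h
  refine fun x z => ⟨(hp x z).1, ?_⟩
  have := ha ret x z
  rw [bind_ret] at this
  rw [this]; exact hQ

theorem CostLE.and_run {α : Type} {p : Prog α} {c : ℝ} {Q : α → Prop} (hp : CostLE p c)
    (h : ∀ x z, Q (p.run x z)) : Cost p c Q := fun x z => ⟨(hp x z).1, h x z⟩

theorem CostLE.seq_eq {α β : Type} {p : Prog α} {f : α → Prog β} {c d : ℝ} {a : α}
    (hp : CostLE p c) (h : Post p (· = a)) (hf : CostLE (f a) d) : CostLE (p >>= f) (c + d) :=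
  Cost.bind (hp.and_post h) fun _ h => h ▸ hf

theorem costLE_ite {α : Type} {P : Prop} [Decidable P] {p q : Prog α} {c : ℝ} (hp : CostLE p c)
    (hq : CostLE q c) : CostLE (if P then p else q) c := by
  split_ifs
  · exact hp
  · exact hq

theorem costLE_addP (x y : ℝ) : CostLE (addP x y) 1 := fun _ _ => ⟨by simp [addP, steps], trivial⟩
theorem costLE_subP (x y : ℝ) : CostLE (subP x y) 1 := fun _ _ => ⟨by simp [subP, steps], trivial⟩
theorem costLE_mulP (x y : ℝ) : CostLE (mulP x y) 1 := fun _ _ => ⟨by simp [mulP, steps], trivial⟩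
theorem costLE_divP (x y : ℝ) : CostLE (divP x y) 1 := fun _ _ => ⟨by simp [divP, steps], trivial⟩
theorem costLE_leP (x y : ℝ) : CostLE (leP x y) 1 := fun _ _ => ⟨by simp [leP, steps], trivial⟩
theorem costLE_ceilP (x : ℝ) : CostLE (ceilP x) (⌈x⌉₊ + 1) :=
  fun _ _ => ⟨by simp [ceilP, steps], trivial⟩
theorem costLE_tickP : CostLE tickP 1 := fun _ _ => ⟨by simp [tickP, steps], trivial⟩
theorem costLE_noisySample : CostLE noisySample 3 :=
  fun _ _ => ⟨by norm_num [noisySample, steps], trivial⟩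

theorem costLE_absP (x : ℝ) : CostLE (absP x) 2 :=
  (CostLE.seq (d := 1) (costLE_leP _ _) fun _ =>
    costLE_ite ((costLE_pure _).mono zero_le_one) (costLE_subP _ _)).mono (by norm_num)

theorem costLE_powP (x : ℝ) (n : ℕ) : CostLE (powP x n) n := by
  induction n with
  | zero => exact (costLE_pure _).mono (by simp)
  | succ n ih => exact (ih.seq fun _ => costLE_mulP _ _).mono (by push_cast; exact le_rfl)

theorem costLE_forFin {β : Type} {c : ℝ} : ∀ {n : ℕ} {f : Fin n → Prog β},
    (∀ i, CostLE (f i) c) → CostLE (forFin n f) (n * (c + 1))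
  | 0, _, _ => (costLE_pure _).mono (by simp)
  | n + 1, f, h => (costLE_tickP.seq fun _ => (h 0).seq fun _ =>
      (costLE_forFin fun i => h i.succ).seq fun _ => costLE_pure _).mono (by push_cast; linarith)

theorem costLE_sumFin {c : ℝ} : ∀ {n : ℕ} {f : Fin n → Prog ℝ},
    (∀ i, CostLE (f i) c) → CostLE (sumFin n f) (n * (c + 2))
  | 0, _, _ => (costLE_pure _).mono (by simp)
  | n + 1, f, h => (costLE_tickP.seq fun _ => (h 0).seq fun _ =>
      (costLE_sumFin fun i => h i.succ).seq fun _ => costLE_addP _ _).mono (by push_cast; linarith)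

theorem costLE_allFin {c : ℝ} (hc : 0 ≤ c) : ∀ {n : ℕ} {f : Fin n → Prog Bool},
    (∀ i, CostLE (f i) c) → CostLE (allFin n f) (n * (c + 1))
  | 0, _, _ => (costLE_pure _).mono (by simp)
  | n + 1, f, h => (costLE_tickP.seq fun _ => (h 0).seq fun _ =>
      costLE_ite (costLE_allFin hc fun i => h i.succ) ((costLE_pure _).mono (by positivity))).mono
        (by push_cast; linarith)

theorem costLE_anyFin {c : ℝ} (hc : 0 ≤ c) : ∀ {n : ℕ} {f : Fin n → Prog Bool},
    (∀ i, CostLE (f i) c) → CostLE (anyFin n f) (n * (c + 1))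
  | 0, _, _ => (costLE_pure _).mono (by simp)
  | n + 1, f, h => (costLE_tickP.seq fun _ => (h 0).seq fun _ =>
      costLE_ite ((costLE_pure _).mono (by positivity)) (costLE_anyFin hc fun i => h i.succ)).mono
        (by push_cast; linarith)

theorem costLE_firstSome {β γ : Type} {f : β → Prog (Option γ)} {c : ℝ} (hc : 0 ≤ c) :
    ∀ {l : List β}, (∀ b ∈ l, CostLE (f b) c) → CostLE (firstSome f l) (l.length * (c + 1))
  | [], _ => (costLE_pure _).mono (by simp)
  | b :: l, h => by
    refine (costLE_tickP.seq fun _ => (h b (by simp)).seq fun r =>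
      (?_ : CostLE _ (l.length * (c + 1)))).mono (by simp only [List.length_cons]; push_cast; linarith)
    rcases r with _ | r
    · exact costLE_firstSome hc fun b hb => h b (List.mem_cons_of_mem _ hb)
    · exact (costLE_pure _).mono (by positivity)

/-- The form of the bound suits nested loops over L entries: an inner cost X - 1 and one step of
bookkeeping, L times, amount to L X, which is at most (L + 1) X - 1 because X ≥ 1. -/
theorem costLE_searchTuples {β γ : Type} {l : List β} {c : ℝ} (hc : 0 ≤ c) :
    ∀ {n : ℕ} {f : (Fin n → β) → Prog (Option γ)}, (∀ t, CostLE (f t) c) →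
      CostLE (searchTuples l n f) ((l.length + 1) ^ n * (c + 1) - 1)
  | 0, f, h => (h _).mono (by simp)
  | n + 1, f, h => by
    have hp : (1 : ℝ) ≤ (l.length + 1 : ℝ) ^ n := one_le_pow₀ (by simp)
    refine (costLE_firstSome (c := (l.length + 1 : ℝ) ^ n * (c + 1) - 1) (by nlinarith)
      fun b _ => costLE_searchTuples hc fun t => h _).mono ?_
    rw [pow_succ]
    nlinarith

theorem cost_draw : ∀ m : ℕ, Cost (draw m) (3 * m) fun xs => xs.length = m
  | 0 => fun x z => ⟨by simp [draw, pure, steps], rfl⟩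
  | m + 1 => by
    have h : Cost (draw (m + 1)) (3 + (3 * m + 0)) fun xs => xs.length = m + 1 :=
      Cost.bind costLE_noisySample fun _ _ => (cost_draw m).bind fun xs hxs =>
        fun x z => ⟨(Nat.cast_zero (R := ℝ)).le, by change (_ :: xs).length = _; simp [hxs]⟩
    exact h.mono (by push_cast; linarith)

theorem costLE_powerSum (j : ℕ) : ∀ xs : List ℝ, CostLE (powerSum j xs) (xs.length * (j + 1))
  | [] => (costLE_pure _).mono (by simp)
  | x :: xs => ((costLE_powP x j).seq fun _ => (costLE_powerSum j xs).seq fun _ =>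
      costLE_addP _ _).mono (by simp only [List.length_cons]; push_cast; linarith)

theorem costLE_gaussMoments (μ v : ℝ) (n : ℕ) : CostLE (gaussMoments μ v n) (4 * n) := by
  induction n with
  | zero => exact (costLE_pure _).mono (by simp)
  | succ n ih =>
    exact (ih.seq fun _ => (costLE_mulP _ _).seq fun _ => (costLE_mulP _ _).seq fun _ =>
      (costLE_mulP _ _).seq fun _ => (costLE_addP _ _).seq fun _ => costLE_pure _).mono
        (by push_cast; linarith)

theorem costLE_mixtureMoment (F : Mixture) (j : ℕ) :
    CostLE (mixtureMoment F j) (F.size * (4 * j + 3)) :=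
  (costLE_sumFin fun i => (costLE_gaussMoments _ _ _).seq fun _ => costLE_mulP _ _).mono
    (by ring_nf; exact le_rfl)

theorem costLE_paramDistP (a b : Component) : CostLE (paramDistP a b) 7 :=
  ((costLE_subP _ _).seq fun _ => (costLE_absP _).seq fun _ => (costLE_subP _ _).seq fun _ =>
    (costLE_absP _).seq fun _ => costLE_addP _ _).mono (by norm_num)

theorem exists_costLE_isSubdivision (k : ℕ) : ∃ c : ℝ, 0 ≤ c ∧ ∀ (η : ℝ) (F G : Mixture),
    F.size ≤ k → G.size ≤ k → CostLE (isSubdivision η F G) c := by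
  refine ⟨(k + 1) ^ k * (k * (k * 2 + 1) + (k * (k * 3 + 5) + k * 9) + 1), by positivity,
    fun η F G hF hG => ?_⟩
  have hF' : (F.size : ℝ) ≤ k := by exact_mod_cast hF
  have hG' : (G.size : ℝ) ≤ k := by exact_mod_cast hG
  have h0 : (0 : ℝ) ≤ F.size := Nat.cast_nonneg _
  have h0' : (0 : ℝ) ≤ G.size := Nat.cast_nonneg _
  have h1 : ∀ π : Fin F.size → Fin G.size, CostLE (allFin G.size fun j => anyFin F.size fun i => do
      tickP
      pure (decide (π i = j))) (k * (k * 2 + 1)) := fun π =>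
    (costLE_allFin (c := F.size * 2) (by positivity) fun j =>
      (costLE_anyFin (c := 1) zero_le_one fun i =>
        (costLE_tickP.seq fun _ => costLE_pure _).mono (by norm_num)).mono
          (by norm_num)).mono (by gcongr)
  have h2 : ∀ π : Fin F.size → Fin G.size, CostLE (allFin G.size fun j => do
      let s ← sumFin F.size fun i => do
        tickP
        pure (if π i = j then (F.comp i).weight else 0)
      let d ← absP (← subP s (G.comp j).weight)
      leP d η) (k * (k * 3 + 5)) := fun π => by
    have h : ∀ j : Fin G.size, CostLE (sumFin F.size fun i => do
        tickP
        pure (if π i = j then (F.comp i).weight else 0)) (F.size * (1 + 2)) := fun j =>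
      costLE_sumFin fun i => (costLE_tickP.seq fun _ => costLE_pure _).mono (by norm_num)
    refine (costLE_allFin (c := F.size * 3 + 4) (by positivity) fun j => ((h j).seq fun _ =>
      (costLE_subP _ _).seq fun _ => (costLE_absP _).seq fun _ => costLE_leP _ _).mono
      (by norm_num)).mono ?_
    calc (G.size : ℝ) * (F.size * 3 + 4 + 1) ≤ k * (k * 3 + 4 + 1) := by gcongr
      _ = _ := by ring
  have h3 : ∀ π : Fin F.size → Fin G.size, CostLE (allFin F.size fun i => do
      let d ← paramDistP (F.comp i) (G.comp (π i))
      leP d η) (k * 9) := fun π => by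
    refine (costLE_allFin (c := 8) (by norm_num) fun i =>
      ((costLE_paramDistP _ _).seq fun _ => costLE_leP _ _).mono (by norm_num)).mono ?_
    calc (F.size : ℝ) * (8 + 1) ≤ k * (8 + 1) := by gcongr
      _ = _ := by norm_num
  refine (CostLE.seq (costLE_searchTuples (c := k * (k * 2 + 1) + (k * (k * 3 + 5) + (k * 9 + 0)))
    (by positivity) fun π => (h1 π).seq fun _ => (h2 π).seq fun _ => (h3 π).seq fun _ =>
    costLE_pure _) fun r => costLE_pure _).mono ?_
  have h4 : ((List.finRange G.size).length + 1 : ℝ) ^ F.size ≤ (k + 1 : ℝ) ^ k := by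
    rw [List.length_finRange]
    calc ((G.size : ℝ) + 1) ^ F.size ≤ (k + 1 : ℝ) ^ F.size := by gcongr
      _ ≤ _ := pow_le_pow_right₀ (by linarith [(Nat.cast_nonneg k : (0 : ℝ) ≤ k)]) hF
  have h5 : (0 : ℝ) ≤ k * (k * 2 + 1) + (k * (k * 3 + 5) + (k * 9 + 0)) + 1 := by positivity
  have := mul_le_mul_of_nonneg_right h4 h5
  simp only [add_zero] at this ⊢
  linarith

theorem costLE_chainLast {n : ℕ} {k : ℕ} {c η : ℝ} (hc : 0 ≤ c)
    (hsub : ∀ F G : Mixture, F.size ≤ k → G.size ≤ k → CostLE (isSubdivision η F G) c)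
    {est : Fin n → Option Mixture} (hest : ∀ i G, est i = some G → G.size ≤ k) (T : Fin n → Bool) :
    ∀ (l : List (Fin n)) (prev : Option Mixture), (∀ F, prev = some F → F.size ≤ k) →
      CostLE (chainLast η est T l prev) (l.length * (c + 1))
  | [], _, _ => (costLE_pure _).mono (by simp)
  | i :: l, prev, hprev => by
    have h0 : (0 : ℝ) ≤ l.length * (c + 1) := by positivity
    refine (costLE_tickP.seq fun _ => (?_ : CostLE _ (c + l.length * (c + 1)))).mono
      (by simp only [List.length_cons]; push_cast; linarith)
    refine costLE_ite ?_ ((costLE_chainLast hc hsub hest T l prev hprev).mono (by linarith))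
    generalize he : est i = e
    have key : ∀ G, e = some G → CostLE (chainLast η est T l (some G)) (l.length * (c + 1)) :=
      fun G hG => costLE_chainLast hc hsub hest T l _ fun F hF => by
        rw [Option.some.injEq] at hF
        exact hF ▸ hest i G (he.trans hG)
    rcases e with _ | G <;> rcases prev with _ | F
    · exact (costLE_pure _).mono (by linarith)
    · exact (costLE_pure _).mono (by linarith)
    · exact (key G rfl).mono (by linarith)
    · exact (hsub F G (hprev F rfl) (hest i G he)).seq fun _ =>
        costLE_ite (key G rfl) ((costLE_pure _).mono h0)

theorem costLE_deconvolve (F : Mixture) : CostLE (deconvolve F) (F.size * 2) :=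
  ((costLE_forFin (c := 1) fun i => ((costLE_subP _ _).seq fun _ => costLE_pure _).mono
    (by norm_num)).seq fun _ => costLE_pure _).mono (by norm_num)

theorem costLE_candidate (γ : ℝ) (M n : ℕ) (t : Fin n → ℕ × ℕ × ℕ) :
    CostLE (candidate γ M n t) (n * 5) :=
  ((costLE_forFin (c := 4) fun i => ((costLE_mulP _ _).seq fun _ => (costLE_subP _ _).seq fun _ =>
    (costLE_mulP _ _).seq fun _ => (costLE_mulP _ _).seq fun _ => costLE_pure _).mono
    (by norm_num)).seq fun _ => costLE_pure _).mono (by norm_num)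

theorem costLE_admissible (ε : ℝ) (F : Mixture) :
    CostLE (admissible ε F) (F.size * 9 + F.size * (F.size * 9 + 1) + 4) := by
  have h0 : (0 : ℝ) ≤ F.size := Nat.cast_nonneg _
  refine ((costLE_divP _ _).seq fun _ => (costLE_divP _ _).seq fun _ =>
    (costLE_allFin (c := 6) (by norm_num) fun i => ((costLE_leP _ _).seq fun _ =>
      (costLE_absP _).seq fun _ => (costLE_leP _ _).seq fun _ => (costLE_leP _ _).seq fun _ =>
      (costLE_leP _ _).seq fun _ => costLE_pure _).mono (by norm_num)).seq fun _ =>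
    (costLE_sumFin fun i => costLE_pure _).seq fun _ => (costLE_leP _ _).seq fun _ =>
    (costLE_leP _ _).seq fun _ => (costLE_allFin (c := F.size * 9) (by positivity) fun i =>
      (costLE_allFin (c := 8) (by norm_num) fun j => costLE_ite ((costLE_pure _).mono (by norm_num))
        (((costLE_paramDistP _ _).seq fun _ => costLE_leP _ _).mono (by norm_num))).mono
        (by norm_num)).seq fun _ => costLE_pure _).mono ?_
  linarith

theorem costLE_nextPrecision (K : Constants) (k : ℕ) (ε δ : ℝ) :
    CostLE (nextPrecision K k ε δ) (K.cB + 4) :=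
  ((costLE_mulP _ _).seq fun _ => (costLE_powP _ _).seq fun _ => (costLE_divP _ _).seq fun _ =>
    (costLE_divP _ _).seq fun _ => costLE_divP _ _).mono (by linarith)

end Prog

/-! ### Polynomial bounds and the running time. -/

/-- The function is bounded by a polynomial in `1 / ε` and `1 / δ`. -/
def PolyBounded (f : ℝ → ℝ → ℝ) : Prop :=
  ∃ (A : ℝ) (d : ℕ), 0 ≤ A ∧ ∀ ε δ : ℝ, 0 < ε → 0 < δ → |f ε δ| ≤ A * (1 + 1 / ε + 1 / δ) ^ d

namespace PolyBounded

theorem mono {f g : ℝ → ℝ → ℝ} (hg : PolyBounded g)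
    (h : ∀ ε δ, 0 < ε → 0 < δ → |f ε δ| ≤ |g ε δ|) : PolyBounded f := by
  obtain ⟨A, d, hA, hb⟩ := hg
  exact ⟨A, d, hA, fun ε δ hε hδ => (h ε δ hε hδ).trans (hb ε δ hε hδ)⟩

theorem const (c : ℝ) : PolyBounded fun _ _ => c :=
  ⟨|c|, 0, abs_nonneg c, fun _ _ _ _ => by simp⟩

theorem one_le_base {ε δ : ℝ} (hε : 0 < ε) (hδ : 0 < δ) : 1 ≤ 1 + 1 / ε + 1 / δ := by
  have : 0 < 1 / ε := by positivity
  have : 0 < 1 / δ := by positivity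
  linarith

theorem add {f g : ℝ → ℝ → ℝ} (hf : PolyBounded f) (hg : PolyBounded g) :
    PolyBounded fun ε δ => f ε δ + g ε δ := by
  obtain ⟨A, d, hA, hb⟩ := hf
  obtain ⟨A', d', hA', hb'⟩ := hg
  refine ⟨A + A', d + d', by positivity, fun ε δ hε hδ => ?_⟩
  have h1 := one_le_base hε hδ
  have h2 : (1 + 1 / ε + 1 / δ) ^ d ≤ (1 + 1 / ε + 1 / δ) ^ (d + d') :=
    pow_le_pow_right₀ h1 (by omega)
  have h3 : (1 + 1 / ε + 1 / δ) ^ d' ≤ (1 + 1 / ε + 1 / δ) ^ (d + d') :=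
    pow_le_pow_right₀ h1 (by omega)
  calc |f ε δ + g ε δ| ≤ |f ε δ| + |g ε δ| := abs_add_le _ _
    _ ≤ A * (1 + 1 / ε + 1 / δ) ^ d + A' * (1 + 1 / ε + 1 / δ) ^ d' :=
        add_le_add (hb ε δ hε hδ) (hb' ε δ hε hδ)
    _ ≤ A * (1 + 1 / ε + 1 / δ) ^ (d + d') + A' * (1 + 1 / ε + 1 / δ) ^ (d + d') := by gcongr
    _ = _ := by ring

theorem mul {f g : ℝ → ℝ → ℝ} (hf : PolyBounded f) (hg : PolyBounded g) :
    PolyBounded fun ε δ => f ε δ * g ε δ := by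
  obtain ⟨A, d, hA, hb⟩ := hf
  obtain ⟨A', d', hA', hb'⟩ := hg
  refine ⟨A * A', d + d', by positivity, fun ε δ hε hδ => ?_⟩
  rw [abs_mul, pow_add, mul_mul_mul_comm]
  exact mul_le_mul (hb ε δ hε hδ) (hb' ε δ hε hδ) (abs_nonneg _)
    (mul_nonneg hA (pow_nonneg (by linarith [one_le_base hε hδ]) _))

theorem pow {f : ℝ → ℝ → ℝ} (hf : PolyBounded f) (n : ℕ) : PolyBounded fun ε δ => f ε δ ^ n := by
  induction n with
  | zero => simpa using const 1
  | succ n ih => simpa only [pow_succ] using ih.mul hf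

theorem inv_fst : PolyBounded fun ε _ => 1 / ε := by
  refine ⟨1, 1, zero_le_one, fun ε δ hε hδ => ?_⟩
  have : 0 < 1 / δ := by positivity
  rw [abs_of_pos (by positivity)]
  linarith

theorem inv_snd : PolyBounded fun _ δ => 1 / δ := by
  refine ⟨1, 1, zero_le_one, fun ε δ hε hδ => ?_⟩
  have : 0 < 1 / ε := by positivity
  rw [abs_of_pos (by positivity)]
  linarith

theorem ceil {f : ℝ → ℝ → ℝ} (hf : PolyBounded f) : PolyBounded fun ε δ => (⌈f ε δ⌉₊ : ℝ) := by
  have h : PolyBounded fun ε δ => |f ε δ| := hf.mono fun ε δ _ _ => by rw [abs_abs]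
  refine (h.add (const 1)).mono fun ε δ _ _ => ?_
  rw [abs_of_nonneg (Nat.cast_nonneg _), abs_of_nonneg (by positivity)]
  calc (⌈f ε δ⌉₊ : ℝ) ≤ ⌈|f ε δ|⌉₊ := by exact_mod_cast Nat.ceil_mono (le_abs_self _)
    _ ≤ _ := (Nat.ceil_lt_add_one (abs_nonneg _)).le

theorem comp {f g h : ℝ → ℝ → ℝ} (hf : PolyBounded f) (hg : PolyBounded fun ε δ => 1 / g ε δ)
    (hh : PolyBounded fun ε δ => 1 / h ε δ) (g0 : ∀ ε δ, 0 < ε → 0 < δ → 0 < g ε δ)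
    (h0 : ∀ ε δ, 0 < ε → 0 < δ → 0 < h ε δ) : PolyBounded fun ε δ => f (g ε δ) (h ε δ) := by
  obtain ⟨A, d, hA, hb⟩ := hf
  refine ((const A).mul ((((const 1).add hg).add hh).pow d)).mono fun ε δ hε hδ => ?_
  exact (hb _ _ (g0 ε δ hε hδ) (h0 ε δ hε hδ)).trans (le_abs_self _)

end PolyBounded

namespace Constants

variable (K : Constants) (k : ℕ)

theorem polyBounded_numSamples : PolyBounded fun ε δ => (K.numSamples ε δ : ℝ) := by
  refine PolyBounded.ceil (f := fun ε δ => K.CB / (ε * δ) ^ K.cB) ?_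
  refine ((PolyBounded.const K.CB).mul
    ((PolyBounded.inv_fst.mul PolyBounded.inv_snd).pow K.cB)).mono fun ε δ _ _ => le_of_eq ?_
  congr 1
  rw [div_mul_div_comm, one_mul, div_pow, one_pow]
  ring

theorem polyBounded_meshInv : PolyBounded fun ε _ => (K.meshInv k ε : ℝ) := by
  refine PolyBounded.ceil (f := fun ε _ => K.cγ / K.accuracy ε ^ (4 * k - 1)) ?_
  refine ((PolyBounded.const K.cγ).mul (((PolyBounded.const (1 / K.cα)).mul
    (PolyBounded.inv_fst.pow K.eα)).pow (4 * k - 1))).mono fun ε δ _ _ => le_of_eq ?_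
  congr 1
  rw [accuracy, div_pow, one_pow, div_mul_div_comm, one_mul, div_pow, one_pow]
  ring

theorem polyBounded_meshBound : PolyBounded fun ε _ => (K.meshBound k ε : ℝ) := by
  refine PolyBounded.ceil (f := fun ε _ => 2 / ε * K.meshInv k ε) ?_
  refine (((PolyBounded.const 2).mul PolyBounded.inv_fst).mul (K.polyBounded_meshInv k)).mono
    fun ε δ _ _ => le_of_eq ?_
  congr 1
  ring

theorem S_eq (ε δ : ℝ) :
    K.S k ε δ = (ε * δ) ^ K.cB / (K.CB * (K.C₁ * k ^ 4) * (K.C₂ * k ^ 4)) := by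
  rw [S, R, Q, div_div, div_div, ← mul_assoc]

theorem S_pos (hk : 1 ≤ k) {ε δ : ℝ} (hε : 0 < ε) (hδ : 0 < δ) : 0 < K.S k ε δ := by
  have h1 : (0 : ℝ) < k := by exact_mod_cast hk
  have := K.CB_pos; have := K.C₁_pos; have := K.C₂_pos
  rw [S_eq]; positivity

theorem polyBounded_inv_S : PolyBounded fun ε δ => 1 / K.S k ε δ := by
  refine ((PolyBounded.const (K.CB * (K.C₁ * k ^ 4) * (K.C₂ * k ^ 4))).mul
    ((PolyBounded.inv_fst.mul PolyBounded.inv_snd).pow K.cB)).mono fun ε δ _ _ => le_of_eq ?_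
  congr 1
  rw [S_eq, div_mul_div_comm, one_mul, div_pow, one_pow, one_div_div]
  ring

end Constants

namespace Prog

theorem length_mesh (N M : ℕ) : ((mesh N M).length : ℝ) = (N + 1) * ((2 * M + 1) * (M + 1)) := by
  simp [mesh, List.product]

/-- The bound is nested like the instructions, so that sequential composition produces it literally.
The constant c pays for the examination of one candidate and does not depend on the precision. -/
theorem costLE_basicUnivariate (K : Constants) (k : ℕ) : ∃ c : ℝ, ∀ ε δ : ℝ,
    CostLE (basicUnivariate K k ε δ) (1 + (K.cB + (1 + (K.numSamples ε δ + 1 +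
      (3 * K.numSamples ε δ + ((4 * k - 2 : ℕ) * (K.numSamples ε δ * (4 * k) + 1 + 1) + (K.eα + (1 +
      ((4 * k - 1 : ℕ) + (1 + (K.meshInv k ε + 1 + (1 + (1 + (1 + (K.meshBound k ε + 1 +
      k * (((K.meshInv k ε + 1) * ((2 * K.meshBound k ε + 1) * (K.meshBound k ε + 1)) + 1) ^ k *
        (c + 1) + 1))))))))))))))) ) := by
  have hk0 : (0 : ℝ) ≤ k := Nat.cast_nonneg k
  set c₁ : ℝ := (4 * k - 2 : ℕ) * (k * (4 * (4 * k) + 3) + 5) with hc₁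
  refine ⟨k * 5 + (k * 9 + k * (k * 9 + 1) + 4 + c₁), fun ε δ => ?_⟩
  have hc : 0 ≤ k * 5 + (k * 9 + k * (k * 9 + 1) + 4 + c₁) := by positivity
  set m := K.numSamples ε δ
  refine (costLE_mulP _ _).seq_eq (post_mulP _ _) ((costLE_powP _ _).seq_eq (post_powP _ _)
    ((costLE_divP _ _).seq_eq (post_divP _ _) ((costLE_ceilP _).seq_eq (post_ceilP _)
    ((cost_draw _).bind fun xs hxs => ?_))))
  refine CostLE.seq (costLE_forFin (c := m * (4 * k) + 1) fun j => ?_) fun sm =>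
    (costLE_powP _ _).seq_eq (post_powP _ _) ((costLE_mulP _ _).seq_eq (post_mulP _ _)
    ((costLE_powP _ _).seq_eq (post_powP _ _) ((costLE_divP _ _).seq_eq (post_divP _ _)
    ((costLE_ceilP _).seq_eq (post_ceilP _) ((costLE_divP _ _).seq_eq (post_divP _ _)
    ((costLE_divP _ _).seq_eq (post_divP _ _) ((costLE_mulP _ _).seq_eq (post_mulP _ _)
    ((costLE_ceilP _).seq_eq (post_ceilP _) ?_))))))))
  · refine CostLE.seq ((costLE_powerSum _ _).mono ?_) fun _ => costLE_divP _ _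
    have h1 : ((j : ℕ) : ℝ) + 1 + 1 ≤ 4 * k := by
      have := j.2
      exact_mod_cast (by omega : (j : ℕ) + 1 + 1 ≤ 4 * k)
    have h2 : (xs.length : ℝ) = m := by rw [hxs]; rfl
    rw [h2]
    push_cast
    gcongr
  · change CostLE (firstSome (fun n => searchTuples (mesh (K.meshInv k ε) (K.meshBound k ε)) (n + 1) _) _) _
    have h := costLE_firstSome (c := ((mesh (K.meshInv k ε) (K.meshBound k ε)).length + 1 : ℝ) ^ k *
      (k * 5 + (k * 9 + k * (k * 9 + 1) + 4 + c₁) + 1)) (by positivity) (l := List.range k)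
      (f := fun n => searchTuples (mesh (K.meshInv k ε) (K.meshBound k ε)) (n + 1) fun t => do
        let F ← candidate (1 / K.meshInv k ε) (K.meshBound k ε) (n + 1) t
        if ← admissible ε F then
          let ok ← allFin (4 * k - 2) fun j => do
            let q ← mixtureMoment F (j + 1)
            let d ← absP (← subP q (sm j))
            leP d (K.accuracy ε)
          pure (if ok then some F else none)
        else pure none) fun n hn => ?_
    · rw [List.length_range, length_mesh] at h
      exact h
    · have hn' : n + 1 ≤ k := List.mem_range.1 hn
      have hnk : ((n + 1 : ℕ) : ℝ) ≤ k := by exact_mod_cast hn'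
      refine (costLE_searchTuples hc fun t => ?_).mono ?_
      · refine CostLE.seq_eq ((costLE_candidate _ _ _ _).mono (by gcongr)) (post_candidate _ _ _ _)
          (CostLE.seq ((costLE_admissible _ _).mono ?_) fun b => costLE_ite ?_
            ((costLE_pure _).mono (by positivity)))
        · change ((n + 1 : ℕ) : ℝ) * 9 + (n + 1 : ℕ) * ((n + 1 : ℕ) * 9 + 1) + 4 ≤ _
          gcongr
        · refine (CostLE.seq (costLE_allFin (c := k * (4 * (4 * k) + 3) + 4) (by positivity)
            fun j => ?_) fun ok => costLE_pure _).mono (d := c₁) (by rw [hc₁]; apply le_of_eq; ring)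
          refine (CostLE.seq ((costLE_mixtureMoment _ _).mono ?_) fun _ => (costLE_subP _ _).seq
            fun _ => (costLE_absP _).seq fun _ => costLE_leP _ _).mono
            (c := k * (4 * (4 * k) + 3) + (1 + (2 + 1))) (by linarith)
          have h1 : ((j : ℕ) + 1 : ℕ) ≤ 4 * k := by have := j.2; omega
          have h2 : (((j : ℕ) + 1 : ℕ) : ℝ) ≤ 4 * k := by exact_mod_cast h1
          change ((n + 1 : ℕ) : ℝ) * _ ≤ _
          gcongr
      · have : ((mesh (K.meshInv k ε) (K.meshBound k ε)).length + 1 : ℝ) ^ (n + 1) ≤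
            ((mesh (K.meshInv k ε) (K.meshBound k ε)).length + 1 : ℝ) ^ k :=
          pow_le_pow_right₀ (by linarith [(Nat.cast_nonneg _ : (0 : ℝ) ≤ (mesh (K.meshInv k ε) (K.meshBound k ε)).length)]) hn'
        have := mul_le_mul_of_nonneg_right this (by linarith : 0 ≤ k * 5 + (k * 9 + k * (k * 9 + 1) + 4 + c₁) + 1)
        linarith

end Prog

namespace Prog

theorem exists_polyBounded_costLE_basicUnivariate (K : Constants) (k : ℕ) :
    ∃ B, PolyBounded B ∧ ∀ ε δ : ℝ, CostLE (basicUnivariate K k ε δ) (B ε δ) := by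
  obtain ⟨c, hc⟩ := costLE_basicUnivariate K k
  refine ⟨_, ?_, hc⟩
  have pc := PolyBounded.const
  have hm := K.polyBounded_numSamples
  have hN := K.polyBounded_meshInv k
  have hM := K.polyBounded_meshBound k
  have hL := (((hN.add (pc 1)).mul ((((pc 2).mul hM).add (pc 1)).mul (hM.add (pc 1)))).add (pc 1)).pow k
  exact (pc 1).add ((pc _).add ((pc 1).add ((hm.add (pc 1)).add (((pc 3).mul hm).add
    (((pc _).mul (((hm.mul (pc _)).add (pc 1)).add (pc 1))).add ((pc _).add ((pc 1).add
    ((pc _).add ((pc 1).add ((hN.add (pc 1)).add ((pc 1).add ((pc 1).add ((pc 1).add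
    ((hM.add (pc 1)).add ((pc _).mul ((hL.mul (pc _)).add (pc 1)))))))))))))))))

/-- The next precision is S of the current one, and 1 / S is polynomially bounded. Composing
polynomial bounds a fixed number of times keeps them polynomial. -/
theorem exists_polyBounded_costLE_runBasic (K : Constants) (k : ℕ) (hk : 1 ≤ k) (n : ℕ) :
    ∃ B, PolyBounded B ∧ ∀ ε δ : ℝ, 0 < ε → 0 < δ → CostLE (runBasic K k δ n ε) (B ε δ) := by
  induction n with
  | zero => exact ⟨_, PolyBounded.const 0, fun ε δ _ _ => costLE_pure _⟩
  | succ n ih =>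
    obtain ⟨B, hB, h⟩ := ih
    obtain ⟨B', hB', h'⟩ := exists_polyBounded_costLE_basicUnivariate K k
    refine ⟨fun ε δ => B' ε δ + (K.cB + 4 + (B (K.S k ε δ) δ + 0)), hB'.add
      ((PolyBounded.const _).add ((hB.comp (g := K.S k) (h := fun _ δ => δ)
        (K.polyBounded_inv_S k) PolyBounded.inv_snd (fun ε δ hε hδ => K.S_pos k hk hε hδ)
        fun _ _ _ hδ => hδ).add (PolyBounded.const 0))), fun ε δ hε hδ => ?_⟩
    exact (h' ε δ).seq fun _ => (costLE_nextPrecision K k ε δ).seq_eq (post_nextPrecision _ _ _ _)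
      ((h _ _ (K.S_pos k hk hε hδ) hδ).seq fun _ => costLE_pure _)

theorem exists_steps_generalUnivariate_le (K : Constants) (k : ℕ) (hk : 1 ≤ k) :
    ∃ (A : ℝ) (d : ℕ), ∀ ε δ : ℝ, 0 < ε → 0 < δ → ∀ x z : ℕ → ℝ,
      ((generalUnivariate K k ε δ).steps x z : ℝ) ≤ A * (1 + 1 / ε + 1 / δ) ^ d := by
  obtain ⟨B, hB, hrun⟩ := exists_polyBounded_costLE_runBasic K k hk (k ^ 2)
  obtain ⟨c, hc0, hc⟩ := exists_costLE_isSubdivision k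
  have hk0 : (0 : ℝ) < k := by exact_mod_cast hk
  have hC := K.C_pos
  set a : ℝ := K.C * (k : ℝ) ^ k ^ 2 with ha
  have ha0 : 0 < a := by positivity
  set b : ℝ := 2 * (k : ℝ) ^ 2 with hb
  have hb0 : 0 < b := by positivity
  set c₂ : ℝ := (k ^ 2 : ℕ) * (0 + 2) + (1 + (k ^ 2 : ℕ) * (c + 1)) with hc₂
  have hc₂0 : 0 ≤ c₂ := by positivity
  set tot : ℝ → ℝ → ℝ := fun ε δ => 1 + (1 + (1 + (B (ε / a) (δ / b) +
    (((2 + 1 : ℝ) ^ k ^ 2 * (c₂ + 1) - 1) + (k * 2 + 0))))) with htot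
  have hpoly : PolyBounded tot := by
    have pc := PolyBounded.const
    refine (pc 1).add ((pc 1).add ((pc 1).add (PolyBounded.add (hB.comp (g := fun ε _ => ε / a)
      (h := fun _ δ => δ / b) ?_ ?_ (fun ε δ hε _ => by positivity)
      fun ε δ _ hδ => by positivity) ((pc _).add (pc _)))))
    · exact ((pc a).mul PolyBounded.inv_fst).mono fun ε δ _ _ => le_of_eq (by
        congr 1; rw [one_div_div]; ring)
    · exact ((pc b).mul PolyBounded.inv_snd).mono fun ε δ _ _ => le_of_eq (by
        congr 1; rw [one_div_div]; ring)
  have hcost : ∀ ε δ : ℝ, 0 < ε → 0 < δ → CostLE (generalUnivariate K k ε δ) (tot ε δ) := by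
    intro ε δ hε hδ
    refine (costLE_divP _ _).seq_eq (post_divP _ _) ((costLE_divP _ _).seq_eq (post_divP _ _)
      ((costLE_mulP _ _).seq_eq (post_mulP _ _) (Cost.bind (CostLE.and_run
        (Q := fun est => ∀ i G, est i = some G → G.size ≤ k)
        (hrun (ε / a) (δ / b) (by positivity) (by positivity)) fun x z => ?_) fun est hest => ?_)))
    -- The cost of comparing and deconvolving estimates depends on their sizes, which the
    -- specification of the runs bounds by k.
    · obtain ⟨est, hest, x', z', h⟩ := exists_run_runBasic_bind K k (δ / b) (k ^ 2) (ε / a) x z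
      have h1 := h ret
      rw [bind_ret] at h1
      rw [h1]
      exact fun i G hG => ((hest i).1 G hG).1
    · set η := K.Cchain * k * (ε / a) with hη
      refine Cost.bind (CostLE.and_post (costLE_searchTuples hc₂0 fun T => ?_)
        (post_searchTuples (Q := fun T r => ∀ F, r = some F → F.size ≤ k) fun T _ =>
          (post_sumFin fun i => post_pure_eq _).bind_eq ((post_leP _ _).bind fun b hb => ?_)))
        fun r hr => ?_
      · refine CostLE.seq (costLE_sumFin fun i => costLE_pure _) fun s => (costLE_leP _ _).seq fun b =>
          costLE_ite ((costLE_pure _).mono (by positivity)) ?_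
        refine (costLE_chainLast hc0 (hc η) hest T _ _ (by simp)).mono ?_
        rw [List.length_reverse, List.length_finRange]
      · rcases b with _ | _
        · exact (post_chainLast _ _ _ _ _).mono fun r hr F hF => by
            rw [hr] at hF
            rcases chainValue_mem _ _ _ _ _ _ hF with h | ⟨i, h⟩
            · simp at h
            · exact hest i F h
        · exact post_pure fun F hF => by simp at hF
      · rcases hr with ⟨F, rfl, T, _, h⟩ | ⟨rfl, _⟩
        · refine CostLE.seq ((costLE_deconvolve F).mono ?_) fun _ => costLE_pure _
          have : (F.size : ℝ) ≤ k := by exact_mod_cast h F rfl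
          gcongr
        · exact (costLE_pure _).mono (by positivity)
  obtain ⟨A, d, _, h⟩ := hpoly
  exact ⟨A, d, fun ε δ hε hδ x z =>
    (hcost ε δ hε hδ x z).1.trans ((le_abs_self _).trans (h ε δ hε hδ))⟩

end Prog

/-! ### A single run whose window contains no distance. -/

/-- Components at distance less than `r` are replaced by a common representative, when no distance
lies between `r` and `ε`. -/
theorem Mixture.exists_representatives (F : Mixture) {r ε : ℝ} (hr : 0 < r) (hrε : 2 * r ≤ ε)
    (hgap : ∀ a b, paramDist (F.comp a) (F.comp b) < r ∨ ε < paramDist (F.comp a) (F.comp b)) :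
    ∃ (H : Mixture) (ρ : Fin F.size → Fin H.size), Function.Surjective ρ ∧ H.size ≤ F.size ∧
      (∀ j, (H.comp j).weight = ∑ i with ρ i = j, (F.comp i).weight) ∧
      (∀ j, ∃ a, ρ a = j ∧ (H.comp j).mean = (F.comp a).mean ∧ (H.comp j).var = (F.comp a).var) ∧
      (∀ i, paramDist (F.comp i) (H.comp (ρ i)) < r) ∧
      (∀ a b, ρ a = ρ b ↔ paramDist (F.comp a) (F.comp b) < r) ∧
      ∀ i j, i ≠ j → ε < paramDist (H.comp i) (H.comp j) := by
  classical
  -- Transitivity is where the gap enters: two distances below r add up to less than 2 * r ≤ ε, and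
  -- a distance that does not exceed ε is below r.
  let s : Setoid (Fin F.size) := ⟨fun a b => paramDist (F.comp a) (F.comp b) < r,
    fun a => by rw [paramDist_self]; exact hr,
    fun {a b} h => by rw [paramDist_comm]; exact h,
    fun {a b c} h h' => by
      rcases hgap a c with h1 | h1
      · exact h1
      · have := paramDist_triangle (F.comp a) (F.comp b) (F.comp c)
        linarith⟩
  let e := Fintype.equivFin (Quotient s)
  let ρ : Fin F.size → Fin (Fintype.card (Quotient s)) := fun a => e (Quotient.mk s a)
  have hρ : Function.Surjective ρ := e.surjective.comp Quotient.mk_surjective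
  have hiff : ∀ a b, ρ a = ρ b ↔ paramDist (F.comp a) (F.comp b) < r := fun a b => by
    rw [e.injective.eq_iff, Quotient.eq]; rfl
  choose sec hsec using fun j => hρ j
  let H : Mixture := ⟨Fintype.card (Quotient s), fun j =>
    ⟨∑ i with ρ i = j, (F.comp i).weight, (F.comp (sec j)).mean, (F.comp (sec j)).var⟩⟩
  refine ⟨H, ρ, hρ, ?_, fun j => rfl, fun j => ⟨sec j, hsec j, rfl, rfl⟩, fun i => ?_, hiff,
    fun i j hij => ?_⟩
  · simpa using Fintype.card_quotient_le s
  · exact (hiff i (sec (ρ i))).1 (hsec _).symm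
  · rcases hgap (sec i) (sec j) with h | h
    · exact absurd ((hiff _ _).2 h) (by rw [hsec, hsec]; exact hij)
    · exact h

/-- A mixture is approximated by one with parameters in the mesh. -/
theorem Mixture.exists_mesh (F : Mixture) (hF : 0 < F.size) {N M : ℕ} (hN : 0 < N)
    (hw : ∀ i, 0 ≤ (F.comp i).weight) (hsum : ∑ i, (F.comp i).weight = 1)
    (hμ : ∀ i, |(F.comp i).mean| * N ≤ M) (hv : ∀ i, 0 ≤ (F.comp i).var ∧ (F.comp i).var * N ≤ M) :
    ∃ t : Fin F.size → ℕ × ℕ × ℕ, (∀ i, t i ∈ Prog.mesh N M) ∧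
      ∑ i, ((t i).1 : ℝ) * (1 / N) = 1 ∧
      (∀ i, |(t i).1 * (1 / (N : ℝ)) - (F.comp i).weight| ≤ F.size / N) ∧
      (∀ i, (F.comp i).weight - 1 / N ≤ (t i).1 * (1 / (N : ℝ))) ∧
      (∀ i, |((t i).2.1 - M : ℝ) * (1 / N) - (F.comp i).mean| ≤ 1 / N) ∧
      ∀ i, (F.comp i).var ≤ (t i).2.2 * (1 / (N : ℝ)) ∧
        |(t i).2.2 * (1 / (N : ℝ)) - (F.comp i).var| ≤ 1 / N := by
  classical
  have hN' : (0 : ℝ) < N := by exact_mod_cast hN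
  -- The weights are rounded down, and the missing g ≤ `F.size` units are given to one component, so
  -- that the sum is exactly one.
  set f : Fin F.size → ℕ := fun i => ⌊(F.comp i).weight * N⌋₊ with hf
  have hf1 : ∀ i, (f i : ℝ) ≤ (F.comp i).weight * N := fun i =>
    Nat.floor_le (mul_nonneg (hw i) hN'.le)
  have hf2 : ∀ i, (F.comp i).weight * N - 1 ≤ f i := fun i => (Nat.sub_one_lt_floor _).le
  have hfs : ∑ i, (f i : ℝ) ≤ N := by
    calc _ ≤ ∑ i, (F.comp i).weight * N := Finset.sum_le_sum fun i _ => hf1 i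
      _ = N := by rw [← Finset.sum_mul, hsum, one_mul]
  have hfs2 : (N : ℝ) - F.size ≤ ∑ i, (f i : ℝ) := by
    calc (N : ℝ) - F.size = ∑ i, ((F.comp i).weight * N - 1) := by
          rw [Finset.sum_sub_distrib, ← Finset.sum_mul, hsum]; simp
      _ ≤ _ := Finset.sum_le_sum fun i _ => hf2 i
  have hfs' : ∑ i, f i ≤ N := by exact_mod_cast hfs
  set g : ℕ := N - ∑ i, f i with hg
  have hg' : (g : ℝ) = N - ∑ i, (f i : ℝ) := by rw [hg, Nat.cast_sub hfs']; push_cast; rfl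
  set a : Fin F.size → ℕ := fun i => f i + if i = ⟨0, hF⟩ then g else 0 with ha
  have hsa : ∑ i, a i = N := by
    simp only [ha, Finset.sum_add_distrib, Finset.sum_ite_eq', Finset.mem_univ, if_true]
    omega
  have haN : ∀ i, a i ≤ N := fun i => hsa ▸ Finset.single_le_sum (f := a) (by simp) (Finset.mem_univ i)
  have ha1 : ∀ i, (f i : ℝ) ≤ a i := fun i => by
    simp only [ha]; push_cast; split_ifs <;> simp
  have ha2 : ∀ i, (a i : ℝ) ≤ f i + g := fun i => by
    simp only [ha]; push_cast; split_ifs <;> simp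
  have hbm : ∀ i, -(M : ℤ) ≤ ⌈(F.comp i).mean * N⌉ ∧ ⌈(F.comp i).mean * N⌉ ≤ M := fun i => by
    have h := hμ i
    rw [← abs_of_pos hN', ← abs_mul, abs_le] at h
    refine ⟨?_, Int.ceil_le.2 (by exact_mod_cast h.2)⟩
    have : (-(M : ℤ) : ℝ) ≤ ⌈(F.comp i).mean * N⌉ := by
      push_cast; exact h.1.trans (Int.le_ceil _)
    exact_mod_cast this
  have hbc : ∀ i, (((⌈(F.comp i).mean * N⌉ + M).toNat : ℕ) : ℝ) = ⌈(F.comp i).mean * N⌉ + M := fun i => by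
    have h := (hbm i).1
    have : (((⌈(F.comp i).mean * N⌉ + M).toNat : ℕ) : ℤ) = ⌈(F.comp i).mean * N⌉ + M :=
      Int.toNat_of_nonneg (by linarith)
    exact_mod_cast this
  -- The index of the mean is offset by M to be natural. The variance is rounded up, so that it
  -- stays above 1/2.
  refine ⟨fun i => (a i, (⌈(F.comp i).mean * N⌉ + M).toNat, ⌈(F.comp i).var * N⌉₊), fun i => ?_, ?_,
    fun i => ?_, fun i => ?_, fun i => ?_, fun i => ?_⟩
  · have h1 := haN i
    have h2 := hbm i
    have h3 : ⌈(F.comp i).var * N⌉₊ ≤ M := Nat.ceil_le.2 (hv i).2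
    unfold Prog.mesh
    rw [List.pair_mem_product, List.pair_mem_product, List.mem_range, List.mem_range, List.mem_range]
    omega
  · rw [← Finset.sum_mul]
    have : ∑ i, (a i : ℝ) = N := by exact_mod_cast hsa
    simp only [this]
    field_simp
  · have h1 := ha1 i
    have h2 := ha2 i
    have hs1 : (1 : ℝ) ≤ F.size := by exact_mod_cast hF
    rw [mul_one_div, show (a i : ℝ) / N - (F.comp i).weight =
      (a i - (F.comp i).weight * N) / N by field_simp, abs_div, abs_of_pos hN']
    gcongr
    rw [abs_le]
    have h3 := hf1 i
    have h4 := hf2 i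
    constructor <;> linarith
  · have h1 := ha1 i
    have h4 := hf2 i
    rw [mul_one_div, le_div_iff₀ hN', sub_mul, one_div_mul_cancel hN'.ne']
    exact h4.trans h1
  · simp only [hbc, add_sub_cancel_right]
    rw [mul_one_div, show (⌈(F.comp i).mean * N⌉ : ℝ) / N - (F.comp i).mean =
      (⌈(F.comp i).mean * N⌉ - (F.comp i).mean * N) / N by field_simp, abs_div, abs_of_pos hN']
    gcongr
    have h1 := Int.le_ceil ((F.comp i).mean * N)
    have h2 := (Int.ceil_lt_add_one ((F.comp i).mean * N)).le
    rw [abs_le]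
    constructor <;> linarith
  · have h1 := Nat.le_ceil ((F.comp i).var * N)
    have h2 := (Nat.ceil_lt_add_one (mul_nonneg (hv i).1 hN'.le)).le
    rw [mul_one_div]
    refine ⟨(le_div_iff₀ hN').2 h1, ?_⟩
    rw [show (⌈(F.comp i).var * N⌉₊ : ℝ) / N - (F.comp i).var =
      (⌈(F.comp i).var * N⌉₊ - (F.comp i).var * N) / N by field_simp, abs_div, abs_of_pos hN']
    gcongr
    rw [abs_le]
    constructor <;> linarith

/-- Closeness of the moments of two mixtures with close parameters. -/
theorem Mixture.abs_moment_sub_le {n m j : ℕ} {D B a b : ℝ} (hD0 : 0 ≤ D) (hB : 1 ≤ B)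
    (hD : (∀ μ v, |μ| ≤ B → |v| ≤ B → |gaussMoment μ v j| ≤ D * B ^ m) ∧
      ∀ μ v μ' v', |μ| ≤ B → |v| ≤ B → |μ'| ≤ B → |v'| ≤ B →
        |gaussMoment μ v j - gaussMoment μ' v' j| ≤ D * B ^ m * (|μ - μ'| + |v - v'|))
    (F G : Fin n → Component) (hw : ∀ i, 0 ≤ (F i).weight) (hsum : ∑ i, (F i).weight = 1)
    (hF : ∀ i, |(F i).mean| ≤ B ∧ |(F i).var| ≤ B) (hG : ∀ i, |(G i).mean| ≤ B ∧ |(G i).var| ≤ B)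
    (ha : ∀ i, |(G i).weight - (F i).weight| ≤ a) (hb : ∀ i, paramDist (F i) (G i) ≤ b) :
    |Mixture.moment ⟨n, G⟩ j - Mixture.moment ⟨n, F⟩ j| ≤ D * B ^ m * (n * a + b) := by
  have hX : 0 ≤ D * B ^ m := by positivity
  unfold Mixture.moment
  calc |∑ i, (G i).weight * gaussMoment (G i).mean (G i).var j -
        ∑ i, (F i).weight * gaussMoment (F i).mean (F i).var j|
      = |∑ i, (((G i).weight - (F i).weight) * gaussMoment (G i).mean (G i).var j +
          (F i).weight * (gaussMoment (G i).mean (G i).var j -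
            gaussMoment (F i).mean (F i).var j))| := by
        rw [← Finset.sum_sub_distrib]; congr 1; exact Finset.sum_congr rfl fun i _ => by ring
    _ ≤ ∑ i : Fin n, (a * (D * B ^ m) + (F i).weight * (D * B ^ m * b)) := by
        refine (Finset.abs_sum_le_sum_abs _ _).trans (Finset.sum_le_sum fun i _ => ?_)
        refine (abs_add_le _ _).trans (add_le_add ?_ ?_)
        · rw [abs_mul]
          exact mul_le_mul (ha i) (hD.1 _ _ (hG i).1 (hG i).2) (abs_nonneg _)
            ((abs_nonneg _).trans (ha i))
        · rw [abs_mul, abs_of_nonneg (hw i)]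
          refine mul_le_mul_of_nonneg_left ?_ (hw i)
          rw [abs_sub_comm]
          exact (hD.2 _ _ _ _ (hF i).1 (hF i).2 (hG i).1 (hG i).2).trans
            (mul_le_mul_of_nonneg_left (hb i) hX)
    _ = D * B ^ m * (n * a + b) := by
        rw [Finset.sum_add_distrib, ← Finset.sum_mul, ← Finset.sum_mul, hsum]
        simp; ring

/-- Regrouping a mixture along a map between the components. -/
theorem Mixture.moment_eq_of_weight (F H : Mixture) (ρ : Fin F.size → Fin H.size)
    (hw : ∀ j, (H.comp j).weight = ∑ i with ρ i = j, (F.comp i).weight) (j : ℕ) :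
    H.moment j = Mixture.moment ⟨F.size, fun i =>
      ⟨(F.comp i).weight, (H.comp (ρ i)).mean, (H.comp (ρ i)).var⟩⟩ j := by
  unfold Mixture.moment
  rw [← Finset.sum_fiberwise (s := Finset.univ) (g := ρ)]
  refine Finset.sum_congr rfl fun l _ => ?_
  rw [hw, Finset.sum_mul]
  exact Finset.sum_congr rfl fun i hi => by rw [← (Finset.mem_filter.1 hi).2]

/-- In a run whose window contains none of the distances between components, the Basic Univariate
Algorithm succeeds, and its result identifies exactly the components at distance less than `r`. -/
theorem Constants.IsBasicResult.exists_of_gap (K : Constants) (k : ℕ) {e : ℕ}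
    (he : ∀ θ : ℝ, 0 < θ → θ ≤ 1 / 2 → ∀ F G : Mixture,
      F.size ≤ k → G.size ≤ k → F.IsSeparated θ → G.IsSeparated θ →
      (∀ j ≤ 4 * k - 2, |F.moment j - G.moment j| ≤ θ ^ e) →
      ∃ π : Fin F.size → Fin G.size, Function.Bijective π ∧
        ∀ i, |(F.comp i).weight - (G.comp (π i)).weight| ≤ θ ∧
          paramDist (F.comp i) (G.comp (π i)) ≤ θ) {D : ℝ} (hD1 : 1 ≤ D)
    (hD : ∀ j ≤ 4 * k - 2, ∀ B : ℝ, 1 ≤ B →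
      (∀ μ v, |μ| ≤ B → |v| ≤ B → |gaussMoment μ v j| ≤ D * B ^ (4 * k - 2)) ∧
      ∀ μ v μ' v', |μ| ≤ B → |v| ≤ B → |μ'| ≤ B → |v'| ≤ B →
        |gaussMoment μ v j - gaussMoment μ' v' j| ≤
          D * B ^ (4 * k - 2) * (|μ - μ'| + |v - v'|))
    {ε r : ℝ} (hε : 0 < ε) (hε1 : ε ≤ 1) (hr : 0 < r) (hrε : 2 * r ≤ ε)
    (hα : 2 * K.accuracy ε ≤ (ε / 4) ^ e)
    (hrα : D * (2 / ε) ^ (4 * k - 2) * r ≤ K.accuracy ε / 4)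
    (hN : 8 / ε ≤ K.meshInv k ε)
    (hNα : D * (2 / ε) ^ (4 * k - 2) * ((k ^ 2 + 2) / K.meshInv k ε) ≤ K.accuracy ε / 4)
    {F : Mixture} (hFk : F.size ≤ k) (hw : ∀ i, ε ≤ (F.comp i).weight)
    (hsum : ∑ i, (F.comp i).weight = 1) (hμ : ∀ i, |(F.comp i).mean| ≤ 1 / ε)
    (hv : ∀ i, 1 / 2 < (F.comp i).var ∧ (F.comp i).var ≤ 1 / ε)
    (hgap : ∀ a b, paramDist (F.comp a) (F.comp b) < r ∨ ε < paramDist (F.comp a) (F.comp b))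
    {s : ℕ → ℝ} (hs : ∀ j, 1 ≤ j → j ≤ 4 * k - 2 → |F.moment j - s j| ≤ K.accuracy ε / 4)
    {o : Option Mixture} (ho : K.IsBasicResult k ε s o) :
    ∃ G, o = some G ∧ ∃ π : Fin F.size → Fin G.size, Function.Surjective π ∧
      (∀ a b, π a = π b ↔ paramDist (F.comp a) (F.comp b) < r) ∧
      (∀ j, |∑ i with π i = j, (F.comp i).weight - (G.comp j).weight| ≤ ε) ∧
      ∀ i, paramDist (F.comp i) (G.comp (π i)) ≤ ε := by
  classical
  set α := K.accuracy ε with hαdef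
  set N := K.meshInv k ε with hNdef
  set B := 2 / ε with hB
  set X := D * B ^ (4 * k - 2) with hX
  have hB1 : 1 ≤ B := by rw [hB, le_div_iff₀ hε]; linarith
  have hXpos : 0 < X := by positivity
  have hα0 : 0 < α := mul_pos K.cα_pos (pow_pos hε _)
  have hN8 : (8 : ℝ) ≤ N := le_trans (by rw [le_div_iff₀ hε]; linarith) hN
  have hN0 : (0 : ℝ) < N := by linarith
  have hNnat : 0 < N := by exact_mod_cast hN0
  have hinvε : 1 / (N : ℝ) ≤ ε / 8 := by
    rw [div_le_div_iff₀ hN0 (by norm_num)]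
    rw [div_le_iff₀ hε] at hN; linarith
  have h1ε : 1 ≤ 1 / ε := by rw [le_div_iff₀ hε]; linarith
  have hBε : B = 2 * (1 / ε) := by rw [hB]; ring
  -- H is F with each cluster contracted to one component. It is ε-separated with weights at least
  -- ε, and contracting over distances below r changes the moments by at most α / 4.
  obtain ⟨H, ρ, hρ, hHF, hHw, hHp, hρd, hρr, hHsep⟩ := F.exists_representatives hr hrε hgap
  have hHweight : ∀ j, ε ≤ (H.comp j).weight := fun j => by
    obtain ⟨a, ha⟩ := hρ j
    rw [hHw]
    refine (hw a).trans (Finset.single_le_sum (f := fun i => (F.comp i).weight)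
      (fun i _ => hε.le.trans (hw i)) (by simp [ha]))
  have hHsum : ∑ j, (H.comp j).weight = 1 := by
    simp only [hHw]
    rw [Finset.sum_fiberwise, hsum]
  have hHμ : ∀ j, |(H.comp j).mean| ≤ 1 / ε := fun j => by
    obtain ⟨a, _, h, _⟩ := hHp j
    rw [h]; exact hμ a
  have hHv : ∀ j, 1 / 2 < (H.comp j).var ∧ (H.comp j).var ≤ 1 / ε := fun j => by
    obtain ⟨a, _, _, h⟩ := hHp j
    rw [h]; exact hv a
  have hHk : H.size ≤ k := hHF.trans hFk
  have hHpos : 0 < H.size := by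
    rcases Nat.eq_zero_or_pos H.size with h | h
    · have : IsEmpty (Fin H.size) := by rw [h]; infer_instance
      simp at hHsum
    · exact h
  have habs : ∀ {x : ℝ}, 0 ≤ x → x ≤ B → |x| ≤ B := fun h0 h => by rwa [abs_of_nonneg h0]
  have hHF' : ∀ j ≤ 4 * k - 2, |H.moment j - F.moment j| ≤ α / 4 := fun j hj => by
    rw [F.moment_eq_of_weight H ρ hHw]
    refine (Mixture.abs_moment_sub_le (a := 0) (b := r) (by linarith) hB1 (hD j hj B hB1) F.comp
      (fun i => ⟨(F.comp i).weight, (H.comp (ρ i)).mean, (H.comp (ρ i)).var⟩)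
      (fun i => hε.le.trans (hw i)) hsum (fun i => ⟨?_, ?_⟩) (fun i => ⟨?_, ?_⟩) (fun i => ?_)
      (fun i => (hρd i).le)).trans ?_
    · linarith [hμ i]
    · exact habs (by linarith [(hv i).1]) (by linarith [(hv i).2])
    · linarith [hHμ (ρ i)]
    · exact habs (by linarith [(hHv (ρ i)).1]) (by linarith [(hHv (ρ i)).2])
    · simp
    · simpa using hrα
  have hHs : ∀ j, 1 ≤ j → j ≤ 4 * k - 2 → |H.moment j - s j| ≤ α / 2 := fun j h1 h2 => by
    have := abs_sub_le (H.moment j) (F.moment j) (s j)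
    have := hHF' j h2
    have := hs j h1 h2
    linarith
  have hMN : B * N ≤ K.meshBound k ε := Nat.le_ceil _
  have hM : 1 / ε * N ≤ K.meshBound k ε := by
    refine le_trans (mul_le_mul_of_nonneg_right ?_ hN0.le) hMN
    linarith
  -- The search cannot fail: the mesh point next to H is admissible, and its moments are within α /
  -- 4 of those of H, hence within 3 α / 4 of the sample moments.
  obtain ⟨G, rfl⟩ : ∃ G, o = some G := by
    rcases o with _ | G
    swap
    · exact ⟨G, rfl⟩
    exfalso
    obtain ⟨t, ht, htsum, htw, htw', htμ, htv⟩ := H.exists_mesh hHpos hNnat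
      (fun i => hε.le.trans (hHweight i)) hHsum
      (fun i => (mul_le_mul_of_nonneg_right (hHμ i) hN0.le).trans hM)
      (fun i => ⟨by linarith [(hHv i).1],
        (mul_le_mul_of_nonneg_right (hHv i).2 hN0.le).trans hM⟩)
    have hmesh : ∀ n (hn : n < k) (t : Fin (n + 1) → ℕ × ℕ × ℕ), (∀ i, t i ∈ Prog.mesh N
      (K.meshBound k ε)) → ¬K.Accepts k ε s (meshMixture (1 / N) (K.meshBound k ε) (n + 1) t) :=
      ho.2 rfl
    have hmesh' : ∀ n' (_ : 0 < n') (hn : n' ≤ k) (t : Fin n' → ℕ × ℕ × ℕ), (∀ i, t i ∈ Prog.mesh N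
        (K.meshBound k ε)) → ¬K.Accepts k ε s (meshMixture (1 / N) (K.meshBound k ε) n' t) := by
      intro n' h0 hn'
      obtain ⟨l, rfl⟩ : ∃ l, n' = l + 1 := ⟨n' - 1, by omega⟩
      exact hmesh l hn'
    refine hmesh' H.size hHpos hHk t ht ⟨⟨fun i => ⟨?_, ?_, ?_, ?_⟩, htsum, fun i j hij => ?_⟩,
      fun j hj => ?_⟩
    · have h1 := htw' i
      have h2 := hHweight i
      change _ ≤ ((t i).1 : ℝ) * (1 / N)
      linarith
    · have h1 := htμ i
      have h2 := hHμ i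
      change |((t i).2.1 - K.meshBound k ε : ℝ) * (1 / N)| ≤ B
      have h3 := abs_sub_abs_le_abs_sub (((t i).2.1 - K.meshBound k ε : ℝ) * (1 / N)) (H.comp i).mean
      linarith
    · have h1 := (abs_le.1 (htv i).2).2
      have h2 := (hHv i).2
      change ((t i).2.2 : ℝ) * (1 / N) ≤ B
      linarith
    · exact (hHv i).1.trans_le (htv i).1
    · have h1 := hHsep i j hij
      have h2 : ∀ i, paramDist (H.comp i)
          ((meshMixture (1 / N) (K.meshBound k ε) H.size t).comp i) ≤ 2 * (1 / N) := fun i => by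
        unfold paramDist
        rw [abs_sub_comm, abs_sub_comm (H.comp i).var]
        have := htμ i
        have := (htv i).2
        simp only [meshMixture]
        linarith
      have h3 := paramDist_triangle (H.comp i)
        ((meshMixture (1 / N) (K.meshBound k ε) H.size t).comp i) (H.comp j)
      have h4 := paramDist_triangle ((meshMixture (1 / N) (K.meshBound k ε) H.size t).comp i)
        ((meshMixture (1 / N) (K.meshBound k ε) H.size t).comp j) (H.comp j)
      have h5 := h2 i
      have h6 := h2 j
      rw [paramDist_comm] at h6
      linarith
    · have h1 := hHs (j + 1) (by omega) (by omega)
      have h2 := Mixture.abs_moment_sub_le (a := H.size / N) (b := 2 / N) (by linarith) hB1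
        (hD (j + 1) (by omega) B hB1) H.comp
        (meshMixture (1 / N) (K.meshBound k ε) H.size t).comp (fun i => hε.le.trans (hHweight i))
        hHsum (fun i => ⟨by linarith [hHμ i],
          habs (by linarith [(hHv i).1]) (by linarith [(hHv i).2])⟩) (fun i => ⟨?_, ?_⟩) htw
        fun i => ?_
      · have hks : (H.size : ℝ) ≤ k := by exact_mod_cast hHk
        have h3 : X * (H.size * (H.size / N) + 2 / N) ≤ X * ((k ^ 2 + 2) / N) := by
          refine mul_le_mul_of_nonneg_left ?_ hXpos.le
          rw [mul_div_assoc', ← add_div]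
          gcongr
          nlinarith
        have h4 := abs_sub_le (Mixture.moment (meshMixture (1 / N) (K.meshBound k ε) H.size t) (j + 1))
          (H.moment (j + 1)) (s (j + 1))
        have h5 := h2.trans (h3.trans hNα)
        change |Mixture.moment (meshMixture (1 / N) (K.meshBound k ε) H.size t) (j + 1) -
          H.moment (j + 1)| ≤ _ at h5
        linarith
      · have h1 := htμ i
        have h2 := hHμ i
        change |((t i).2.1 - K.meshBound k ε : ℝ) * (1 / N)| ≤ B
        have h3 := abs_sub_abs_le_abs_sub (((t i).2.1 - K.meshBound k ε : ℝ) * (1 / N)) (H.comp i).mean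
        linarith
      · have h1 := (abs_le.1 (htv i).2).2
        have h2 := hHv i
        change |((t i).2.2 : ℝ) * (1 / N)| ≤ B
        exact habs (by positivity) (by linarith)
      · unfold paramDist
        rw [abs_sub_comm, abs_sub_comm (H.comp i).var]
        have := htμ i
        have := (htv i).2
        simp only [meshMixture]
        rw [show (2 : ℝ) / N = 2 * (1 / N) by ring]
        linarith
  obtain ⟨hGk, hadm, hacc⟩ := ho.1 G rfl
  have h4ε : 1 / (ε / 4) = 4 * (1 / ε) := by field_simp
  -- Any accepted G has moments within 2 α of those of H, so identifiability matches G with H, even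
  -- if G is not the mesh point found above. The precision ε / 4 leaves room for the distance r ≤ ε
  -- / 2 between F and H.
  obtain ⟨τ, hτ, hτd⟩ := he (ε / 4) (by positivity) (by linarith) H G hHk hGk
    ⟨fun i => by linarith [hHweight i], hHsum, fun i => by rw [h4ε]; linarith [hHμ i],
      fun i => by
        rw [h4ε, abs_of_nonneg (by linarith [(hHv i).1])]; linarith [(hHv i).2],
      fun i j hij => by linarith [hHsep i j hij]⟩
    ⟨fun i => by linarith [(hadm.each i).1], hadm.sum,
      fun i => by rw [h4ε]; linarith [(hadm.each i).2.1, hBε],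
      fun i => by
        rw [h4ε, abs_of_nonneg (by linarith [(hadm.each i).2.2.2])]
        linarith [(hadm.each i).2.2.1, hBε],
      fun i j hij => by linarith [hadm.sep i j hij]⟩ fun j hj => by
      rcases Nat.eq_zero_or_pos j with rfl | hj0
      · rw [Mixture.moment_zero, Mixture.moment_zero, hHsum, hadm.sum]
        simp only [sub_self, abs_zero]; positivity
      · obtain ⟨l, rfl⟩ : ∃ l, j = l + 1 := ⟨j - 1, by omega⟩
        have h1 := hHs (l + 1) hj0 hj
        have h2 := hacc l (by omega)
        have h3 := abs_sub_le (H.moment (l + 1)) (s (l + 1)) (G.moment (l + 1))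
        rw [abs_sub_comm (s _)] at h3
        linarith
  refine ⟨G, rfl, τ ∘ ρ, hτ.2.comp hρ, fun a b => ?_, fun j => ?_, fun i => ?_⟩
  · rw [Function.comp, Function.comp, hτ.1.eq_iff, hρr]
  · obtain ⟨l, rfl⟩ := hτ.2 j
    have h1 := (hτd l).1
    have h2 : ∑ i with (τ ∘ ρ) i = τ l, (F.comp i).weight = (H.comp l).weight := by
      rw [hHw]
      congr 1
      ext i
      simp [hτ.1.eq_iff]
    rw [h2]
    linarith
  · have h1 := (hτd (ρ i)).2
    have h2 := paramDist_triangle (F.comp i) (H.comp (ρ i)) (G.comp (τ (ρ i)))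
    have h3 := hρd i
    change paramDist _ (G.comp (τ (ρ i))) ≤ ε
    linarith

/-! ### Subdivisions and chains. -/

theorem IsCorrectSubdivision.mono {ε ε' : ℝ} {F G : Mixture} (h : IsCorrectSubdivision ε F G)
    (hε : ε ≤ ε') : IsCorrectSubdivision ε' F G := by
  obtain ⟨h1, π, h2, h3, h4⟩ := h
  exact ⟨h1, π, h2, fun j => (h3 j).trans hε, fun i => (h4 i).trans hε⟩

theorem Finset.abs_sum_fiber_sub_le {n m : ℕ} {f g : Fin n → ℝ} {e : ℝ} {k : ℕ} (hn : n ≤ k)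
    (h : ∀ i, |f i - g i| ≤ e) (he : 0 ≤ e) (σ : Fin n → Fin m) (j : Fin m) :
    |∑ i with σ i = j, f i - ∑ i with σ i = j, g i| ≤ k * e := by
  rw [← Finset.sum_sub_distrib]
  calc _ ≤ ∑ i with σ i = j, |f i - g i| := Finset.abs_sum_le_sum_abs _ _
    _ ≤ ∑ i, |f i - g i| := Finset.sum_le_sum_of_subset_of_nonneg (Finset.filter_subset _ _)
        fun i _ _ => abs_nonneg _
    _ ≤ ∑ i : Fin n, e := Finset.sum_le_sum fun i _ => h i
    _ ≤ k * e := by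
        rw [Finset.sum_const, Finset.card_univ, Fintype.card_fin, nsmul_eq_mul]
        gcongr

theorem Finset.sum_comp_fiber {n m l : ℕ} (f : Fin n → ℝ) (π : Fin n → Fin m) (σ : Fin m → Fin l)
    (j : Fin l) : ∑ i with σ (π i) = j, f i = ∑ a with σ a = j, ∑ i with π i = a, f i := by
  rw [Finset.sum_fiberwise_eq_sum_filter]
  congr 1
  ext i
  simp

/-- The factor k is due to the weights: up to k components of G, each with a weight error e, may be
merged into one component of H. -/
theorem IsCorrectSubdivision.trans {k : ℕ} {e η : ℝ} (he : 0 ≤ e) (hk : 1 ≤ k) {F G H : Mixture}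
    (hG : G.size ≤ k) (h : IsCorrectSubdivision e F G) (h' : IsCorrectSubdivision η G H) :
    IsCorrectSubdivision (k * e + η) F H := by
  obtain ⟨h1, π, h2, h3, h4⟩ := h
  obtain ⟨h1', σ, h2', h3', h4'⟩ := h'
  have hk' : (1 : ℝ) ≤ k := by exact_mod_cast hk
  refine ⟨h1'.trans h1, σ ∘ π, h2'.comp h2, fun j => ?_, fun i => ?_⟩
  · have h5 := Finset.abs_sum_fiber_sub_le hG h3 he σ j
    rw [← Finset.sum_comp_fiber] at h5
    exact (abs_sub_le _ _ _).trans (add_le_add h5 (h3' j))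
  · have h5 := paramDist_triangle (F.comp i) (G.comp (π i)) (H.comp (σ (π i)))
    have h6 := h4 i
    have h7 := h4' (π i)
    change paramDist _ (H.comp (σ (π i))) ≤ _
    nlinarith

/-- Of two subdivisions of `F`, the one with the coarser partition is a subdivision of the other. -/
theorem isCorrectSubdivision_of_factor {k : ℕ} {e : ℝ} (he : 0 ≤ e) (hk : 1 ≤ k) {F G H : Mixture}
    (hG : G.size ≤ k) {π : Fin F.size → Fin G.size} {τ : Fin F.size → Fin H.size}
    (hπ : Function.Surjective π) (hτ : Function.Surjective τ) (hπτ : ∀ a b, π a = π b → τ a = τ b)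
    (hwG : ∀ j, |∑ i with π i = j, (F.comp i).weight - (G.comp j).weight| ≤ e)
    (hdG : ∀ i, paramDist (F.comp i) (G.comp (π i)) ≤ e)
    (hwH : ∀ j, |∑ i with τ i = j, (F.comp i).weight - (H.comp j).weight| ≤ e)
    (hdH : ∀ i, paramDist (F.comp i) (H.comp (τ i)) ≤ e) :
    IsCorrectSubdivision (2 * k * e) G H := by
  have hk' : (1 : ℝ) ≤ k := by exact_mod_cast hk
  -- Since τ is constant on the fibres of π, it factors through π, and any section of π gives the
  -- factor.
  choose sec hsec using fun j => hπ j
  set σ : Fin G.size → Fin H.size := fun a => τ (sec a) with hσ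
  have hστ : ∀ i, σ (π i) = τ i := fun i => hπτ _ _ (hsec _)
  have hσs : Function.Surjective σ := fun j => by
    obtain ⟨i, rfl⟩ := hτ j
    exact ⟨π i, hστ i⟩
  refine ⟨by simpa using Fintype.card_le_of_surjective σ hσs, σ, hσs, fun j => ?_, fun a => ?_⟩
  · have h5 := Finset.abs_sum_fiber_sub_le hG (fun i => (abs_sub_comm _ _).trans_le (hwG i)) he σ j
    rw [← Finset.sum_comp_fiber] at h5
    simp only [hστ] at h5
    have h6 := (abs_sub_le _ _ _).trans (add_le_add h5 (hwH j))
    nlinarith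
  · have h5 := paramDist_triangle (G.comp a) (F.comp (sec a)) (H.comp (σ a))
    have h6 := hdG (sec a)
    rw [hsec, paramDist_comm] at h6
    have h7 := hdH (sec a)
    change paramDist _ (H.comp (τ (sec a))) ≤ _ at h7
    change paramDist _ (H.comp (τ (sec a))) ≤ _ at h5
    change paramDist _ (H.comp (τ (sec a))) ≤ _
    nlinarith

section chain

variable {n : ℕ} {η : ℝ} {est : Fin n → Option Mixture} {T : Fin n → Bool}

theorem exists_chainValue_some : ∀ (l : List (Fin n)) (F : Mixture),
    (∀ i ∈ l, T i → ∃ G, est i = some G ∧ IsCorrectSubdivision η F G) →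
    l.Pairwise (fun i j => T i → T j → ∀ G H, est i = some G → est j = some H →
      IsCorrectSubdivision η G H) → ∃ G, chainValue η est T l (some F) = some G
  | [], F, _, _ => ⟨F, rfl⟩
  | i :: l, F, h, hp => by
    rw [List.pairwise_cons] at hp
    rw [chainValue_cons]
    by_cases hT : T i = true
    · rw [if_pos hT]
      obtain ⟨G, hG, hs⟩ := h i (by simp) hT
      rw [hG]
      simp only [if_pos hs]
      refine exists_chainValue_some l G (fun j hj hTj => ?_) hp.2
      obtain ⟨H, hH, _⟩ := h j (by simp [hj]) hTj
      exact ⟨H, hH, hp.1 j hj hT hTj G H hG hH⟩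
    · rw [if_neg hT]
      exact exists_chainValue_some l F (fun j hj => h j (by simp [hj])) hp.2

theorem exists_chainValue_none : ∀ (l : List (Fin n)), (∃ i ∈ l, T i) →
    (∀ i ∈ l, T i → ∃ G, est i = some G) →
    l.Pairwise (fun i j => T i → T j → ∀ G H, est i = some G → est j = some H →
      IsCorrectSubdivision η G H) → ∃ G, chainValue η est T l none = some G
  | [], h, _, _ => by simp at h
  | i :: l, h0, h, hp => by
    rw [List.pairwise_cons] at hp
    rw [chainValue_cons]
    by_cases hT : T i = true
    · rw [if_pos hT]
      obtain ⟨G, hG⟩ := h i (by simp) hT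
      rw [hG]
      refine exists_chainValue_some l G (fun j hj hTj => ?_) hp.2
      obtain ⟨H, hH⟩ := h j (by simp [hj]) hTj
      exact ⟨H, hH, hp.1 j hj hT hTj G H hG hH⟩
    · rw [if_neg hT]
      refine exists_chainValue_none l ?_ (fun j hj => h j (by simp [hj])) hp.2
      obtain ⟨j, hj, hTj⟩ := h0
      rcases List.mem_cons.1 hj with rfl | hj
      · exact absurd hTj hT
      · exact ⟨j, hj, hTj⟩

/-- A selected index with no estimate, or with a failing test, aborts the whole computation. A
successful chain can therefore be restarted at any selected index. -/
theorem chainValue_append {i : Fin n} (hT : T i) (l₂ : List (Fin n)) {R : Mixture} :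
    ∀ (l₁ : List (Fin n)) (prev : Option Mixture),
    chainValue η est T (l₁ ++ i :: l₂) prev = some R →
    ∃ G, est i = some G ∧ chainValue η est T l₂ (some G) = some R
  | [], prev, h => by
    rw [List.nil_append, chainValue_cons, if_pos hT] at h
    rcases hi : est i with _ | G
    · rw [hi] at h; simp at h
    · rw [hi] at h
      refine ⟨G, rfl, ?_⟩
      rcases prev with _ | F
      · exact h
      · simp only at h
        split_ifs at h
        exact h
  | j :: l₁, prev, h => by
    rw [List.cons_append, chainValue_cons] at h
    split_ifs at h
    · rcases hj : est j with _ | G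
      · rw [hj] at h; simp at h
      · rw [hj] at h
        rcases prev with _ | F
        · exact chainValue_append hT l₂ l₁ _ h
        · simp only at h
          split_ifs at h
          exact chainValue_append hT l₂ l₁ _ h
    · exact chainValue_append hT l₂ l₁ _ h

/-- One link turns an error x e₁ with x ≥ 1 into k x e₁ + 2 k e₁ ≤ 3 k x e₁. Nothing is assumed
about the quality of the later runs, since the algorithm has tested the links itself. The exponent
also counts skipped indices, which only weakens the bound. -/
theorem isCorrectSubdivision_chainValue {k : ℕ} (hk : 1 ≤ k) {e₁ : ℝ} (he₁ : 0 ≤ e₁)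
    (hest : ∀ i G, est i = some G → G.size ≤ k) {F R : Mixture} :
    ∀ (l : List (Fin n)) (G : Mixture) (t : ℕ), G.size ≤ k →
    IsCorrectSubdivision ((3 * k) ^ t * e₁) F G →
    chainValue (2 * k * e₁) est T l (some G) = some R →
    IsCorrectSubdivision ((3 * k) ^ (t + l.length) * e₁) F R
  | [], G, t, _, hFG, h => by
    have : G = R := by simpa [chainValue] using h
    subst this
    exact hFG
  | i :: l, G, t, hG, hFG, h => by
    have hk' : (1 : ℝ) ≤ k := by exact_mod_cast hk
    have h3k : (1 : ℝ) ≤ (3 * k) ^ t := one_le_pow₀ (by linarith)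
    rw [chainValue_cons] at h
    rw [List.length_cons, show t + (l.length + 1) = t + 1 + l.length by ring]
    split_ifs at h with hT
    · rcases hi : est i with _ | H
      · rw [hi] at h; simp at h
      · rw [hi] at h
        simp only at h
        split_ifs at h with hGH
        refine isCorrectSubdivision_chainValue hk he₁ hest l H (t + 1) (hest i H hi)
          ((hFG.trans (by positivity) hk hG hGH).mono ?_) h
        rw [pow_succ]
        have : (k : ℝ) * e₁ ≤ (3 * k) ^ t * (k * e₁) := le_mul_of_one_le_left (by positivity) h3k
        linarith
    · refine isCorrectSubdivision_chainValue hk he₁ hest l G (t + 1) hG (hFG.mono ?_) h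
      gcongr
      · linarith
      · omega

end chain

/-! ### The majority argument. -/

/-- The requirements on a precision `ε` and the lower end `r` of its window under which the Basic
Univariate Algorithm succeeds when no distance lies in the window. -/
structure Constants.IsFine (K : Constants) (k e : ℕ) (D ε r : ℝ) : Prop where
  pos : 0 < ε
  le_one : ε ≤ 1
  r_pos : 0 < r
  r_le : 2 * r ≤ ε
  accuracy_le : 2 * K.accuracy ε ≤ (ε / 4) ^ e
  mul_r_le : D * (2 / ε) ^ (4 * k - 2) * r ≤ K.accuracy ε / 4
  le_meshInv : 8 / ε ≤ K.meshInv k ε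
  div_meshInv_le :
    D * (2 / ε) ^ (4 * k - 2) * ((k ^ 2 + 2) / K.meshInv k ε) ≤ K.accuracy ε / 4

/-- Only a minority of disjoint windows contain a distance between components. -/
theorem two_mul_card_windows_lt {k : ℕ} (hk : 1 ≤ k) {F : Mixture} (hF : F.size ≤ k)
    {W : ℕ → Set ℝ} (hW : ∀ i < k ^ 2, ∀ j < k ^ 2, i ≠ j → Disjoint (W i) (W j))
    [DecidablePred fun i => ∃ a b, a ≠ b ∧ paramDist (F.comp a) (F.comp b) ∈ W i] :
    2 * ((Finset.range (k ^ 2)).filter fun i =>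
      ∃ a b, a ≠ b ∧ paramDist (F.comp a) (F.comp b) ∈ W i).card < k ^ 2 := by
  classical
  -- Counting unordered pairs matters: there are at most k (k - 1) / 2 < k² / 2 of them, so the good
  -- windows are a majority.
  let d : {s : Sym2 (Fin F.size) // ¬s.IsDiag} → ℝ := fun s =>
    Sym2.lift ⟨fun a b => paramDist (F.comp a) (F.comp b), fun a b => paramDist_comm _ _⟩ s.1
  have h := card_filter_windows_le d W (k ^ 2) hW
  rw [Sym2.card_subtype_not_diag, Fintype.card_fin] at h
  have h2 : ((Finset.range (k ^ 2)).filter fun i =>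
      ∃ a b, a ≠ b ∧ paramDist (F.comp a) (F.comp b) ∈ W i).card ≤
      ((Finset.range (k ^ 2)).filter fun i => ∃ s, d s ∈ W i).card := by
    refine Finset.card_le_card fun i hi => ?_
    simp only [Finset.mem_filter] at hi ⊢
    obtain ⟨hi, a, b, hab, hW⟩ := hi
    exact ⟨hi, ⟨s(a, b), by simpa using hab⟩, hW⟩
  have h3 : F.size.choose 2 ≤ k.choose 2 := Nat.choose_le_choose 2 hF
  have h4 : 2 * k.choose 2 ≤ k * (k - 1) := by
    rw [Nat.choose_two_right]; omega
  have h5 : k * (k - 1) < k ^ 2 := by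
    rw [pow_two]; exact Nat.mul_lt_mul_of_pos_left (by omega) (by omega)
  omega

/-- If all the sample moments are accurate, a majority of the runs gives a correct chain, and the
last estimate of every correct chain of a majority is a correct subdivision. -/
theorem chainValue_of_accurate (K : Constants) {k : ℕ} (hk : 1 ≤ k) {e : ℕ}
    (he : ∀ θ : ℝ, 0 < θ → θ ≤ 1 / 2 → ∀ F G : Mixture,
      F.size ≤ k → G.size ≤ k → F.IsSeparated θ → G.IsSeparated θ →
      (∀ j ≤ 4 * k - 2, |F.moment j - G.moment j| ≤ θ ^ e) →
      ∃ π : Fin F.size → Fin G.size, Function.Bijective π ∧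
        ∀ i, |(F.comp i).weight - (G.comp (π i)).weight| ≤ θ ∧
          paramDist (F.comp i) (G.comp (π i)) ≤ θ) {D : ℝ} (hD1 : 1 ≤ D)
    (hD : ∀ j ≤ 4 * k - 2, ∀ B : ℝ, 1 ≤ B →
      (∀ μ v, |μ| ≤ B → |v| ≤ B → |gaussMoment μ v j| ≤ D * B ^ (4 * k - 2)) ∧
      ∀ μ v μ' v', |μ| ≤ B → |v| ≤ B → |μ'| ≤ B → |v'| ≤ B →
        |gaussMoment μ v j - gaussMoment μ' v' j| ≤
          D * B ^ (4 * k - 2) * (|μ - μ'| + |v - v'|))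
    {p r : ℕ → ℝ} (hp : ∀ i, p i ≤ p 0) (hr : Antitone r)
    (hfine : ∀ i < k ^ 2, K.IsFine k e D (p i) (r i))
    (hdisj : ∀ i < k ^ 2, ∀ j < k ^ 2, i ≠ j → Disjoint (Set.Icc (r i) (p i)) (Set.Icc (r j) (p j)))
    {F : Mixture} (hFk : F.size ≤ k) (hw : ∀ i, p 0 ≤ (F.comp i).weight)
    (hsum : ∑ i, (F.comp i).weight = 1) (hμ : ∀ i, |(F.comp i).mean| ≤ 1 / p 0)
    (hv : ∀ i, 1 / 2 < (F.comp i).var ∧ (F.comp i).var ≤ 1 / p 0)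
    {s : ℕ → ℕ → ℝ} (hs : ∀ i < k ^ 2, ∀ j, 1 ≤ j → j ≤ 4 * k - 2 →
      |F.moment j - s i j| ≤ K.accuracy (p i) / 4)
    {est : Fin (k ^ 2) → Option Mixture}
    (hest : ∀ i : Fin (k ^ 2), K.IsBasicResult k (p i) (s i) (est i)) :
    (∃ T, Prog.IsMajority k T ∧ ∃ G, chainValue (2 * k * p 0) est T
        (List.finRange (k ^ 2)).reverse none = some G) ∧
      ∀ T G, Prog.IsMajority k T →
        chainValue (2 * k * p 0) est T (List.finRange (k ^ 2)).reverse none = some G →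
        IsCorrectSubdivision ((3 * k) ^ k ^ 2 * p 0) F G ∧ ∃ i, est i = some G := by
  classical
  have hk2 : 0 < k ^ 2 := by positivity
  have hp0 : 0 < p 0 := (hfine 0 hk2).pos
  have hk' : (1 : ℝ) ≤ k := by exact_mod_cast hk
  set bad : ℕ → Prop := fun i => ∃ a b, a ≠ b ∧ paramDist (F.comp a) (F.comp b) ∈
    Set.Icc (r i) (p i) with hbad
  have hcard : ∑ i : Fin (k ^ 2), (if bad i then (1 : ℝ) else 0) < (k : ℝ) ^ 2 / 2 := by
    have h := two_mul_card_windows_lt hk hFk hdisj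
    rw [Fin.sum_univ_eq_sum_range (fun i => if bad i then (1 : ℝ) else 0), Finset.sum_boole]
    have h' : (2 : ℝ) * ((Finset.range (k ^ 2)).filter bad).card < (k : ℝ) ^ 2 := by
      exact_mod_cast h
    linarith
  have hgood : ∀ i : Fin (k ^ 2), ¬bad i → ∃ G, est i = some G ∧
      ∃ π : Fin F.size → Fin G.size, Function.Surjective π ∧
      (∀ a b, π a = π b ↔ paramDist (F.comp a) (F.comp b) < r i) ∧
      (∀ j, |∑ l with π l = j, (F.comp l).weight - (G.comp j).weight| ≤ p i) ∧
      ∀ l, paramDist (F.comp l) (G.comp (π l)) ≤ p i := by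
    intro i hi
    have hf := hfine i i.2
    have hinv : 1 / p 0 ≤ 1 / p i := one_div_le_one_div_of_le hf.pos (hp i)
    refine Constants.IsBasicResult.exists_of_gap K k he hD1 hD hf.pos hf.le_one hf.r_pos hf.r_le
      hf.accuracy_le hf.mul_r_le hf.le_meshInv hf.div_meshInv_le hFk (fun l => (hp i).trans (hw l))
      hsum (fun l => (hμ l).trans hinv) (fun l => ⟨(hv l).1, (hv l).2.trans hinv⟩)
      (fun a b => ?_) (hs i i.2) (hest i)
    by_cases hab : a = b
    · left; rw [hab, paramDist_self]; exact hf.r_pos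
    · by_contra hcon
      push Not at hcon
      exact hi ⟨a, b, hab, hcon⟩
  -- The finer run i groups the components closer than r i, and r i ≤ r j. Its partition thus
  -- refines that of run j, and the latter factors through it.
  have hchain : ∀ i j : Fin (k ^ 2), j ≤ i → ¬bad i → ¬bad j → ∀ G H, est i = some G →
      est j = some H → IsCorrectSubdivision (2 * k * p 0) G H := by
    intro i j hij hi hj G H hG hH
    obtain ⟨G', hG', π, hπ, hπr, hπw, hπd⟩ := hgood i hi
    obtain ⟨H', hH', τ, hτ, hτr, hτw, hτd⟩ := hgood j hj
    obtain rfl : G = G' := Option.some.inj (hG.symm.trans hG')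
    obtain rfl : H = H' := Option.some.inj (hH.symm.trans hH')
    exact isCorrectSubdivision_of_factor hp0.le hk ((hest i).1 G hG).1 hπ hτ
      (fun a b hab => (hτr a b).2 (((hπr a b).1 hab).trans_le (hr hij)))
      (fun l => (hπw l).trans (hp i)) (fun l => (hπd l).trans (hp i))
      (fun l => (hτw l).trans (hp j)) (fun l => (hτd l).trans (hp j))
  -- The set of all good runs is the majority that forms a chain.
  refine ⟨⟨fun i => decide (¬bad i), ?_, ?_⟩, fun T G hT hG => ?_⟩
  · unfold Prog.IsMajority
    have h1 : ∑ i : Fin (k ^ 2), (if bad i then (1 : ℝ) else 0) +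
        ∑ i : Fin (k ^ 2), (if decide (¬bad i) = true then (1 : ℝ) else 0) = (k : ℝ) ^ 2 := by
      rw [← Finset.sum_add_distrib]
      calc _ = ∑ _i : Fin (k ^ 2), (1 : ℝ) := Finset.sum_congr rfl fun i _ => by
            by_cases h : bad i <;> simp [h]
        _ = _ := by simp
    linarith
  · refine exists_chainValue_none _ ?_ (fun i _ hi => ?_) ?_
    · by_contra hcon
      push Not at hcon
      have : ∑ i : Fin (k ^ 2), (if bad i then (1 : ℝ) else 0) = (k : ℝ) ^ 2 := by
        calc _ = ∑ _i : Fin (k ^ 2), (1 : ℝ) := Finset.sum_congr rfl fun i _ => by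
              have hi : bad i := by simpa using hcon i (by simp)
              rw [if_pos hi]
          _ = _ := by simp
      have h2 : (0 : ℝ) < (k : ℝ) ^ 2 := by positivity
      linarith
    · obtain ⟨G, hG, _⟩ := hgood i (by simpa using hi)
      exact ⟨G, hG⟩
    · rw [List.pairwise_reverse]
      exact (List.pairwise_lt_finRange _).imp fun {j i} hji hi hj G H hG hH =>
        hchain i j hji.le (by simpa using hi) (by simpa using hj) G H hG hH
  -- The bad runs are less than half, so every majority contains a good one. The chain is followed
  -- from its estimate onwards; what comes before is irrelevant.
  · obtain ⟨i, hi, hTi⟩ : ∃ i : Fin (k ^ 2), ¬bad i ∧ T i = true := by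
      by_contra hcon
      push Not at hcon
      have : ∑ i, (if T i = true then (1 : ℝ) else 0) ≤
          ∑ i : Fin (k ^ 2), (if bad i then (1 : ℝ) else 0) := by
        refine Finset.sum_le_sum fun i _ => ?_
        by_cases h : bad i
        · rw [if_pos h]; split_ifs <;> simp
        · rw [if_neg (hcon i h), if_neg h]
      unfold Prog.IsMajority at hT
      linarith
    obtain ⟨l₁, l₂, hl⟩ := List.append_of_mem (List.mem_reverse.2 (List.mem_finRange i))
    have hlen : l₂.length ≤ k ^ 2 := by
      have := congrArg List.length hl
      simp at this
      omega
    refine ⟨?_, ?_⟩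
    · rw [hl] at hG
      obtain ⟨G', hG', hR⟩ := chainValue_append hTi l₂ l₁ none hG
      obtain ⟨G'', hG'', π, hπ, hπr, hπw, hπd⟩ := hgood i hi
      obtain rfl : G' = G'' := Option.some.inj (hG'.symm.trans hG'')
      refine (isCorrectSubdivision_chainValue hk hp0.le (fun i G h => ((hest i).1 G h).1) l₂ G' 0
        ((hest i).1 G' hG').1 ⟨?_, π, hπ, fun l => ?_, fun l => ?_⟩ hR).mono ?_
      · simpa using Fintype.card_le_of_surjective π hπ
      · rw [pow_zero, one_mul]; exact (hπw l).trans (hp i)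
      · rw [pow_zero, one_mul]; exact (hπd l).trans (hp i)
      · gcongr
        · linarith
        · omega
    · rcases chainValue_mem _ _ _ _ _ _ hG with h | h
      · simp at h
      · exact h

/-! ### Choice of the constants, and disjointness of the windows. -/

namespace Constants

/-- A choice of the constants. -/
theorem exists_isFine (k : ℕ) (hk : 1 ≤ k) (e : ℕ) {D D' : ℝ} (hD : 1 ≤ D) (hD' : 1 ≤ D') :
    ∃ K : Constants, K.Cchain = 2 ∧ K.C = 4 * 3 ^ k ^ 2 ∧
      ∀ ε δ : ℝ, 0 < ε → ε ≤ 1 → 0 < δ → δ ≤ 1 → K.IsFine k e D ε (K.R k ε δ) ∧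
        0 < K.S k ε δ ∧ K.S k ε δ < K.R k ε δ ∧
        D' * (1 / ε) ^ (2 * (4 * k - 2)) / (K.numSamples ε δ * (K.accuracy ε / 4) ^ 2) *
          (4 * k - 2 : ℕ) ≤ δ := by
  have hk' : (1 : ℝ) ≤ k := by exact_mod_cast hk
  set m := 4 * k - 2 with hm
  have hm1 : 1 ≤ m := by omega
  have hm' : (1 : ℝ) ≤ m := by exact_mod_cast hm1
  have hm2 : 4 * k - 1 = m + 1 := by omega
  set ca : ℝ := (1 / 4) ^ e / 2 with hca
  have hca0 : 0 < ca := by positivity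
  have hca1 : ca ≤ 1 := by
    have : ((1 : ℝ) / 4) ^ e ≤ 1 := pow_le_one₀ (by norm_num) (by norm_num)
    rw [hca]; linarith
  -- The three terms serve 2 * r ≤ ε, the change of the moments when components at distance below r
  -- are merged, and Chebyshev's inequality.
  set CB : ℝ := 2 + 4 * D * 2 ^ m / ca + 16 * D' * m / ca ^ 2 with hCB
  -- The first term makes the mesh finer than ε / 8, the second one bounds the error in the moments
  -- caused by rounding to the mesh.
  set cg : ℝ := 8 + 4 * D * 2 ^ m * (k ^ 2 + 2) with hcg
  have hCB2 : 2 ≤ CB := by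
    have h1 : 0 ≤ 4 * D * 2 ^ m / ca := by positivity
    have h2 : 0 ≤ 16 * D' * m / ca ^ 2 := by positivity
    linarith
  have hCBa : 4 * D * 2 ^ m ≤ CB * ca := by
    rw [← div_le_iff₀ hca0]
    have h2 : 0 ≤ 16 * D' * m / ca ^ 2 := by positivity
    linarith
  have hCBb : 16 * D' * m ≤ CB * ca ^ 2 := by
    rw [← div_le_iff₀ (by positivity)]
    have h1 : 0 ≤ 4 * D * 2 ^ m / ca := by positivity
    linarith
  have hcg8 : 8 ≤ cg := by
    have h1 : 0 ≤ 4 * D * 2 ^ m * ((k : ℝ) ^ 2 + 2) := by positivity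
    linarith
  -- The exponent 2 * m + 2 * e + 3 exceeds 2 * m + 2 * (e + 1), the power of ε in Chebyshev's
  -- inequality with accuracy of order ε ^ (e + 1). The value 2 for `C₂` makes S strictly less than
  -- R, which separates consecutive windows.
  refine ⟨⟨4 * 3 ^ k ^ 2, CB, 2 * m + 2 * e + 3, 1, 2, 2, ca, e + 1, cg, by positivity, by linarith,
    by norm_num, by norm_num, by norm_num, hca0, by linarith⟩, rfl, rfl, fun ε δ hε hε1 hδ hδ1 => ?_⟩
  set K : Constants := ⟨4 * 3 ^ k ^ 2, CB, 2 * m + 2 * e + 3, 1, 2, 2, ca, e + 1, cg, by positivity,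
    by linarith, by norm_num, by norm_num, by norm_num, hca0, by linarith⟩ with hK
  set α := K.accuracy ε with hα
  have hαeq : α = ca * ε ^ (e + 1) := rfl
  have hα0 : 0 < α := by rw [hαeq]; positivity
  have hαε : α ≤ ε := by
    rw [hαeq, pow_succ, ← mul_assoc]
    exact mul_le_of_le_one_left hε.le (mul_le_one₀ hca1 (by positivity) (pow_le_one₀ hε.le hε1))
  set x := (ε * δ) ^ (2 * m + 2 * e + 3) with hx
  have hx0 : 0 < x := by positivity
  have hxle : ∀ a b : ℕ, a ≤ 2 * m + 2 * e + 3 → b ≤ 2 * m + 2 * e + 3 → x ≤ ε ^ a * δ ^ b :=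
    fun a b ha hb => by
      rw [hx, mul_pow]
      exact mul_le_mul (pow_le_pow_of_le_one hε.le hε1 ha) (pow_le_pow_of_le_one hδ.le hδ1 hb)
        (by positivity) (by positivity)
  have hReq : K.R k ε δ = x / CB / (1 * (k : ℝ) ^ 4) := rfl
  have hk4 : (1 : ℝ) ≤ (k : ℝ) ^ 4 := one_le_pow₀ hk'
  have hR0 : 0 < K.R k ε δ := by rw [hReq]; positivity
  have hRx : K.R k ε δ ≤ x / CB := by
    rw [hReq, one_mul]; exact div_le_self (by positivity) hk4
  have hSeq : K.S k ε δ = K.R k ε δ / (2 * (k : ℝ) ^ 4) := rfl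
  have hαpow : α ^ (m + 1) ≤ ε := (pow_le_of_le_one hα0.le (hαε.trans hε1) (by omega)).trans hαε
  have hN : cg / α ^ (m + 1) ≤ K.meshInv k ε := by
    rw [← hm2]; exact Nat.le_ceil _
  have hN0 : (0 : ℝ) < K.meshInv k ε := lt_of_lt_of_le (by positivity) hN
  have hn : CB / x ≤ K.numSamples ε δ := Nat.le_ceil _
  have hn0 : (0 : ℝ) < K.numSamples ε δ := lt_of_lt_of_le (by positivity) hn
  refine ⟨⟨hε, hε1, hR0, ?_, ?_, ?_, ?_, ?_⟩, ?_, ?_, ?_⟩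
  · have h1 := hxle 1 0 (by omega) (by omega)
    rw [pow_one, pow_zero, mul_one] at h1
    have h2 : x / CB ≤ x / 2 := by gcongr
    linarith
  · change 2 * α ≤ _
    rw [hαeq, hca, div_pow, div_pow ε, pow_succ, one_pow]
    have : ε ^ e / 4 ^ e * ε ≤ ε ^ e / 4 ^ e := mul_le_of_le_one_right (by positivity) hε1
    calc _ = ε ^ e / 4 ^ e * ε := by ring
      _ ≤ _ := this
  · have h1 := hxle (m + (e + 1)) 0 (by omega) (by omega)
    rw [pow_zero, mul_one] at h1
    calc D * (2 / ε) ^ m * K.R k ε δ ≤ D * (2 / ε) ^ m * (ε ^ (m + (e + 1)) / CB) := by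
          gcongr
          exact hRx.trans (by gcongr)
      _ = 4 * D * 2 ^ m / CB * ε ^ (e + 1) / 4 := by
          rw [div_pow, pow_add]; field_simp
      _ ≤ ca * ε ^ (e + 1) / 4 := by
          gcongr
          rw [div_le_iff₀ (by linarith)]
          linarith
  · refine le_trans ?_ hN
    exact div_le_div₀ (by linarith) hcg8 (by positivity) hαpow
  · have h1 : D * (2 / ε) ^ m * ((k ^ 2 + 2) / K.meshInv k ε) ≤
        D * (2 / ε) ^ m * ((k ^ 2 + 2) / (cg / α ^ (m + 1))) := by gcongr
    refine h1.trans ?_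
    have h2 : α ^ m ≤ ε ^ m := by gcongr
    calc D * (2 / ε) ^ m * ((k ^ 2 + 2) / (cg / α ^ (m + 1)))
        = (4 * D * 2 ^ m * (k ^ 2 + 2)) / cg * (α ^ m / ε ^ m) * (α / 4) := by
          rw [div_pow, pow_succ α]; field_simp
      _ ≤ 1 * 1 * (α / 4) := by
          have h3 : 4 * D * 2 ^ m * (k ^ 2 + 2) / cg ≤ 1 := by
            rw [div_le_one (by linarith)]; linarith
          have h4 : α ^ m / ε ^ m ≤ 1 := by rwa [div_le_one (by positivity)]
          gcongr
      _ = α / 4 := by ring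
  · rw [hSeq]; positivity
  · rw [hSeq]
    exact div_lt_self hR0 (by linarith)
  · have h1 := hxle (2 * m + (2 * (e + 1))) 1 (by omega) (by omega)
    rw [pow_one] at h1
    have h2 : D' * (1 / ε) ^ (2 * m) / (K.numSamples ε δ * (α / 4) ^ 2) * m ≤
        D' * (1 / ε) ^ (2 * m) / (CB / x * (α / 4) ^ 2) * m := by gcongr
    refine h2.trans ?_
    calc D' * (1 / ε) ^ (2 * m) / (CB / x * (α / 4) ^ 2) * m
        = (16 * D' * m / (CB * ca ^ 2)) * (x / (ε ^ (2 * m + 2 * (e + 1)))) := by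
          rw [hαeq, pow_add ε (2 * m), one_div_pow, mul_comm 2 (e + 1), pow_mul ε (e + 1)]
          have hu : 0 < ε ^ (2 * m) := by positivity
          have hy : 0 < ε ^ (e + 1) := by positivity
          generalize ε ^ (2 * m) = u at hu
          generalize ε ^ (e + 1) = y at hy
          field_simp
          norm_num
      _ ≤ 1 * (ε ^ (2 * m + 2 * (e + 1)) * δ / (ε ^ (2 * m + 2 * (e + 1)))) := by
          have h3 : 16 * D' * m / (CB * ca ^ 2) ≤ 1 := by
            rw [div_le_one (by positivity)]; linarith
          gcongr
      _ = δ := by field_simp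

end Constants

theorem Constants.precision_pos_le {K : Constants} {k : ℕ} {ε δ : ℝ} (h0 : 0 < K.precision k ε δ 0)
    (h1 : K.precision k ε δ 0 ≤ 1)
    (hS : ∀ p, 0 < p → p ≤ 1 → 0 < K.S k p (errorProb k δ) ∧
      K.S k p (errorProb k δ) < K.R k p (errorProb k δ) ∧ K.R k p (errorProb k δ) ≤ p) (i : ℕ) :
    0 < K.precision k ε δ i ∧ K.precision k ε δ i ≤ 1 := by
  induction i with
  | zero => exact ⟨h0, h1⟩
  | succ i ih =>
    obtain ⟨h2, h3, h4⟩ := hS _ ih.1 ih.2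
    exact ⟨h2, (h3.trans_le (h4.trans ih.2)).le⟩

/-- The windows lie below each other. -/
theorem Constants.windows {K : Constants} {k : ℕ} {ε δ : ℝ} (h0 : 0 < K.precision k ε δ 0)
    (h1 : K.precision k ε δ 0 ≤ 1)
    (hS : ∀ p, 0 < p → p ≤ 1 → 0 < K.S k p (errorProb k δ) ∧
      K.S k p (errorProb k δ) < K.R k p (errorProb k δ) ∧ K.R k p (errorProb k δ) ≤ p) :
    Antitone (K.precision k ε δ) ∧
    Antitone (fun i => K.R k (K.precision k ε δ i) (errorProb k δ)) ∧
    (∀ i, (K.window k (K.precision k ε δ i) (errorProb k δ)).Nonempty) ∧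
    ∀ i j, i ≠ j → Disjoint (K.window k (K.precision k ε δ i) (errorProb k δ))
      (K.window k (K.precision k ε δ j) (errorProb k δ)) := by
  have hb := precision_pos_le h0 h1 hS
  have hstep : ∀ i, K.precision k ε δ (i + 1) < K.R k (K.precision k ε δ i) (errorProb k δ) ∧
      K.R k (K.precision k ε δ i) (errorProb k δ) ≤ K.precision k ε δ i :=
    fun i => (hS _ (hb i).1 (hb i).2).2
  have hanti : Antitone (K.precision k ε δ) :=
    antitone_nat_of_succ_le fun i => ((hstep i).1.trans_le (hstep i).2).le
  have hlt : ∀ i j, i < j → Disjoint (K.window k (K.precision k ε δ i) (errorProb k δ))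
      (K.window k (K.precision k ε δ j) (errorProb k δ)) := fun i j hij => by
    refine Set.disjoint_left.2 fun y hy hy' => ?_
    have := hanti (Nat.succ_le_of_lt hij)
    exact absurd (hy.1.trans hy'.2) (not_le.2 (this.trans_lt (hstep i).1))
  refine ⟨hanti, antitone_nat_of_succ_le fun i => (hstep (i + 1)).2.trans (hstep i).1.le,
    fun i => Set.nonempty_Icc.2 (hstep i).2, fun i j hij => ?_⟩
  rcases lt_or_gt_of_ne hij with h | h
  · exact hlt i j h
  · exact (hlt j i h).symm

/-! ### Laws of mixtures, the noise, and accuracy of the sample moments. -/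

namespace Mixture

theorem lintegral_law (F : Mixture) (f : ℝ → ENNReal) :
    ∫⁻ x, f x ∂F.law = ∑ i, ENNReal.ofReal (F.comp i).weight *
      ∫⁻ x, f x ∂gaussianReal (F.comp i).mean (F.comp i).var.toNNReal := by
  unfold law
  rw [lintegral_finsetSum_measure]
  exact Finset.sum_congr rfl fun i _ => by rw [lintegral_smul_measure]; rfl

theorem IsGMM.isProbabilityMeasure {F : Mixture} (hF : F.IsGMM) : IsProbabilityMeasure F.law := by
  constructor
  rw [← lintegral_one, lintegral_law]
  simp only [lintegral_one, measure_univ, mul_one]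
  rw [← ENNReal.ofReal_sum_of_nonneg fun i _ => (hF.1 i).le, hF.2.1, ENNReal.ofReal_one]

theorem integrable_pow_law (F : Mixture) (n : ℕ) : Integrable (fun x => x ^ n) F.law := by
  unfold law
  rw [integrable_finsetSum_measure]
  exact fun i _ => (integrable_pow_gaussianReal _ _ n).smul_measure ENNReal.ofReal_ne_top

theorem IsGMM.integral_pow_law {F : Mixture} (hF : F.IsGMM) (n : ℕ) :
    ∫ x, x ^ n ∂F.law = F.moment n := by
  unfold law moment
  rw [integral_finsetSum_measure fun i _ =>
    (integrable_pow_gaussianReal _ _ n).smul_measure ENNReal.ofReal_ne_top]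
  refine Finset.sum_congr rfl fun i _ => ?_
  rw [integral_smul_measure, integral_pow_gaussianReal, ENNReal.toReal_ofReal (hF.1 i).le,
    Real.coe_toNNReal _ (hF.2.2 i).le, smul_eq_mul]

/-- The mixture of the samples with added noise. -/
noncomputable def noisy (F : Mixture) : Mixture :=
  ⟨F.size, fun i => ⟨(F.comp i).weight, (F.comp i).mean, (F.comp i).var + 1 / 2⟩⟩

theorem IsGMM.noisy {F : Mixture} (hF : F.IsGMM) : F.noisy.IsGMM :=
  ⟨hF.1, hF.2.1, fun i => by have := hF.2.2 i; change 0 < (F.comp i).var + 1 / 2; linarith⟩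

/-- Convolution is linear in the mixture, and variances of Gaussians add. The noise is there to
raise the variances above the lower bound 1/2 imposed in the search. -/
theorem IsGMM.law_conv {F : Mixture} (hF : F.IsGMM) :
    F.law.conv (gaussianReal 0 (1 / 2)) = F.noisy.law := by
  refine Measure.ext_of_lintegral _ fun f hf => ?_
  rw [Measure.lintegral_conv hf, lintegral_law, lintegral_law]
  refine Finset.sum_congr rfl fun i _ => ?_
  rw [← Measure.lintegral_conv hf, gaussianReal_conv_gaussianReal, add_zero]
  have h : (F.comp i).var.toNNReal + 1 / 2 = ((F.comp i).var + 1 / 2).toNNReal := by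
    rw [Real.toNNReal_add (hF.2.2 i).le (by norm_num), Real.toNNReal_div (by norm_num),
      Real.toNNReal_one, Real.toNNReal_ofNat]
  rw [h]
  rfl

/-- The parameters of a mixture in near isotropic position are bounded. -/
theorem IsGMM.param_le {F : Mixture} (hF : F.IsGMM) (hiso : F.NearIsotropic) {ε : ℝ} (hε : 0 < ε)
    (hε1 : ε ≤ 1) (hw : ∀ i, ε ≤ (F.comp i).weight) (i : Fin F.size) :
    |(F.comp i).mean| ≤ 3 / ε ∧ (F.comp i).var ≤ 3 / ε := by
  have := hF.isProbabilityMeasure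
  have hint : MemLp id 2 F.law := by
    rw [memLp_two_iff_integrable_sq measurable_id.aestronglyMeasurable]
    exact F.integrable_pow_law 2
  obtain ⟨h1, _, h2⟩ := hiso
  rw [variance_eq_sub hint] at h2
  have h3 : ∫ x, (id ^ 2 : ℝ → ℝ) x ∂F.law = F.moment 2 := hF.integral_pow_law 2
  rw [h3] at h2
  have h4 : F.moment 2 ≤ 3 := by
    have h5 : (∫ x, x ∂F.law) ^ 2 ≤ 1 := by
      rw [← sq_abs]; exact pow_le_one₀ (abs_nonneg _) h1
    have h6 : (∫ x, id x ∂F.law) ^ 2 ≤ 1 := h5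
    linarith
  -- The second moment is at most 1 + 2. It is a weighted sum of the nonnegative terms μ² + v with
  -- weights at least ε, so no single term can exceed 3 / ε.
  have h5 : ε * ((F.comp i).mean ^ 2 + (F.comp i).var) ≤ 3 := by
    refine le_trans ?_ h4
    unfold moment
    have h6 : ∀ l, gaussMoment (F.comp l).mean (F.comp l).var 2 =
        (F.comp l).mean ^ 2 + (F.comp l).var := fun l => by
      simp [gaussMoment]; ring
    simp only [h6]
    have h7 : ∀ l, 0 ≤ (F.comp l).mean ^ 2 + (F.comp l).var := fun l => by
      have := hF.2.2 l; positivity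
    exact (mul_le_mul_of_nonneg_right (hw i) (h7 i)).trans (Finset.single_le_sum
      (f := fun l => (F.comp l).weight * ((F.comp l).mean ^ 2 + (F.comp l).var))
      (fun l _ => mul_nonneg (hF.1 l).le (h7 l)) (Finset.mem_univ i))
  have hv := hF.2.2 i
  have h6 : (F.comp i).mean ^ 2 + (F.comp i).var ≤ 3 / ε := by
    rw [le_div_iff₀ hε]; linarith
  have h7 : 3 ≤ 3 / ε := by rw [le_div_iff₀ hε]; linarith
  refine ⟨abs_le_of_sq_le_sq ?_ (by linarith), by nlinarith [sq_nonneg (F.comp i).mean]⟩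
  nlinarith

end Mixture

/-- Chebyshev's inequality for sample moments. -/
theorem measure_sampleMoment_le {Ω : Type*} [MeasurableSpace Ω] {P : Measure Ω}
    [IsProbabilityMeasure P] {Y : ℕ → Ω → ℝ} {ν : Measure ℝ} (hY : ∀ n, HasLaw (Y n) ν P)
    (hind : Pairwise fun a b => IndepFun (Y a) (Y b) P) (j : ℕ)
    (hint : Integrable (fun x => x ^ (2 * j)) ν) {V : ℝ} (hV : ∫ x, x ^ (2 * j) ∂ν ≤ V) (o : ℕ)
    {n : ℕ} (hn : 0 < n) {c : ℝ} (hc : 0 < c) :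
    P {ω | c ≤ |sampleMoment (fun t => Y (t + o) ω) n j - ∫ x, x ^ j ∂ν|} ≤
      ENNReal.ofReal (V / (n * c ^ 2)) := by
  have hn' : (0 : ℝ) < n := by exact_mod_cast hn
  have hm : ∀ i : ℕ, Measurable fun x : ℝ => x ^ i := fun i => measurable_id.pow_const i
  have hlp : ∀ a, MemLp (fun ω => Y a ω ^ j) 2 P := fun a => by
    have haem : AEMeasurable (fun ω => Y a ω ^ j) P := (hY a).aemeasurable.pow_const j
    rw [memLp_two_iff_integrable_sq haem.aestronglyMeasurable]
    have h1 : Integrable ((fun x : ℝ => x ^ (2 * j)) ∘ Y a) P := by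
      refine Integrable.comp_aemeasurable ?_ (hY a).aemeasurable
      rw [(hY a).map_eq]; exact hint
    refine h1.congr (Filter.Eventually.of_forall fun ω => ?_)
    change Y a ω ^ (2 * j) = (Y a ω ^ j) ^ 2
    rw [← pow_mul, mul_comm]
  have hmean : ∀ a i : ℕ, ∫ ω, Y a ω ^ i ∂P = ∫ x, x ^ i ∂ν := fun a i => by
    rw [← (hY a).map_eq, integral_map (hY a).aemeasurable (hm i).aestronglyMeasurable]
  have hvar : ∀ a, variance (fun ω => Y a ω ^ j) P ≤ V := fun a => by
    refine (variance_le_expectation_sq (hlp a).1).trans (le_trans (le_of_eq ?_) hV)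
    rw [← hmean a]
    refine integral_congr_ae (Filter.Eventually.of_forall fun ω => ?_)
    change (Y a ω ^ j) ^ 2 = Y a ω ^ (2 * j)
    rw [← pow_mul, mul_comm]
  set S : Ω → ℝ := ∑ t ∈ Finset.range n, fun ω => Y (t + o) ω ^ j with hS
  have hSapp : ∀ ω, S ω = ∑ t ∈ Finset.range n, Y (t + o) ω ^ j := fun ω => by
    rw [hS, Finset.sum_apply]
  have hSlp : MemLp S 2 P := memLp_finsetSum' _ fun t _ => hlp _
  have hSvar : variance S P ≤ n * V := by
    rw [hS, IndepFun.variance_sum (fun t _ => hlp _) fun s _ t _ hst => ?_]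
    · refine (Finset.sum_le_sum fun t _ => hvar _).trans (le_of_eq ?_)
      simp
    · exact (hind (by omega : s + o ≠ t + o)).comp (hm j) (hm j)
  have hA : (fun ω => sampleMoment (fun t => Y (t + o) ω) n j) = fun ω => (n : ℝ)⁻¹ * S ω := by
    funext ω
    rw [hSapp, sampleMoment, div_eq_inv_mul]
  have hAmean : ∫ ω, sampleMoment (fun t => Y (t + o) ω) n j ∂P = ∫ x, x ^ j ∂ν := by
    rw [hA, integral_const_mul]
    simp only [hSapp]
    rw [integral_finsetSum _ fun t _ => (hlp _).integrable (by norm_num)]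
    simp only [hmean]
    rw [Finset.sum_const, Finset.card_range, nsmul_eq_mul, inv_mul_cancel_left₀ hn'.ne']
  have hAvar : variance (fun ω => sampleMoment (fun t => Y (t + o) ω) n j) P ≤ V / n := by
    rw [hA, variance_const_mul]
    calc _ ≤ (n : ℝ)⁻¹ ^ 2 * (n * V) := by gcongr
      _ = V / n := by field_simp
  have hAlp : MemLp (fun ω => sampleMoment (fun t => Y (t + o) ω) n j) 2 P := by
    rw [hA]; exact hSlp.const_mul _
  have h := meas_ge_le_variance_div_sq hAlp hc
  rw [hAmean] at h
  refine h.trans (ENNReal.ofReal_le_ofReal ?_)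
  rw [← div_div]
  gcongr

/-- The noisy samples are identically distributed and pairwise independent. -/
theorem hasLaw_noisy {Ω : Type*} [MeasurableSpace Ω] {P : Measure Ω} [IsProbabilityMeasure P]
    {X Z : ℕ → Ω → ℝ} {F : Mixture} (hF : F.IsGMM) (hX : ∀ n, HasLaw (X n) F.law P)
    (hZ : ∀ n, HasLaw (Z n) (gaussianReal 0 (1 / 2)) P)
    (hind : iIndepFun (Sum.elim X Z : ℕ ⊕ ℕ → Ω → ℝ) P) :
    (∀ n, HasLaw (X n + Z n) F.noisy.law P) ∧
      Pairwise fun a b => IndepFun (X a + Z a) (X b + Z b) P := by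
  have := hF.isProbabilityMeasure
  have hmeas : ∀ s, AEMeasurable ((Sum.elim X Z : ℕ ⊕ ℕ → Ω → ℝ) s) P := by
    rintro (n | n)
    · exact (hX n).aemeasurable
    · exact (hZ n).aemeasurable
  refine ⟨fun n => ?_, fun a b hab => ?_⟩
  · rw [← hF.law_conv]
    exact IndepFun.hasLaw_add (hX n) (hZ n)
      (hind.indepFun (i := Sum.inl n) (j := Sum.inr n) (by simp))
  · exact (hind.indepFun_prodMk_prodMk₀ hmeas (Sum.inl a) (Sum.inr a) (Sum.inl b) (Sum.inr b)
      (by simpa using hab) (by simp) (by simp) (by simpa using hab)).comp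
      (measurable_fst.add measurable_snd) (measurable_fst.add measurable_snd)

theorem IsCorrectSubdivision.deconvolved {η : ℝ} {F G : Mixture}
    (h : IsCorrectSubdivision η F.noisy G) : IsCorrectSubdivision η F G.deconvolved := by
  obtain ⟨h1, π, h2, h3, h4⟩ := h
  refine ⟨h1, π, h2, h3, fun i => ?_⟩
  have h5 := h4 i
  unfold paramDist at h5 ⊢
  change |(F.comp i).mean - (G.comp (π i)).mean| + |(F.comp i).var + 1 / 2 - (G.comp (π i)).var| ≤ η
    at h5
  change |(F.comp i).mean - (G.comp (π i)).mean| + |(F.comp i).var - ((G.comp (π i)).var - 1 / 2)| ≤ η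
  rwa [sub_sub_eq_add_sub]

/-- The strict lower bound 1/2 on the variances of the candidates is needed here: the variances must
remain positive after the noise is removed. -/
theorem Mixture.IsAdmissible.isGMM_deconvolved {G : Mixture} {ε : ℝ} (hε : 0 < ε)
    (h : G.IsAdmissible ε) : G.deconvolved.IsGMM :=
  ⟨fun i => lt_of_lt_of_le (by positivity) (h.each i).1, h.sum, fun i => sub_pos.2 (h.each i).2.2.2⟩

theorem Mixture.IsGMM.moment_le {F : Mixture} (hF : F.IsGMM) {j : ℕ} {A : ℝ}
    (h : ∀ i, |gaussMoment (F.comp i).mean (F.comp i).var j| ≤ A) : F.moment j ≤ A := by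
  calc F.moment j ≤ ∑ i, (F.comp i).weight * A := Finset.sum_le_sum fun i _ =>
        mul_le_mul_of_nonneg_left ((le_abs_self _).trans (h i)) (hF.1 i).le
    _ = A := by rw [← Finset.sum_mul, hF.2.1, one_mul]

/-- With high probability the sample moments of all the runs are accurate. -/
theorem measure_not_accurate_le {Ω : Type*} [MeasurableSpace Ω] {P : Measure Ω}
    [IsProbabilityMeasure P] {Y : ℕ → Ω → ℝ} {F : Mixture} (hF : F.IsGMM)
    (hY : ∀ n, HasLaw (Y n) F.law P) (hind : Pairwise fun a b => IndepFun (Y a) (Y b) P)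
    {N m : ℕ} {δ : ℝ} (n o : ℕ → ℕ) (c V : ℕ → ℝ) (hn : ∀ i < N, 0 < n i) (hc : ∀ i < N, 0 < c i)
    (hV : ∀ i < N, ∀ j < m, F.moment (2 * (j + 1)) ≤ V i)
    (hδ : ∀ i < N, V i / (n i * c i ^ 2) * m ≤ δ) :
    P {ω | ∃ i < N, ∃ j < m,
        c i ≤ |sampleMoment (fun t => Y (t + o i) ω) (n i) (j + 1) - F.moment (j + 1)|} ≤
      ENNReal.ofReal (N * δ) := by
  have hsub : {ω | ∃ i < N, ∃ j < m,
        c i ≤ |sampleMoment (fun t => Y (t + o i) ω) (n i) (j + 1) - F.moment (j + 1)|} ⊆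
      ⋃ i ∈ Finset.range N, ⋃ j ∈ Finset.range m, {ω |
        c i ≤ |sampleMoment (fun t => Y (t + o i) ω) (n i) (j + 1) - F.moment (j + 1)|} := by
    rintro ω ⟨i, hi, j, hj, h⟩
    simp only [Set.mem_iUnion, Finset.mem_range]
    exact ⟨i, hi, j, hj, h⟩
  refine (measure_mono hsub).trans ((measure_biUnion_finset_le _ _).trans ?_)
  have h1 : ∀ i ∈ Finset.range N, P (⋃ j ∈ Finset.range m, {ω |
      c i ≤ |sampleMoment (fun t => Y (t + o i) ω) (n i) (j + 1) - F.moment (j + 1)|}) ≤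
      ENNReal.ofReal δ := fun i hi => by
    have hi := Finset.mem_range.1 hi
    refine (measure_biUnion_finset_le _ _).trans ?_
    calc _ ≤ ∑ j ∈ Finset.range m, ENNReal.ofReal (V i / (n i * c i ^ 2)) := by
          refine Finset.sum_le_sum fun j hj => ?_
          rw [← hF.integral_pow_law]
          refine measure_sampleMoment_le hY hind (j + 1) (F.integrable_pow_law _) ?_ (o i)
            (hn i hi) (hc i hi)
          rw [hF.integral_pow_law]
          exact hV i hi j (Finset.mem_range.1 hj)
      _ = ENNReal.ofReal (V i / (n i * c i ^ 2) * m) := by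
          rw [Finset.sum_const, Finset.card_range, nsmul_eq_mul, mul_comm (_ / _),
            ENNReal.ofReal_mul (Nat.cast_nonneg _), ENNReal.ofReal_natCast]
      _ ≤ _ := ENNReal.ofReal_le_ofReal (hδ i hi)
  refine (Finset.sum_le_sum h1).trans (le_of_eq ?_)
  rw [Finset.sum_const, Finset.card_range, nsmul_eq_mul, ENNReal.ofReal_mul (Nat.cast_nonneg _),
    ENNReal.ofReal_natCast]

/-! ### The theorem. -/

theorem mainTheorem7 (k : ℕ) (hk : 1 ≤ k) :
    ∃ K : Constants,
      -- the windows of the `k ^ 2` runs are nonempty and pairwise disjoint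
      (∀ ε δ : ℝ, 0 < ε → ε ≤ 1 → 0 < δ → δ ≤ 1 →
        (∀ i < k ^ 2, (K.window k (K.precision k ε δ i) (Constants.errorProb k δ)).Nonempty) ∧
        ∀ i < k ^ 2, ∀ j < k ^ 2, i ≠ j →
          Disjoint (K.window k (K.precision k ε δ i) (Constants.errorProb k δ))
            (K.window k (K.precision k ε δ j) (Constants.errorProb k δ))) ∧
      -- the running time is polynomial in `1 / ε` and `1 / δ`, whatever the samples are
      (∃ (A : ℝ) (d : ℕ), ∀ ε δ : ℝ, 0 < ε → 0 < δ → ∀ x z : ℕ → ℝ,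
        ((Prog.generalUnivariate K k ε δ).steps x z : ℝ) ≤ A * (1 + 1 / ε + 1 / δ) ^ d) ∧
      -- with probability at least `1 - δ` the output is an `ε`-correct subdivision
      ∀ ε δ : ℝ, 0 < ε → 0 < δ →
      ∀ F : Mixture, F.IsGMM → F.size ≤ k → F.NearIsotropic →
        (∀ i, ε ≤ (F.comp i).weight) →
      ∀ (Ω : Type*) [MeasurableSpace Ω] (P : Measure Ω) [IsProbabilityMeasure P]
        (X Z : ℕ → Ω → ℝ),
        (∀ n, HasLaw (X n) F.law P) → (∀ n, HasLaw (Z n) (gaussianReal 0 (1 / 2)) P) →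
        iIndepFun (Sum.elim X Z : ℕ ⊕ ℕ → Ω → ℝ) P →
        P {ω | ¬ ∃ G : Mixture,
            (Prog.generalUnivariate K k ε δ).run (fun n => X n ω) (fun n => Z n ω) = some G ∧
            G.IsGMM ∧ G.size ≤ k ∧ IsCorrectSubdivision ε F G} ≤ ENNReal.ofReal δ := by
  have hk' : (1 : ℝ) ≤ k := by exact_mod_cast hk
  obtain ⟨e, he⟩ := exists_matching k
  obtain ⟨D, hD1, hD⟩ := exists_gaussMoment_bounds (4 * k - 2)
  obtain ⟨D', hD1', hD'⟩ := exists_gaussMoment_bounds (2 * (4 * k - 2))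
  obtain ⟨K, hchain, hC, hK⟩ := Constants.exists_isFine k hk e hD1 hD1'
  have hS : ∀ δ : ℝ, 0 < δ → δ ≤ 1 → ∀ p, 0 < p → p ≤ 1 →
      0 < K.S k p δ ∧ K.S k p δ < K.R k p δ ∧ K.R k p δ ≤ p := fun δ hδ hδ1 p hp hp1 => by
    obtain ⟨h1, h2, h3, _⟩ := hK p δ hp hp1 hδ hδ1
    have := h1.r_le
    have := h1.r_pos
    exact ⟨h2, h3, by linarith⟩
  have herr : ∀ δ : ℝ, 0 < δ → δ ≤ 1 →
      0 < Constants.errorProb k δ ∧ Constants.errorProb k δ ≤ 1 := fun δ hδ hδ1 => by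
    have h1 : (1 : ℝ) ≤ (k : ℝ) ^ 2 := one_le_pow₀ hk'
    unfold Constants.errorProb
    exact ⟨by positivity, (div_le_one (by positivity)).2 (by linarith)⟩
  -- The constant `C` is chosen so that the loss (3 * k) ^ k ^ 2 along a chain turns the first
  -- precision into ε / 4.
  have hp0eq : ∀ ε δ : ℝ, (3 * k) ^ k ^ 2 * K.precision k ε δ 0 = ε / 4 := fun ε δ => by
    change (3 * (k : ℝ)) ^ k ^ 2 * (ε / (K.C * (k : ℝ) ^ k ^ 2)) = _
    rw [hC, mul_pow]
    field_simp
  have hp0 : ∀ ε δ : ℝ, 0 < ε → 0 < K.precision k ε δ 0 ∧ K.precision k ε δ 0 ≤ ε / 4 :=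
    fun ε δ hε => by
      have h1 : (1 : ℝ) ≤ (3 * k) ^ k ^ 2 := one_le_pow₀ (by linarith)
      have h2 : 0 < K.precision k ε δ 0 :=
        div_pos hε (mul_pos K.C_pos (by positivity))
      refine ⟨h2, ?_⟩
      rw [← hp0eq ε δ]
      exact le_mul_of_one_le_left h2.le h1
  refine ⟨K, fun ε δ hε hε1 hδ hδ1 => ?_, Prog.exists_steps_generalUnivariate_le K k hk,
    fun ε δ hε hδ F hF hFk hiso hw Ω _ P _ X Z hX hZ hind => ?_⟩
  · obtain ⟨h1, h2⟩ := hp0 ε δ hε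
    obtain ⟨h3, h4⟩ := herr δ hδ hδ1
    obtain ⟨_, _, h5, h6⟩ := Constants.windows h1 (by linarith) (hS _ h3 h4)
    exact ⟨fun i _ => h5 i, fun i _ j _ => h6 i j⟩
  -- For δ ≥ 1 the claim is empty. The other case is reduced to ε ≤ 1: a mixture has at least one
  -- component, and its weight is between ε and 1.
  rcases le_total 1 δ with hδ1 | hδ1
  · exact prob_le_one.trans (by simpa using hδ1)
  have hε1 : ε ≤ 1 := by
    have hpos : 0 < F.size := by
      rcases Nat.eq_zero_or_pos F.size with h | h
      · have : IsEmpty (Fin F.size) := by rw [h]; infer_instance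
        have := hF.2.1
        simp at this
      · exact h
    rw [← hF.2.1]
    exact (hw ⟨0, hpos⟩).trans (Finset.single_le_sum (f := fun i => (F.comp i).weight)
      (fun i _ => (hF.1 i).le) (Finset.mem_univ _))
  set δ' := Constants.errorProb k δ with hδ'
  obtain ⟨hδ'0, hδ'1⟩ := herr δ hδ hδ1
  set p := K.precision k ε δ with hp
  obtain ⟨hp0', hp0ε⟩ := hp0 ε δ hε
  obtain ⟨hanti, hranti, _, hdisj⟩ := Constants.windows hp0' (by linarith) (hS _ hδ'0 hδ'1)
  have hb : ∀ i, 0 < p i ∧ p i ≤ 1 :=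
    Constants.precision_pos_le hp0' (by linarith) (hS _ hδ'0 hδ'1)
  have hfine := fun i => hK (p i) δ' (hb i).1 (hb i).2 hδ'0 hδ'1
  -- The parameters of F are at most 3 / ε, and the noise adds 1/2 ≤ 1 / ε to the variances, so 4 /
  -- ε bounds the noisy mixture.
  have hp0inv : 4 / ε ≤ 1 / p 0 := by
    rw [div_le_div_iff₀ hε hp0']; linarith
  have h3ε : 3 ≤ 3 / ε := by rw [le_div_iff₀ hε]; linarith
  have h4ε : 4 / ε = 3 / ε + 1 / 3 * (3 / ε) := by ring
  have hμ : ∀ i, |(F.noisy.comp i).mean| ≤ 1 / p 0 := fun i => by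
    have := (hF.param_le hiso hε hε1 hw i).1
    change |(F.comp i).mean| ≤ _
    linarith
  have hv : ∀ i, 1 / 2 < (F.noisy.comp i).var ∧ (F.noisy.comp i).var ≤ 1 / p 0 := fun i => by
    have h1 := (hF.param_le hiso hε hε1 hw i).2
    have h2 := hF.2.2 i
    change 1 / 2 < (F.comp i).var + 1 / 2 ∧ (F.comp i).var + 1 / 2 ≤ _
    constructor <;> linarith
  obtain ⟨hlaw, hpair⟩ := hasLaw_noisy hF hX hZ hind
  set o : ℕ → ℕ := Prog.offset K k (p 0) δ' with ho
  have hbad := measure_not_accurate_le (N := k ^ 2) (m := 4 * k - 2) (δ := δ') hF.noisy hlaw hpair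
    (fun i => K.numSamples (p i) δ') o (fun i => K.accuracy (p i) / 4)
    (fun i => D' * (1 / p i) ^ (2 * (4 * k - 2)))
    (fun i _ => Nat.ceil_pos.2 (div_pos K.CB_pos (pow_pos (mul_pos (hb i).1 hδ'0) _)))
    (fun i _ => div_pos (mul_pos K.cα_pos (pow_pos (hb i).1 _)) (by norm_num))
    (fun i _ j hj => hF.noisy.moment_le fun l => by
      have hinv : 1 / p 0 ≤ 1 / p i := one_div_le_one_div_of_le (hb i).1 (hanti (Nat.zero_le i))
      refine (hD' (2 * (j + 1)) (by omega) (1 / p i) ?_).1 _ _ ((hμ l).trans hinv) ?_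
      · rw [le_div_iff₀ (hb i).1]; linarith [(hb i).2]
      · rw [abs_of_nonneg (by linarith [(hv l).1])]
        exact (hv l).2.trans hinv)
    (fun i _ => (hfine i).2.2.2)
  -- A union bound over the runs; the total error probability is in fact at most δ / 2.
  have hle : ((k ^ 2 : ℕ) : ℝ) * δ' ≤ δ := by
    rw [hδ', Constants.errorProb]
    push_cast
    rw [show (k : ℝ) ^ 2 * (δ / (2 * (k : ℝ) ^ 2)) = δ / 2 by field_simp]
    linarith
  -- Whenever all sample moments are accurate, the analysis is deterministic. The failure event is
  -- thus contained in the event of an inaccurate moment, and its own measurability does not matter.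
  refine le_trans (measure_mono fun ω hω => ?_) (hbad.trans (ENNReal.ofReal_le_ofReal hle))
  by_contra hacc
  simp only [Set.mem_ofPred_eq] at hacc hω
  push Not at hacc
  refine hω ?_
  obtain ⟨est, hest, hres⟩ := Prog.exists_run_generalUnivariate K k ε δ (fun n => X n ω) fun n => Z n ω
  obtain ⟨⟨T, hT, G, hTG⟩, hsound⟩ := chainValue_of_accurate K hk he hD1 hD
    (fun i => hanti (Nat.zero_le i)) hranti (fun i _ => (hfine i).1)
    (fun i _ j _ => hdisj i j) (F := F.noisy) hFk (fun i => by
      change p 0 ≤ (F.comp i).weight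
      linarith [hw i]) hF.noisy.2.1 hμ hv
    (s := fun i => sampleMoment (fun t => (X (t + o i) + Z (t + o i)) ω) (K.numSamples (p i) δ'))
    (fun i hi j h1 hj => by
      obtain ⟨l, rfl⟩ : ∃ l, j = l + 1 := ⟨j - 1, by omega⟩
      rw [abs_sub_comm]
      exact (hacc i hi l (by omega)).le) hest
  rw [hchain] at hres
  rcases hres with ⟨H, T', hT', hH, hrun⟩ | hres
  · obtain ⟨hsub, i, hi⟩ := hsound T' H hT' hH
    obtain ⟨hsize, hadm, _⟩ := (hest i).1 H hi
    refine ⟨H.deconvolved, hrun, hadm.isGMM_deconvolved (hb i).1, hsize, hsub.deconvolved.mono ?_⟩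
    rw [hp0eq]
    linarith
  · have h := hres T hT
    change chainValue (2 * k * p 0) est T _ none = none at h
    rw [hTG] at h
    simp at h
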